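/- **Setting.** All spaces are over a field $k$; algebras are associative, not necessarily unital, with nondegenerate product, and $M(X)$ denotes the multiplier algebra of $X$. Let $Q$ be a multiplier Hopf algebra: an algebra with local units and a homomorphism $\Delta:Q\to M(Q\otimes Q)$ such that $T_1(x\otimes y)=\Delta(x)(1\otimes y)$ and $T_2(x\otimes y)=(x\otimes1)\Delta(y)$ define bijections of $Q\otimes Q$ with $(T_2\otimes\iota)(\iota\otimes T_1)=(\iota\otimes T_1)(T_2\otimes\iota)$. It is regular if the flip of $\Delta$ is again such a comultiplication; then it has a bijective antipode $S:Q\to Q$. Let $A$ be a right $Q$-comodule algebra, that is, there is an injective homomorphism $\Upsilon:A\to M(A\otimes Q)$, $a\mapsto\sum a_0\otimes a_{(1)}$, with $\Upsilon(a)(1\otimes x),(1\otimes x)\Upsilon(a)\in A\otimes Q$ and $(\Upsilon\otimes\iota)\Upsilon=(\iota\otimes\Delta)\Upsilon$. Let $B$ be a left $Q$-comodule algebra, that is, there is an injective homomorphism $\Gamma:B\to M(Q\otimes B)$, $b\mapsto\sum b_{(-1)}\otimes b_0$, with $\Gamma(b)(x\otimes 1),(x\otimes1)\Gamma(b)\in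 Q\otimes B$ and $(\iota\otimes\Gamma)\Gamma=(\Delta\otimes\iota)\Gamma$. Let $C$ be a $Q$-bimodule algebra, that is, an algebra with commuting unital actions $\rhd$ (left) and $\lhd$ (right) of $Q$ satisfying $x\rhd(cc')=\sum(x_1\rhd c)(x_2\rhd c')$ and $(cc')\lhd x=\sum(c\lhd x_1)(c'\lhd x_2)$. For a right (left) $Q$-comodule algebra $X$ and an algebra $V$ with a unital right (left) $Q$-action, $X\#_r^QV$ is $X\otimes V$ with product $(x'\#v')(x\#v)=\sum x'x_0\#(v'\lhd x_{(1)})v$, and $V\#_l^QX$ is $V\otimes X$ with product $(v\#x)(v'\#x')=\sum v(x_{(-1)}\rhd v')\#x_0x'$, respectively. For a $Q$-bicomodule algebra $X$ (a left and right $Q$-comodule algebra with commuting coactions): * $X\diamond_r^QC=X\otimes C$ with $(x'\diamond c')(x\diamond c)=\sum x'_0x_0\diamond(c'\lhd x_{(1)})(x'_{(-1)}\rhd c)$; * $C\diamond_l^QX=C\otimes X$ with $(c\diamond x)(c'\diamond x')=\sum(c\lhd x'_{(1)})(x_{(-1)}\rhd c')\diamond x_0x'_0$; * for regular $Q$, $X\star_r^QC=X\otimes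 C$ with $(x'\star c')(x\star c)=\sum x'x_0\star(S^{-1}(x_{(-1)})\rhd c'\lhd x_{(1)})c$, and $C\star_l^QX=C\otimes X$ with $(c\star x)(c'\star x')=\sum c(x_{(-1)}\rhd c'\lhd S^{-1}(x_{(1)}))\star x_0x'$. **Statement.** The two-sided L-R-smash product $A\bowtie_r^QC\bowtie_l^QB$, that is, $A\otimes C\otimes B$ with the multiplication $$(a\bowtie c\bowtie b)(a'\bowtie c'\bowtie b')=\sum aa'_0\bowtie(c\lhd a'_{(1)})(b_{(-1)}\rhd c')\bowtie b_0b',$$ is an associative algebra; $A\otimes B$ with the coactions $a\otimes b\mapsto\sum b_{(-1)}\otimes(a\otimes b_0)$ and $a\otimes b\mapsto\sum(a_0\otimes b)\otimes a_{(1)}$ is a $Q$-bicomodule algebra; and: 1. $\phi:(A\otimes B)\diamond_r^QC\to A\bowtie_r^QC\bowtie_l^QB$, $\phi((a\otimes b)\diamond c)=a\bowtie c\bowtie b$, is an algebra isomorphism. 2. $\psi:C\diamond_l^Q(A\otimes B)\to A\bowtie_r^QC\bowtie_l^QB$, $\psi(c\diamond(a\otimes b))=a\bowtie c\bowtie b$,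 is an algebra isomorphism. 3. If $Q$ is regular, then $(A\otimes B)\star_r^QC\cong(A\otimes B)\diamond_r^QC\cong C\diamond_l^Q(A\otimes B)\cong C\star_l^Q(A\otimes B)$ as algebras. 4. $A\#_r^QC$ and $C\#_l^QB$ are associative algebras; $A\#_r^QC$ is a left $Q$-module algebra by $x\rhd(a\#c)=a\#(x\rhd c)$, and $C\#_l^QB$ is a right $Q$-module algebra by $(c\#b)\lhd x=(c\lhd x)\#b$; and with these actions $(A\#_r^QC)\#_l^QB=A\#_r^Q(C\#_l^QB)=A\bowtie_r^QC\bowtie_l^QB$ under the canonical identification of the underlying spaces. -/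

import Mathlib

open scoped TensorProduct

set_option linter.unusedSectionVars false

noncomputable section

/-! ### Algebras with or without unit -/

/-- The product of the (possibly non-unital) algebra `A` is nondegenerate. -/
class NondegenerateProduct (A : Type*) [NonUnitalNonAssocRing A] : Prop where
  left : ∀ a : A, (∀ b : A, a * b = 0) → a = 0
  right : ∀ a : A, (∀ b : A, b * a = 0) → a = 0

/-- `A` has local units: every finite subset of `A` has a common left unit and a common
right unit in `A`. -/
class LocalUnits (A : Type*) [NonUnitalNonAssocRing A] : Prop where
  exists_unit : ∀ s : Finset A, ∃ e f : A, ∀ a ∈ s, e * a = a ∧ a * f = a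

section NondegenerateTensor

variable {k : Type*} [Field k]

theorem rTensor_jointly_injective {X X' Y ι : Type*} [AddCommGroup X] [Module k X]
    [AddCommGroup X'] [Module k X'] [AddCommGroup Y] [Module k Y]
    (f : ι → X →ₗ[k] X') (hf : ∀ x, (∀ i, f i x = 0) → x = 0)
    (z : X ⊗[k] Y) (hz : ∀ i, LinearMap.rTensor Y (f i) z = 0) : z = 0 := by
  classical
  let b := Module.Basis.ofVectorSpace k Y
  apply (TensorProduct.equivFinsuppOfBasisRight (M := X) b).injective
  rw [map_zero]
  ext j
  rw [TensorProduct.equivFinsuppOfBasisRight_apply]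
  apply hf
  intro i
  have key : ∀ w : X ⊗[k] Y, f i (TensorProduct.rid k X ((b.coord j).lTensor X w)) =
      TensorProduct.rid k X' ((b.coord j).lTensor X' (LinearMap.rTensor Y (f i) w)) := by
    intro w
    induction w with
    | zero => simp
    | tmul x y => simp
    | add u v hu hv => simp only [map_add, hu, hv]
  rw [key, hz i, map_zero, map_zero]

theorem lTensor_jointly_injective {X Y Y' ι : Type*} [AddCommGroup X] [Module k X]
    [AddCommGroup Y'] [Module k Y'] [AddCommGroup Y] [Module k Y]
    (f : ι → Y →ₗ[k] Y') (hf : ∀ x, (∀ i, f i x = 0) → x = 0)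
    (z : X ⊗[k] Y) (hz : ∀ i, LinearMap.lTensor X (f i) z = 0) : z = 0 := by
  apply (TensorProduct.comm k X Y).injective
  rw [map_zero]
  apply rTensor_jointly_injective f hf
  intro i
  rw [← LinearMap.comm_comp_lTensor_comp_comm_eq]
  simp [hz i]

variable {A B : Type*}
  [NonUnitalRing A] [Module k A] [IsScalarTower k A A] [SMulCommClass k A A]
  [NonUnitalRing B] [Module k B] [IsScalarTower k B B] [SMulCommClass k B B]

instance [NondegenerateProduct A] [NondegenerateProduct B] :
    NondegenerateProduct (A ⊗[k] B) where
  left z hz := by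
    have key : ∀ (a : A) (b : B) (w : A ⊗[k] B),
        LinearMap.lTensor A (LinearMap.mulRight k b)
          (LinearMap.rTensor B (LinearMap.mulRight k a) w) = w * (a ⊗ₜ[k] b) := by
      intro a b w
      induction w with
      | zero => simp
      | tmul x y => simp
      | add u v hu hv => simp only [map_add, hu, hv, add_mul]
    refine rTensor_jointly_injective (fun a : A => LinearMap.mulRight k a)
      (fun x hx => NondegenerateProduct.left x hx) z fun a => ?_
    refine lTensor_jointly_injective (fun b : B => LinearMap.mulRight k b)
      (fun x hx => NondegenerateProduct.left x hx) _ fun b => ?_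
    rw [key, hz]
  right z hz := by
    have key : ∀ (a : A) (b : B) (w : A ⊗[k] B),
        LinearMap.lTensor A (LinearMap.mulLeft k b)
          (LinearMap.rTensor B (LinearMap.mulLeft k a) w) = (a ⊗ₜ[k] b) * w := by
      intro a b w
      induction w with
      | zero => simp
      | tmul x y => simp
      | add u v hu hv => simp only [map_add, hu, hv, mul_add]
    refine rTensor_jointly_injective (fun a : A => LinearMap.mulLeft k a)
      (fun x hx => NondegenerateProduct.right x hx) z fun a => ?_
    refine lTensor_jointly_injective (fun b : B => LinearMap.mulLeft k b)
      (fun x hx => NondegenerateProduct.right x hx) _ fun b => ?_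
    rw [key, hz]

end NondegenerateTensor

/-! ### The multiplier algebra -/

section MultiplierAlgebra

variable (k : Type*) [Field k]
variable (A : Type*) [NonUnitalRing A] [Module k A] [IsScalarTower k A A] [SMulCommClass k A A]

/-- The multipliers of `A` as a unital algebra: pairs `(m₁, m₂)` of linear endomorphisms of `A`
with `m₂(a) b = a m₁(b)`. Here `m₁` is left multiplication by the multiplier and `m₂` is right
multiplication by it, so that the `m₁` compose covariantly and the `m₂` contravariantly. -/
def multiplierSubalgebra : Subalgebra k (Module.End k A × (Module.End k A)ᵐᵒᵖ) where
  carrier := {m | ∀ a b : A, m.2.unop a * b = a * m.1 b}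
  mul_mem' := by
    intro m n hm hn a b
    simp only [Prod.snd_mul, MulOpposite.unop_mul, Module.End.mul_apply, Prod.fst_mul]
    rw [hn, hm]
  add_mem' := by
    intro m n hm hn a b
    simp only [Prod.snd_add, MulOpposite.unop_add, LinearMap.add_apply, Prod.fst_add]
    rw [add_mul, mul_add, hm, hn]
  algebraMap_mem' := by
    intro r a b
    simp [Prod.algebraMap_apply, Module.algebraMap_end_apply, MulOpposite.algebraMap_apply,
      smul_mul_assoc, mul_smul_comm]

/-- The multiplier algebra `M(A)`. -/
def Multiplier : Type _ := multiplierSubalgebra k A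

instance : Ring (Multiplier k A) := inferInstanceAs (Ring (multiplierSubalgebra k A))

instance : Algebra k (Multiplier k A) := inferInstanceAs (Algebra k (multiplierSubalgebra k A))

end MultiplierAlgebra

namespace Multiplier

variable {k : Type*} [Field k]
variable {A : Type*} [NonUnitalRing A] [Module k A] [IsScalarTower k A A] [SMulCommClass k A A]
variable {B : Type*} [NonUnitalRing B] [Module k B] [IsScalarTower k B B] [SMulCommClass k B B]

/-- `m.left a` is the product `m · a`. -/
def left (m : Multiplier k A) : A →ₗ[k] A := m.1.1

/-- `m.right a` is the product `a · m`. -/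
def right (m : Multiplier k A) : A →ₗ[k] A := m.1.2.unop

theorem right_mul (m : Multiplier k A) (a b : A) : m.right a * b = a * m.left b := m.2 a b

/-- The multiplier with given left and right multiplications. -/
def mk (l r : A →ₗ[k] A) (h : ∀ a b, r a * b = a * l b) : Multiplier k A :=
  ⟨(l, MulOpposite.op r), h⟩

@[simp] theorem mk_left (l r : A →ₗ[k] A) (h) : (mk l r h).left = l := rfl
@[simp] theorem mk_right (l r : A →ₗ[k] A) (h) : (mk l r h).right = r := rfl

@[ext] theorem ext' {m n : Multiplier k A} (h₁ : m.left = n.left) (h₂ : m.right = n.right) :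
    m = n :=
  Subtype.ext (Prod.ext h₁ (MulOpposite.unop_injective h₂))

@[simp] theorem one_left : (1 : Multiplier k A).left = LinearMap.id := rfl
@[simp] theorem one_right : (1 : Multiplier k A).right = LinearMap.id := rfl
@[simp] theorem mul_left (m n : Multiplier k A) : (m * n).left = m.left ∘ₗ n.left := rfl
@[simp] theorem mul_right (m n : Multiplier k A) : (m * n).right = n.right ∘ₗ m.right := rfl
@[simp] theorem add_left (m n : Multiplier k A) : (m + n).left = m.left + n.left := rfl
@[simp] theorem add_right (m n : Multiplier k A) : (m + n).right = m.right + n.right := rfl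
@[simp] theorem smul_left (c : k) (m : Multiplier k A) : (c • m).left = c • m.left := rfl
@[simp] theorem smul_right (c : k) (m : Multiplier k A) : (c • m).right = c • m.right := rfl
@[simp] theorem zero_left : (0 : Multiplier k A).left = 0 := rfl
@[simp] theorem zero_right : (0 : Multiplier k A).right = 0 := rfl

variable (k) in
/-- The canonical map `A → M(A)`, `a ↦ (a ·, · a)`. -/
def of (a : A) : Multiplier k A :=
  mk (LinearMap.mulLeft k a) (LinearMap.mulRight k a) fun x y => by simp [mul_assoc]

@[simp] theorem of_left (a : A) : (of k a).left = LinearMap.mulLeft k a := rfl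
@[simp] theorem of_right (a : A) : (of k a).right = LinearMap.mulRight k a := rfl

theorem of_injective [NondegenerateProduct A] : Function.Injective (of k (A := A)) := by
  intro a b h
  rw [← sub_eq_zero]
  apply NondegenerateProduct.left
  intro c
  have := LinearMap.congr_fun (congrArg left h) c
  simp only [of_left, LinearMap.mulLeft_apply] at this
  rw [sub_mul, this, sub_self]

/-- The canonical map `M(A) × M(B) → M(A ⊗ B)`, `(m, n) ↦ m ⊗ n`. -/
def tmul (m : Multiplier k A) (n : Multiplier k B) : Multiplier k (A ⊗[k] B) :=
  mk (TensorProduct.map m.left n.left) (TensorProduct.map m.right n.right) fun x y => by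
    induction x with
    | zero => simp
    | add u v hu hv => simp only [map_add, add_mul, hu, hv]
    | tmul a b =>
      induction y with
      | zero => simp
      | add u v hu hv => simp only [map_add, mul_add, hu, hv]
      | tmul c d => simp [right_mul]

@[simp] theorem tmul_left (m : Multiplier k A) (n : Multiplier k B) :
    (tmul m n).left = TensorProduct.map m.left n.left := rfl
@[simp] theorem tmul_right (m : Multiplier k A) (n : Multiplier k B) :
    (tmul m n).right = TensorProduct.map m.right n.right := rfl

variable (k A) in
/-- The canonical map `A → M(A)` as a linear map. -/
def ofLinear : A →ₗ[k] Multiplier k A where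
  toFun := of k
  map_add' a b := by ext <;> simp [add_mul, mul_add]
  map_smul' c a := by ext <;> simp [smul_mul_assoc, mul_smul_comm]

@[simp] theorem ofLinear_apply (a : A) : ofLinear k A a = of k a := rfl

variable (k A B) in
/-- The canonical map `M(A) × M(B) → M(A ⊗ B)` as a bilinear map. -/
def tmulBilinear : Multiplier k A →ₗ[k] Multiplier k B →ₗ[k] Multiplier k (A ⊗[k] B) :=
  LinearMap.mk₂ k tmul
    (fun _ _ _ => ext' (TensorProduct.map_add_left _ _ _) (TensorProduct.map_add_left _ _ _))
    (fun _ _ _ => ext' (TensorProduct.map_smul_left _ _ _) (TensorProduct.map_smul_left _ _ _))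
    (fun _ _ _ => ext' (TensorProduct.map_add_right _ _ _) (TensorProduct.map_add_right _ _ _))
    (fun _ _ _ => ext' (TensorProduct.map_smul_right _ _ _) (TensorProduct.map_smul_right _ _ _))

@[simp] theorem tmulBilinear_apply (m : Multiplier k A) (n : Multiplier k B) :
    tmulBilinear k A B m n = tmul m n := rfl

/-- The map `M(A) → M(B)` induced by a linear isomorphism `A ≃ B` that preserves products. -/
def congr (e : A ≃ₗ[k] B) (he : ∀ x y, e (x * y) = e x * e y) :
    Multiplier k A →ₗ[k] Multiplier k B where
  toFun m := mk (e.toLinearMap ∘ₗ m.left ∘ₗ e.symm.toLinearMap)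
    (e.toLinearMap ∘ₗ m.right ∘ₗ e.symm.toLinearMap) fun x y => by
      obtain ⟨x, rfl⟩ := e.surjective x
      obtain ⟨y, rfl⟩ := e.surjective y
      simp [← he, right_mul]
  map_add' m n := by ext <;> simp
  map_smul' c m := by ext <;> simp

@[simp] theorem congr_left (e : A ≃ₗ[k] B) (he) (m : Multiplier k A) :
    (congr e he m).left = e.toLinearMap ∘ₗ m.left ∘ₗ e.symm.toLinearMap := rfl
@[simp] theorem congr_right (e : A ≃ₗ[k] B) (he) (m : Multiplier k A) :
    (congr e he m).right = e.toLinearMap ∘ₗ m.right ∘ₗ e.symm.toLinearMap := rfl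

theorem of_tmul (a : A) (b : B) : of k (a ⊗ₜ[k] b) = tmul (of k a) (of k b) := by
  ext <;> simp

theorem tmul_mul (m m' : Multiplier k A) (n n' : Multiplier k B) :
    tmul m n * tmul m' n' = tmul (m * m') (n * n') :=
  ext' (TensorProduct.map_comp _ _ _ _).symm (TensorProduct.map_comp _ _ _ _).symm

theorem of_mul (a b : A) : of k (a * b) = of k a * of k b := by
  ext <;> simp [mul_assoc]

theorem congr_of (e : A ≃ₗ[k] B) (he) (a : A) : congr e he (of k a) = of k (e a) := by
  ext x <;> simp [he]

theorem congr_mul (e : A ≃ₗ[k] B) (he) (m n : Multiplier k A) :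
    congr e he (m * n) = congr e he m * congr e he n := by
  ext x <;> simp

end Multiplier

/-! ### Permutations of tensor factors preserve products -/

section Permutations

variable {k : Type*} [Field k]
variable {A : Type*} [NonUnitalRing A] [Module k A] [IsScalarTower k A A] [SMulCommClass k A A]
variable {B : Type*} [NonUnitalRing B] [Module k B] [IsScalarTower k B B] [SMulCommClass k B B]
variable {C : Type*} [NonUnitalRing C] [Module k C] [IsScalarTower k C C] [SMulCommClass k C C]

theorem comm_map_mul (x y : A ⊗[k] B) : TensorProduct.comm k A B (x * y) =
    TensorProduct.comm k A B x * TensorProduct.comm k A B y := by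
  induction x with
  | zero => simp
  | add u v hu hv => simp only [map_add, add_mul, hu, hv]
  | tmul a b =>
    induction y with
    | zero => simp
    | add u v hu hv => simp only [map_add, mul_add, hu, hv]
    | tmul c d => simp

theorem leftComm_map_mul (x y : A ⊗[k] (B ⊗[k] C)) :
    TensorProduct.leftComm k A B C (x * y) =
      TensorProduct.leftComm k A B C x * TensorProduct.leftComm k A B C y := by
  induction x with
  | zero => simp
  | add u v hu hv => simp only [map_add, add_mul, hu, hv]
  | tmul a x =>
    induction x with
    | zero => simp
    | add u v hu hv => simp only [map_add, add_mul, TensorProduct.tmul_add, hu, hv]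
    | tmul b c =>
      induction y with
      | zero => simp
      | add u v hu hv => simp only [map_add, mul_add, hu, hv]
      | tmul a' y =>
        induction y with
        | zero => simp
        | add u v hu hv => simp only [map_add, mul_add, TensorProduct.tmul_add, hu, hv]
        | tmul b' c' => simp

theorem rightComm_map_mul (x y : (A ⊗[k] B) ⊗[k] C) :
    TensorProduct.rightComm k A B C (x * y) =
      TensorProduct.rightComm k A B C x * TensorProduct.rightComm k A B C y := by
  induction x with
  | zero => simp
  | add u v hu hv => simp only [map_add, add_mul, hu, hv]
  | tmul x c =>
    induction x with
    | zero => simp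
    | add u v hu hv => simp only [map_add, add_mul, TensorProduct.add_tmul, hu, hv]
    | tmul a b =>
      induction y with
      | zero => simp
      | add u v hu hv => simp only [map_add, mul_add, hu, hv]
      | tmul y c' =>
        induction y with
        | zero => simp
        | add u v hu hv => simp only [map_add, mul_add, TensorProduct.add_tmul, hu, hv]
        | tmul a' b' => simp

variable (k A B C) in
/-- The isomorphism `M(A ⊗ (B ⊗ C)) ≃ M(B ⊗ (A ⊗ C))` interchanging the first two factors. -/
def Multiplier.leftComm : Multiplier k (A ⊗[k] (B ⊗[k] C)) →ₗ[k] Multiplier k (B ⊗[k] (A ⊗[k] C)) :=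
  Multiplier.congr (TensorProduct.leftComm k A B C) leftComm_map_mul

variable (k A B C) in
/-- The isomorphism `M((A ⊗ B) ⊗ C) ≃ M((A ⊗ C) ⊗ B)` interchanging the last two factors. -/
def Multiplier.rightComm :
    Multiplier k ((A ⊗[k] B) ⊗[k] C) →ₗ[k] Multiplier k ((A ⊗[k] C) ⊗[k] B) :=
  Multiplier.congr (TensorProduct.rightComm k A B C) rightComm_map_mul

theorem Multiplier.leftComm_of (z : A ⊗[k] (B ⊗[k] C)) :
    Multiplier.leftComm k A B C (Multiplier.of k z) =
      Multiplier.of k (TensorProduct.leftComm k A B C z) :=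
  Multiplier.congr_of _ _ z

theorem Multiplier.rightComm_of (z : (A ⊗[k] B) ⊗[k] C) :
    Multiplier.rightComm k A B C (Multiplier.of k z) =
      Multiplier.of k (TensorProduct.rightComm k A B C z) :=
  Multiplier.congr_of _ _ z

theorem Multiplier.leftComm_mul (m n : Multiplier k (A ⊗[k] (B ⊗[k] C))) :
    Multiplier.leftComm k A B C (m * n) =
      Multiplier.leftComm k A B C m * Multiplier.leftComm k A B C n :=
  Multiplier.congr_mul _ _ m n

theorem Multiplier.rightComm_mul (m n : Multiplier k ((A ⊗[k] B) ⊗[k] C)) :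
    Multiplier.rightComm k A B C (m * n) =
      Multiplier.rightComm k A B C m * Multiplier.rightComm k A B C n :=
  Multiplier.congr_mul _ _ m n

theorem Multiplier.leftComm_tmul (m : Multiplier k B) :
    Multiplier.leftComm k A B C (Multiplier.tmul 1 (Multiplier.tmul m 1)) =
      Multiplier.tmul m 1 := by
  ext <;> simp [Multiplier.leftComm]

theorem Multiplier.rightComm_tmul (m : Multiplier k B) :
    Multiplier.rightComm k A B C (Multiplier.tmul (Multiplier.tmul 1 m) 1) =
      Multiplier.tmul 1 m := by
  ext <;> simp [Multiplier.rightComm]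

end Permutations

/-! ### Multiplier Hopf algebras -/

/-- A multiplier Hopf algebra structure on `Q`: a comultiplication `Δ : Q → M(Q ⊗ Q)` (an algebra
homomorphism) such that `T₁(x ⊗ y) = Δ(x)(1 ⊗ y)` and `T₂(x ⊗ y) = (x ⊗ 1)Δ(y)` lie in `Q ⊗ Q`,
such that `(T₂ ⊗ id)(id ⊗ T₁) = (id ⊗ T₁)(T₂ ⊗ id)`, and such that `T₁`, `T₂` are bijective.
(`T₁` and `T₂` are determined by `Δ` because the product of `Q` is nondegenerate.) -/
structure MultiplierHopf (k Q : Type*) [Field k] [NonUnitalRing Q] [Module k Q]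
    [IsScalarTower k Q Q] [SMulCommClass k Q Q] where
  comul : Q →ₙₐ[k] Multiplier k (Q ⊗[k] Q)
  T₁ : (Q ⊗[k] Q) ≃ₗ[k] (Q ⊗[k] Q)
  T₂ : (Q ⊗[k] Q) ≃ₗ[k] (Q ⊗[k] Q)
  T₁_spec : ∀ x y : Q, Multiplier.of k (T₁ (x ⊗ₜ y)) =
    comul x * Multiplier.tmul (1 : Multiplier k Q) (Multiplier.of k y)
  T₂_spec : ∀ x y : Q, Multiplier.of k (T₂ (x ⊗ₜ y)) =
    Multiplier.tmul (Multiplier.of k x) (1 : Multiplier k Q) * comul y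
  coassoc : ∀ x y z : Q,
    TensorProduct.assoc k Q Q Q (LinearMap.rTensor Q T₂.toLinearMap
      ((TensorProduct.assoc k Q Q Q).symm (x ⊗ₜ T₁ (y ⊗ₜ z)))) =
    LinearMap.lTensor Q T₁.toLinearMap
      (TensorProduct.assoc k Q Q Q (T₂ (x ⊗ₜ y) ⊗ₜ z))

namespace MultiplierHopf

variable {k Q : Type*} [Field k] [NonUnitalRing Q] [Module k Q]
  [IsScalarTower k Q Q] [SMulCommClass k Q Q]

/-- `Q` is regular if `τΔ`, with `τ` the flip, is again the comultiplication of a multiplier Hopf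
algebra structure on `Q`. -/
def IsRegular (H : MultiplierHopf k Q) : Prop :=
  ∃ H' : MultiplierHopf k Q, ∀ x : Q,
    H'.comul x = Multiplier.congr (TensorProduct.comm k Q Q) comm_map_mul (H.comul x)

/-- A bijective antipode of a multiplier Hopf algebra: a counit `ε` and a bijective
anti-multiplicative linear map `S : Q → Q` with `(ε ⊗ ι)(Δ(x)(1 ⊗ y)) = xy`,
`(ι ⊗ ε)((x ⊗ 1)Δ(y)) = xy`, `m(S ⊗ ι)(Δ(x)(1 ⊗ y)) = ε(x)y` and
`m(ι ⊗ S)((x ⊗ 1)Δ(y)) = ε(y)x`. -/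
structure Antipode (H : MultiplierHopf k Q) where
  counit : Q →ₗ[k] k
  S : Q ≃ₗ[k] Q
  counit_T₁ : ∀ x y : Q,
    TensorProduct.lid k Q (LinearMap.rTensor Q counit (H.T₁ (x ⊗ₜ y))) = x * y
  counit_T₂ : ∀ x y : Q,
    TensorProduct.rid k Q (LinearMap.lTensor Q counit (H.T₂ (x ⊗ₜ y))) = x * y
  antipode_T₁ : ∀ x y : Q,
    LinearMap.mul' k Q (LinearMap.rTensor Q S.toLinearMap (H.T₁ (x ⊗ₜ y))) = counit x • y
  antipode_T₂ : ∀ x y : Q,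
    LinearMap.mul' k Q (LinearMap.lTensor Q S.toLinearMap (H.T₂ (x ⊗ₜ y))) = counit y • x
  anti_mul : ∀ x y : Q, S (x * y) = S y * S x

end MultiplierHopf

/-! ### Modules and module algebras -/

section Modules

variable (k Q : Type*) [Field k] [NonUnitalRing Q] [Module k Q]
  [IsScalarTower k Q Q] [SMulCommClass k Q Q]
variable (V : Type*) [AddCommGroup V] [Module k V]

/-- A unital left `Q`-module structure on `V`; `act x v` is `x ▷ v`. Unital means `Q ▷ V = V`. -/
structure UnitalLeftModule where
  act : Q →ₗ[k] V →ₗ[k] V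
  mul_act : ∀ x y v, act (x * y) v = act x (act y v)
  unital : Function.Surjective (TensorProduct.lift act)

/-- A unital right `Q`-module structure on `V`; `act x v` is `v ◁ x`. Unital means `V ◁ Q = V`. -/
structure UnitalRightModule where
  act : Q →ₗ[k] V →ₗ[k] V
  act_mul : ∀ x y v, act (x * y) v = act y (act x v)
  unital : Function.Surjective (TensorProduct.lift act)

end Modules

section ModuleConstructions

variable {k Q : Type*} [Field k] [NonUnitalRing Q] [Module k Q]
  [IsScalarTower k Q Q] [SMulCommClass k Q Q]
variable {V : Type*} [AddCommGroup V] [Module k V]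

theorem lift_surjective_iff_span {W : Type*} [AddCommGroup W] [Module k W]
    (f : Q →ₗ[k] V →ₗ[k] W) :
    Function.Surjective (TensorProduct.lift f) ↔
      ∀ w : W, w ∈ Submodule.span k {w | ∃ x v, f x v = w} := by
  constructor
  · intro h w
    obtain ⟨z, rfl⟩ := h w
    induction z with
    | zero => simp
    | tmul x v => exact Submodule.subset_span ⟨x, v, by simp⟩
    | add u v hu hv => rw [map_add]; exact add_mem hu hv
  · intro h w
    have : Submodule.span k {w | ∃ x v, f x v = w} ≤ LinearMap.range (TensorProduct.lift f) := by
      rw [Submodule.span_le]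
      rintro _ ⟨x, v, rfl⟩
      exact ⟨x ⊗ₜ v, by simp⟩
    exact this (h w)

/-- The left action `x ▷ (w ⊗ v) = w ⊗ (x ▷ v)` on `W ⊗ V`. -/
def UnitalLeftModule.lTensor (W : Type*) [AddCommGroup W] [Module k W]
    (M : UnitalLeftModule k Q V) : UnitalLeftModule k Q (W ⊗[k] V) where
  act := LinearMap.lTensorHom W ∘ₗ M.act
  mul_act x y z := by
    induction z with
    | zero => simp
    | tmul w v => simp [M.mul_act]
    | add u v hu hv => simp only [map_add, hu, hv]
  unital := by
    rw [lift_surjective_iff_span]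
    intro z
    induction z with
    | zero => simp
    | add u v hu hv => exact add_mem hu hv
    | tmul w v =>
      obtain ⟨t, rfl⟩ := M.unital v
      induction t with
      | zero => simp
      | add u v hu hv => rw [map_add, TensorProduct.tmul_add]; exact add_mem hu hv
      | tmul x v => exact Submodule.subset_span ⟨x, w ⊗ₜ v, by simp⟩

/-- The right action `(v ⊗ w) ◁ x = (v ◁ x) ⊗ w` on `V ⊗ W`. -/
def UnitalRightModule.rTensor (W : Type*) [AddCommGroup W] [Module k W]
    (M : UnitalRightModule k Q V) : UnitalRightModule k Q (V ⊗[k] W) where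
  act := LinearMap.rTensorHom W ∘ₗ M.act
  act_mul x y z := by
    induction z with
    | zero => simp
    | tmul w v => simp [M.act_mul]
    | add u v hu hv => simp only [map_add, hu, hv]
  unital := by
    rw [lift_surjective_iff_span]
    intro z
    induction z with
    | zero => simp
    | add u v hu hv => exact add_mem hu hv
    | tmul v w =>
      obtain ⟨t, rfl⟩ := M.unital v
      induction t with
      | zero => simp
      | add u v hu hv => rw [map_add, TensorProduct.add_tmul]; exact add_mem hu hv
      | tmul x v => exact Submodule.subset_span ⟨x, v ⊗ₜ w, by simp⟩

theorem lift_comp_equiv_surjective (S : Q ≃ₗ[k] Q) (f : Q →ₗ[k] V →ₗ[k] V)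
    (hf : Function.Surjective (TensorProduct.lift f)) :
    Function.Surjective (TensorProduct.lift (f ∘ₗ S.toLinearMap)) := by
  intro v
  obtain ⟨z, rfl⟩ := hf v
  refine ⟨LinearMap.rTensor V S.symm.toLinearMap z, ?_⟩
  induction z with
  | zero => simp
  | tmul x v => simp
  | add u v hu hv => simp only [map_add, hu, hv]

/-- The right action `v · x = S⁻¹(x) ▷ v`. -/
def UnitalLeftModule.invAntipode {H : MultiplierHopf k Q} (S : H.Antipode)
    (M : UnitalLeftModule k Q V) : UnitalRightModule k Q V where
  act := M.act ∘ₗ S.S.symm.toLinearMap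
  act_mul x y v := by
    have : S.S.symm (x * y) = S.S.symm y * S.S.symm x := by
      apply S.S.injective
      simp [S.anti_mul]
    simp [this, M.mul_act]
  unital := lift_comp_equiv_surjective _ _ M.unital

/-- The left action `x · v = v ◁ S⁻¹(x)`. -/
def UnitalRightModule.invAntipode {H : MultiplierHopf k Q} (S : H.Antipode)
    (M : UnitalRightModule k Q V) : UnitalLeftModule k Q V where
  act := M.act ∘ₗ S.S.symm.toLinearMap
  mul_act x y v := by
    have : S.S.symm (x * y) = S.S.symm y * S.S.symm x := by
      apply S.S.injective
      simp [S.anti_mul]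
    simp [this, M.act_mul]
  unital := lift_comp_equiv_surjective _ _ M.unital

end ModuleConstructions

section ModuleAlgebras

variable {k Q : Type*} [Field k] [NonUnitalRing Q] [Module k Q]
  [IsScalarTower k Q Q] [SMulCommClass k Q Q]
variable {V : Type*} [NonUnitalNonAssocRing V] [Module k V]
  [IsScalarTower k V V] [SMulCommClass k V V]

/-- `V` is a left `Q`-module algebra: `x ▷ (ab) = ∑ (x₁ ▷ a)(x₂ ▷ b)`. The factor `x₂` is covered
through `b`: as `V` is unital, it suffices to require the formula with `y ▷ b` in place of `b`,
and then `x₁ ⊗ x₂ y = Δ(x)(1 ⊗ y) = T₁(x ⊗ y)`. -/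
def UnitalLeftModule.IsModuleAlgebra (M : UnitalLeftModule k Q V) (H : MultiplierHopf k Q) :
    Prop :=
  ∀ (x y : Q) (a b : V), M.act x (a * M.act y b) =
    LinearMap.mul' k V (TensorProduct.map (M.act.flip a) (M.act.flip b) (H.T₁ (x ⊗ₜ y)))

/-- `V` is a right `Q`-module algebra: `(ab) ◁ x = ∑ (a ◁ x₁)(b ◁ x₂)`. The factor `x₁` is covered
through `a`: as `V` is unital, it suffices to require the formula with `a ◁ y` in place of `a`,
and then `y x₁ ⊗ x₂ = (y ⊗ 1)Δ(x) = T₂(y ⊗ x)`. -/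
def UnitalRightModule.IsModuleAlgebra (M : UnitalRightModule k Q V) (H : MultiplierHopf k Q) :
    Prop :=
  ∀ (x y : Q) (a b : V), M.act x (M.act y a * b) =
    LinearMap.mul' k V (TensorProduct.map (M.act.flip a) (M.act.flip b) (H.T₂ (y ⊗ₜ x)))

/-- `V` is a `Q`-bimodule algebra: a left and a right `Q`-module algebra with
`(x ▷ a) ◁ y = x ▷ (a ◁ y)`. -/
structure IsBimoduleAlgebra (H : MultiplierHopf k Q) (l : UnitalLeftModule k Q V)
    (r : UnitalRightModule k Q V) : Prop where
  left : l.IsModuleAlgebra H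
  right : r.IsModuleAlgebra H
  bimodule : ∀ (x y : Q) (a : V), r.act y (l.act x a) = l.act x (r.act y a)

end ModuleAlgebras

/-! ### Comodule algebras -/

section Coactions

variable (k Q : Type*) [Field k] [NonUnitalRing Q] [Module k Q]
  [IsScalarTower k Q Q] [SMulCommClass k Q Q]
variable (B : Type*) [NonUnitalRing B] [Module k B] [IsScalarTower k B B] [SMulCommClass k B B]

/-- A linear map `Γ : B → M(Q ⊗ B)`, `b ↦ ∑ b₍₋₁₎ ⊗ b₀`, such that
`coverR b x = Γ(b)(x ⊗ 1) = ∑ b₍₋₁₎x ⊗ b₀` and `coverL b x = (x ⊗ 1)Γ(b) = ∑ x b₍₋₁₎ ⊗ b₀`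
lie in `Q ⊗ B`. -/
structure LeftCoaction where
  coact : B →ₗ[k] Multiplier k (Q ⊗[k] B)
  coverR : B →ₗ[k] Q →ₗ[k] Q ⊗[k] B
  coverL : B →ₗ[k] Q →ₗ[k] Q ⊗[k] B
  coverR_spec : ∀ b x, Multiplier.of k (coverR b x) =
    coact b * Multiplier.tmul (Multiplier.of k x) (1 : Multiplier k B)
  coverL_spec : ∀ b x, Multiplier.of k (coverL b x) =
    Multiplier.tmul (Multiplier.of k x) (1 : Multiplier k B) * coact b

/-- A linear map `Υ : B → M(B ⊗ Q)`, `b ↦ ∑ b₀ ⊗ b₍₁₎`, such that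
`coverR b x = Υ(b)(1 ⊗ x) = ∑ b₀ ⊗ b₍₁₎x` and `coverL b x = (1 ⊗ x)Υ(b) = ∑ b₀ ⊗ x b₍₁₎`
lie in `B ⊗ Q`. -/
structure RightCoaction where
  coact : B →ₗ[k] Multiplier k (B ⊗[k] Q)
  coverR : B →ₗ[k] Q →ₗ[k] B ⊗[k] Q
  coverL : B →ₗ[k] Q →ₗ[k] B ⊗[k] Q
  coverR_spec : ∀ b x, Multiplier.of k (coverR b x) =
    coact b * Multiplier.tmul (1 : Multiplier k B) (Multiplier.of k x)
  coverL_spec : ∀ b x, Multiplier.of k (coverL b x) =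
    Multiplier.tmul (1 : Multiplier k B) (Multiplier.of k x) * coact b

end Coactions

section ComoduleAlgebras

variable {k Q : Type*} [Field k] [NonUnitalRing Q] [Module k Q]
  [IsScalarTower k Q Q] [SMulCommClass k Q Q]
variable {A : Type*} [NonUnitalRing A] [Module k A] [IsScalarTower k A A] [SMulCommClass k A A]
variable {B : Type*} [NonUnitalRing B] [Module k B] [IsScalarTower k B B] [SMulCommClass k B B]

/-- `Γ` makes `B` a left `Q`-comodule algebra: `Γ` is an injective homomorphism and
`(ι ⊗ Γ)Γ = (Δ ⊗ ι)Γ`. The last identity is written after multiplication on the right by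
`Δ(z)(1 ⊗ y) ⊗ 1 = ∑ u ⊗ v ⊗ 1` (these elements span `Q ⊗ Q ⊗ 1`):
`(Δ ⊗ ι)(Γ(b)(z ⊗ 1))(1 ⊗ y ⊗ 1) = ∑ (ι ⊗ Γ)(Γ(b)(u ⊗ 1))(1 ⊗ v ⊗ 1)` in `Q ⊗ Q ⊗ B`. -/
structure LeftCoaction.IsComoduleAlgebra (γ : LeftCoaction k Q B) (H : MultiplierHopf k Q) :
    Prop where
  map_mul : ∀ b c, γ.coact (b * c) = γ.coact b * γ.coact c
  injective : Function.Injective γ.coact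
  coassoc : ∀ (b : B) (z y : Q),
    TensorProduct.assoc k Q Q B
      (LinearMap.rTensor B (H.T₁.toLinearMap ∘ₗ (TensorProduct.mk k Q Q).flip y)
        (γ.coverR b z)) =
    TensorProduct.lift ((LinearMap.lTensorHom Q ∘ₗ γ.coverR.flip).flip ∘ₗ γ.coverR b)
      (H.T₁ (z ⊗ₜ y))

/-- `Υ` makes `A` a right `Q`-comodule algebra: `Υ` is an injective homomorphism and
`(Υ ⊗ ι)Υ = (ι ⊗ Δ)Υ`. The last identity is written after multiplication on the right by
`1 ⊗ Δ(z)(1 ⊗ y) = ∑ 1 ⊗ u ⊗ v` (these elements span `1 ⊗ Q ⊗ Q`):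
`(ι ⊗ Δ)(Υ(a)(1 ⊗ z))(1 ⊗ 1 ⊗ y) = ∑ (Υ ⊗ ι)(Υ(a)(1 ⊗ v))(1 ⊗ u ⊗ 1)` in `A ⊗ Q ⊗ Q`. -/
structure RightCoaction.IsComoduleAlgebra (υ : RightCoaction k Q A) (H : MultiplierHopf k Q) :
    Prop where
  map_mul : ∀ a c, υ.coact (a * c) = υ.coact a * υ.coact c
  injective : Function.Injective υ.coact
  coassoc : ∀ (a : A) (z y : Q),
    LinearMap.lTensor A (H.T₁.toLinearMap ∘ₗ (TensorProduct.mk k Q Q).flip y)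
      (υ.coverR a z) =
    TensorProduct.assoc k A Q Q
      (TensorProduct.lift
        (((LinearMap.rTensorHom Q ∘ₗ υ.coverR.flip).flip ∘ₗ υ.coverR a).flip)
        (H.T₁ (z ⊗ₜ y)))

/-- `B` is a `Q`-bicomodule algebra: a left and a right `Q`-comodule algebra such that
`(1 ⊗ 1 ⊗ x)((ι ⊗ Υ)(Γ(b)(y ⊗ 1))) = ((Γ ⊗ ι)((1 ⊗ x)Υ(b)))(y ⊗ 1 ⊗ 1)` in `Q ⊗ B ⊗ Q`. -/
structure IsBicomoduleAlgebra (H : MultiplierHopf k Q) (γ : LeftCoaction k Q B)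
    (υ : RightCoaction k Q B) : Prop where
  left : γ.IsComoduleAlgebra H
  right : υ.IsComoduleAlgebra H
  bicomodule : ∀ (x y : Q) (b : B),
    LinearMap.lTensor Q (υ.coverL.flip x) (γ.coverR b y) =
      TensorProduct.assoc k Q B Q (LinearMap.rTensor Q (γ.coverR.flip y) (υ.coverL b x))

/-- The left coaction `a ⊗ b ↦ ∑ b₍₋₁₎ ⊗ (a ⊗ b₀)` on `A ⊗ B`. -/
def LeftCoaction.onTensor (A : Type*) [NonUnitalRing A] [Module k A] [IsScalarTower k A A]
    [SMulCommClass k A A] (γ : LeftCoaction k Q B) : LeftCoaction k Q (A ⊗[k] B) where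
  coact := TensorProduct.lift
    (((Multiplier.tmulBilinear k A (Q ⊗[k] B)).compl₁₂ (Multiplier.ofLinear k A) γ.coact).compr₂
      (Multiplier.leftComm k A Q B))
  coverR := TensorProduct.lift (LinearMap.mk₂ k
    (fun a b => (TensorProduct.leftComm k A Q B).toLinearMap ∘ₗ
      TensorProduct.mk k A (Q ⊗[k] B) a ∘ₗ γ.coverR b)
    (fun a a' b => by ext; simp)
    (fun c a b => by ext; simp)
    (fun a b b' => by ext; simp [TensorProduct.tmul_add])
    (fun c a b => by ext; simp))
  coverL := TensorProduct.lift (LinearMap.mk₂ k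
    (fun a b => (TensorProduct.leftComm k A Q B).toLinearMap ∘ₗ
      TensorProduct.mk k A (Q ⊗[k] B) a ∘ₗ γ.coverL b)
    (fun a a' b => by ext; simp)
    (fun c a b => by ext; simp)
    (fun a b b' => by ext; simp [TensorProduct.tmul_add])
    (fun c a b => by ext; simp))
  coverR_spec t x := by
    induction t with
    | zero => simp only [map_zero, LinearMap.zero_apply, zero_mul, ← Multiplier.ofLinear_apply]
    | add u v hu hv =>
      simp only [map_add, LinearMap.add_apply, add_mul, ← Multiplier.ofLinear_apply] at *
      rw [hu, hv]
    | tmul a b =>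
      change Multiplier.of k (TensorProduct.leftComm k A Q B (a ⊗ₜ γ.coverR b x)) = 
        Multiplier.leftComm k A Q B
          (Multiplier.tmul (Multiplier.of k a) (γ.coact b)) *
          Multiplier.tmul (Multiplier.of k x) 1
      rw [← Multiplier.leftComm_of, Multiplier.of_tmul,
        γ.coverR_spec, ← Multiplier.leftComm_tmul (A := A) (C := B), ← Multiplier.leftComm_mul,
        Multiplier.tmul_mul, mul_one]
  coverL_spec t x := by
    induction t with
    | zero => simp only [map_zero, LinearMap.zero_apply, mul_zero, ← Multiplier.ofLinear_apply]
    | add u v hu hv =>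
      simp only [map_add, LinearMap.add_apply, mul_add, ← Multiplier.ofLinear_apply] at *
      rw [hu, hv]
    | tmul a b =>
      change Multiplier.of k (TensorProduct.leftComm k A Q B (a ⊗ₜ γ.coverL b x)) = 
        Multiplier.tmul (Multiplier.of k x) 1 *
          Multiplier.leftComm k A Q B
          (Multiplier.tmul (Multiplier.of k a) (γ.coact b))
      rw [← Multiplier.leftComm_of, Multiplier.of_tmul,
        γ.coverL_spec, ← Multiplier.leftComm_tmul (A := A) (C := B), ← Multiplier.leftComm_mul,
        Multiplier.tmul_mul, one_mul]

/-- The right coaction `a ⊗ b ↦ ∑ (a₀ ⊗ b) ⊗ a₍₁₎` on `A ⊗ B`. -/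
def RightCoaction.onTensor (B : Type*) [NonUnitalRing B] [Module k B] [IsScalarTower k B B]
    [SMulCommClass k B B] (υ : RightCoaction k Q A) : RightCoaction k Q (A ⊗[k] B) where
  coact := TensorProduct.lift
    (((Multiplier.tmulBilinear k (A ⊗[k] Q) B).compl₁₂ υ.coact (Multiplier.ofLinear k B)).compr₂
      (Multiplier.rightComm k A Q B))
  coverR := TensorProduct.lift (LinearMap.mk₂ k
    (fun a b => (TensorProduct.rightComm k A Q B).toLinearMap ∘ₗ
      (TensorProduct.mk k (A ⊗[k] Q) B).flip b ∘ₗ υ.coverR a)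
    (fun a a' b => by ext; simp)
    (fun c a b => by ext; simp)
    (fun a b b' => by ext; simp)
    (fun c a b => by ext; simp))
  coverL := TensorProduct.lift (LinearMap.mk₂ k
    (fun a b => (TensorProduct.rightComm k A Q B).toLinearMap ∘ₗ
      (TensorProduct.mk k (A ⊗[k] Q) B).flip b ∘ₗ υ.coverL a)
    (fun a a' b => by ext; simp)
    (fun c a b => by ext; simp)
    (fun a b b' => by ext; simp)
    (fun c a b => by ext; simp))
  coverR_spec t x := by
    induction t with
    | zero => simp only [map_zero, LinearMap.zero_apply, zero_mul, ← Multiplier.ofLinear_apply]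
    | add u v hu hv =>
      simp only [map_add, LinearMap.add_apply, add_mul, ← Multiplier.ofLinear_apply] at *
      rw [hu, hv]
    | tmul a b =>
      change Multiplier.of k (TensorProduct.rightComm k A Q B (υ.coverR a x ⊗ₜ b)) = 
        Multiplier.rightComm k A Q B
          (Multiplier.tmul (υ.coact a) (Multiplier.of k b)) *
          Multiplier.tmul 1 (Multiplier.of k x)
      rw [← Multiplier.rightComm_of, Multiplier.of_tmul,
        υ.coverR_spec, ← Multiplier.rightComm_tmul (A := A) (C := B), ← Multiplier.rightComm_mul,
        Multiplier.tmul_mul, mul_one]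
  coverL_spec t x := by
    induction t with
    | zero => simp only [map_zero, LinearMap.zero_apply, mul_zero, ← Multiplier.ofLinear_apply]
    | add u v hu hv =>
      simp only [map_add, LinearMap.add_apply, mul_add, ← Multiplier.ofLinear_apply] at *
      rw [hu, hv]
    | tmul a b =>
      change Multiplier.of k (TensorProduct.rightComm k A Q B (υ.coverL a x ⊗ₜ b)) = 
        Multiplier.tmul 1 (Multiplier.of k x) *
          Multiplier.rightComm k A Q B
          (Multiplier.tmul (υ.coact a) (Multiplier.of k b))
      rw [← Multiplier.rightComm_of, Multiplier.of_tmul,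
        υ.coverL_spec, ← Multiplier.rightComm_tmul (A := A) (C := B), ← Multiplier.rightComm_mul,
        Multiplier.tmul_mul, one_mul]

end ComoduleAlgebras

/-! ### The twist maps -/

section Twists

variable {k Q : Type*} [Field k] [NonUnitalRing Q] [Module k Q]
  [IsScalarTower k Q Q] [SMulCommClass k Q Q]
variable {V U : Type*} [AddCommGroup V] [Module k V] [AddCommGroup U] [Module k U]
variable {B : Type*} [NonUnitalRing B] [Module k B] [IsScalarTower k B B] [SMulCommClass k B B]

theorem exists_coverLift (f : Q →ₗ[k] V →ₗ[k] V) (hf : Function.Surjective (TensorProduct.lift f))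
    (g : Q →ₗ[k] V →ₗ[k] U)
    (h : ∀ s : Finset Q, ∃ (m : Q →ₗ[k] Q) (K : V →ₗ[k] U), (∀ x ∈ s, m x = x) ∧
      ∀ x v, g (m x) v = K (f x v)) :
    ∃ L : V →ₗ[k] U, ∀ x v, L (f x v) = g x v := by
  classical
  have hle : LinearMap.ker (TensorProduct.lift f) ≤ LinearMap.ker (TensorProduct.lift g) := by
    intro z hz
    obtain ⟨S, rfl⟩ := TensorProduct.exists_finset z
    obtain ⟨m, K, hm, hK⟩ := h (S.image Prod.fst)
    rw [LinearMap.mem_ker] at hz ⊢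
    have : TensorProduct.lift g (∑ i ∈ S, i.1 ⊗ₜ[k] i.2) =
        K (TensorProduct.lift f (∑ i ∈ S, i.1 ⊗ₜ[k] i.2)) := by
      simp only [map_sum, TensorProduct.lift.tmul]
      refine Finset.sum_congr rfl fun i hi => ?_
      rw [← hK, hm _ (Finset.mem_image_of_mem _ hi)]
    rw [this, hz, map_zero]
  let e := (TensorProduct.lift f).quotKerEquivOfSurjective hf
  refine ⟨(Submodule.liftQ _ (TensorProduct.lift g) hle) ∘ₗ e.symm.toLinearMap, fun x v => ?_⟩
  have : e.symm (f x v) = Submodule.Quotient.mk (x ⊗ₜ v) := by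
    rw [LinearEquiv.symm_apply_eq]
    simp [e]
  simp [this]

variable [NondegenerateProduct Q] [NondegenerateProduct B]

theorem LeftCoaction.coverR_mul (γ : LeftCoaction k Q B) (b : B) (x y : Q) :
    γ.coverR b (x * y) = LinearMap.rTensor B (LinearMap.mulRight k y) (γ.coverR b x) := by
  apply Multiplier.of_injective (k := k)
  have h1 : ∀ z : Q ⊗[k] B, Multiplier.of k (LinearMap.rTensor B (LinearMap.mulRight k y) z) =
      Multiplier.of k z * Multiplier.tmul (Multiplier.of k y) 1 := by
    intro z
    induction z with
    | zero => simp only [map_zero, zero_mul, ← Multiplier.ofLinear_apply]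
    | add u v hu hv =>
      simp only [map_add, add_mul, ← Multiplier.ofLinear_apply] at *
      rw [hu, hv]
    | tmul q b =>
      rw [Multiplier.of_tmul, Multiplier.tmul_mul, mul_one, LinearMap.rTensor_tmul,
        Multiplier.of_tmul, LinearMap.mulRight_apply, Multiplier.of_mul]
  rw [h1, γ.coverR_spec, γ.coverR_spec, mul_assoc, Multiplier.tmul_mul, mul_one, Multiplier.of_mul]

theorem LeftCoaction.coverL_mul (γ : LeftCoaction k Q B) (b : B) (x y : Q) :
    γ.coverL b (x * y) = LinearMap.rTensor B (LinearMap.mulLeft k x) (γ.coverL b y) := by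
  apply Multiplier.of_injective (k := k)
  have h1 : ∀ z : Q ⊗[k] B, Multiplier.of k (LinearMap.rTensor B (LinearMap.mulLeft k x) z) =
      Multiplier.tmul (Multiplier.of k x) 1 * Multiplier.of k z := by
    intro z
    induction z with
    | zero => simp only [map_zero, mul_zero, ← Multiplier.ofLinear_apply]
    | add u v hu hv =>
      simp only [map_add, mul_add, ← Multiplier.ofLinear_apply] at *
      rw [hu, hv]
    | tmul q b =>
      rw [Multiplier.of_tmul, Multiplier.tmul_mul, one_mul, LinearMap.rTensor_tmul,
        Multiplier.of_tmul, LinearMap.mulLeft_apply, Multiplier.of_mul]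
  rw [h1, γ.coverL_spec, γ.coverL_spec, ← mul_assoc, Multiplier.tmul_mul, mul_one,
    Multiplier.of_mul]

theorem RightCoaction.coverR_mul (υ : RightCoaction k Q B) (b : B) (x y : Q) :
    υ.coverR b (x * y) = LinearMap.lTensor B (LinearMap.mulRight k y) (υ.coverR b x) := by
  apply Multiplier.of_injective (k := k)
  have h1 : ∀ z : B ⊗[k] Q, Multiplier.of k (LinearMap.lTensor B (LinearMap.mulRight k y) z) =
      Multiplier.of k z * Multiplier.tmul 1 (Multiplier.of k y) := by
    intro z
    induction z with
    | zero => simp only [map_zero, zero_mul, ← Multiplier.ofLinear_apply]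
    | add u v hu hv =>
      simp only [map_add, add_mul, ← Multiplier.ofLinear_apply] at *
      rw [hu, hv]
    | tmul b q =>
      rw [Multiplier.of_tmul, Multiplier.tmul_mul, mul_one, LinearMap.lTensor_tmul,
        Multiplier.of_tmul, LinearMap.mulRight_apply, Multiplier.of_mul]
  rw [h1, υ.coverR_spec, υ.coverR_spec, mul_assoc, Multiplier.tmul_mul, mul_one, Multiplier.of_mul]

theorem RightCoaction.coverL_mul (υ : RightCoaction k Q B) (b : B) (x y : Q) :
    υ.coverL b (x * y) = LinearMap.lTensor B (LinearMap.mulLeft k x) (υ.coverL b y) := by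
  apply Multiplier.of_injective (k := k)
  have h1 : ∀ z : B ⊗[k] Q, Multiplier.of k (LinearMap.lTensor B (LinearMap.mulLeft k x) z) =
      Multiplier.tmul 1 (Multiplier.of k x) * Multiplier.of k z := by
    intro z
    induction z with
    | zero => simp only [map_zero, mul_zero, ← Multiplier.ofLinear_apply]
    | add u v hu hv =>
      simp only [map_add, mul_add, ← Multiplier.ofLinear_apply] at *
      rw [hu, hv]
    | tmul b q =>
      rw [Multiplier.of_tmul, Multiplier.tmul_mul, one_mul, LinearMap.lTensor_tmul,
        Multiplier.of_tmul, LinearMap.mulLeft_apply, Multiplier.of_mul]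
  rw [h1, υ.coverL_spec, υ.coverL_spec, ← mul_assoc, Multiplier.tmul_mul, mul_one,
    Multiplier.of_mul]

variable [LocalUnits Q]

theorem UnitalLeftModule.exists_leftTwist (M : UnitalLeftModule k Q V) (γ : LeftCoaction k Q B) :
    ∃ L : V →ₗ[k] B →ₗ[k] V ⊗[k] B, ∀ x v, L (M.act x v) =
      LinearMap.rTensor B (M.act.flip v) ∘ₗ γ.coverR.flip x := by
  let G := ((LinearMap.llcomp k B (Q ⊗[k] B) (V ⊗[k] B) ∘ₗ
      LinearMap.rTensorHom B ∘ₗ M.act.flip).flip ∘ₗ γ.coverR.flip)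
  obtain ⟨L, hL⟩ := exists_coverLift M.act M.unital G fun s => by
    obtain ⟨e, f, hef⟩ := LocalUnits.exists_unit s
    refine ⟨LinearMap.mulLeft k e, G e, fun x hx => (hef x hx).1, fun x v => ?_⟩
    ext b
    have : M.act.flip v ∘ₗ LinearMap.mulRight k x = M.act.flip (M.act x v) := by
      ext y; simp [M.mul_act]
    simp [G, γ.coverR_mul, ← this, LinearMap.rTensor_comp]
  exact ⟨L, hL⟩

theorem UnitalRightModule.exists_leftTwist (M : UnitalRightModule k Q V)
    (γ : LeftCoaction k Q B) :
    ∃ L : V →ₗ[k] B →ₗ[k] V ⊗[k] B, ∀ x v, L (M.act x v) =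
      LinearMap.rTensor B (M.act.flip v) ∘ₗ γ.coverL.flip x := by
  let G := ((LinearMap.llcomp k B (Q ⊗[k] B) (V ⊗[k] B) ∘ₗ
      LinearMap.rTensorHom B ∘ₗ M.act.flip).flip ∘ₗ γ.coverL.flip)
  obtain ⟨L, hL⟩ := exists_coverLift M.act M.unital G fun s => by
    obtain ⟨e, f, hef⟩ := LocalUnits.exists_unit s
    refine ⟨LinearMap.mulRight k f, G f, fun x hx => (hef x hx).2, fun x v => ?_⟩
    ext b
    have : M.act.flip v ∘ₗ LinearMap.mulLeft k x = M.act.flip (M.act x v) := by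
      ext y; simp [M.act_mul]
    simp [G, γ.coverL_mul, ← this, LinearMap.rTensor_comp]
  exact ⟨L, hL⟩

theorem UnitalRightModule.exists_rightTwist (M : UnitalRightModule k Q V)
    (υ : RightCoaction k Q B) :
    ∃ L : V →ₗ[k] B →ₗ[k] B ⊗[k] V, ∀ x v, L (M.act x v) =
      LinearMap.lTensor B (M.act.flip v) ∘ₗ υ.coverL.flip x := by
  let G := ((LinearMap.llcomp k B (B ⊗[k] Q) (B ⊗[k] V) ∘ₗ
      LinearMap.lTensorHom B ∘ₗ M.act.flip).flip ∘ₗ υ.coverL.flip)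
  obtain ⟨L, hL⟩ := exists_coverLift M.act M.unital G fun s => by
    obtain ⟨e, f, hef⟩ := LocalUnits.exists_unit s
    refine ⟨LinearMap.mulRight k f, G f, fun x hx => (hef x hx).2, fun x v => ?_⟩
    ext b
    have : M.act.flip v ∘ₗ LinearMap.mulLeft k x = M.act.flip (M.act x v) := by
      ext y; simp [M.act_mul]
    simp [G, υ.coverL_mul, ← this, LinearMap.lTensor_comp]
  exact ⟨L, hL⟩

theorem UnitalLeftModule.exists_rightTwist (M : UnitalLeftModule k Q V)
    (υ : RightCoaction k Q B) :
    ∃ L : V →ₗ[k] B →ₗ[k] B ⊗[k] V, ∀ x v, L (M.act x v) =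
      LinearMap.lTensor B (M.act.flip v) ∘ₗ υ.coverR.flip x := by
  let G := ((LinearMap.llcomp k B (B ⊗[k] Q) (B ⊗[k] V) ∘ₗ
      LinearMap.lTensorHom B ∘ₗ M.act.flip).flip ∘ₗ υ.coverR.flip)
  obtain ⟨L, hL⟩ := exists_coverLift M.act M.unital G fun s => by
    obtain ⟨e, f, hef⟩ := LocalUnits.exists_unit s
    refine ⟨LinearMap.mulLeft k e, G e, fun x hx => (hef x hx).1, fun x v => ?_⟩
    ext b
    have : M.act.flip v ∘ₗ LinearMap.mulRight k x = M.act.flip (M.act x v) := by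
      ext y; simp [M.mul_act]
    simp [G, υ.coverR_mul, ← this, LinearMap.lTensor_comp]
  exact ⟨L, hL⟩

/-- The map `B ⊗ V → V ⊗ B`, `b ⊗ v ↦ ∑ (b₍₋₁₎ ▷ v) ⊗ b₀`. As `V` is unital it is determined by
`b ⊗ (x ▷ v) ↦ ∑ (b₍₋₁₎x ▷ v) ⊗ b₀` with `∑ b₍₋₁₎x ⊗ b₀ = Γ(b)(x ⊗ 1)`. -/
def UnitalLeftModule.leftTwist (M : UnitalLeftModule k Q V) (γ : LeftCoaction k Q B) :
    B ⊗[k] V →ₗ[k] V ⊗[k] B :=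
  TensorProduct.lift (M.exists_leftTwist γ).choose.flip

theorem UnitalLeftModule.leftTwist_tmul (M : UnitalLeftModule k Q V) (γ : LeftCoaction k Q B)
    (b : B) (x : Q) (v : V) : M.leftTwist γ (b ⊗ₜ M.act x v) =
      LinearMap.rTensor B (M.act.flip v) (γ.coverR b x) := by
  simp [UnitalLeftModule.leftTwist, (M.exists_leftTwist γ).choose_spec]

/-- The map `B ⊗ V → V ⊗ B`, `b ⊗ v ↦ ∑ (v ◁ b₍₋₁₎) ⊗ b₀`. As `V` is unital it is determined by
`b ⊗ (v ◁ x) ↦ ∑ (v ◁ x b₍₋₁₎) ⊗ b₀` with `∑ x b₍₋₁₎ ⊗ b₀ = (x ⊗ 1)Γ(b)`. -/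
def UnitalRightModule.leftTwist (M : UnitalRightModule k Q V) (γ : LeftCoaction k Q B) :
    B ⊗[k] V →ₗ[k] V ⊗[k] B :=
  TensorProduct.lift (M.exists_leftTwist γ).choose.flip

theorem UnitalRightModule.leftTwist_tmul (M : UnitalRightModule k Q V) (γ : LeftCoaction k Q B)
    (b : B) (x : Q) (v : V) : M.leftTwist γ (b ⊗ₜ M.act x v) =
      LinearMap.rTensor B (M.act.flip v) (γ.coverL b x) := by
  simp [UnitalRightModule.leftTwist, (M.exists_leftTwist γ).choose_spec]

/-- The map `V ⊗ B → B ⊗ V`, `v ⊗ b ↦ ∑ b₀ ⊗ (v ◁ b₍₁₎)`. As `V` is unital it is determined by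
`(v ◁ x) ⊗ b ↦ ∑ b₀ ⊗ (v ◁ x b₍₁₎)` with `∑ b₀ ⊗ x b₍₁₎ = (1 ⊗ x)Υ(b)`. -/
def UnitalRightModule.rightTwist (M : UnitalRightModule k Q V) (υ : RightCoaction k Q B) :
    V ⊗[k] B →ₗ[k] B ⊗[k] V :=
  TensorProduct.lift (M.exists_rightTwist υ).choose

theorem UnitalRightModule.rightTwist_tmul (M : UnitalRightModule k Q V) (υ : RightCoaction k Q B)
    (b : B) (x : Q) (v : V) : M.rightTwist υ (M.act x v ⊗ₜ b) =
      LinearMap.lTensor B (M.act.flip v) (υ.coverL b x) := by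
  simp [UnitalRightModule.rightTwist, (M.exists_rightTwist υ).choose_spec]

/-- The map `V ⊗ B → B ⊗ V`, `v ⊗ b ↦ ∑ b₀ ⊗ (b₍₁₎ ▷ v)`. As `V` is unital it is determined by
`(x ▷ v) ⊗ b ↦ ∑ b₀ ⊗ (b₍₁₎x ▷ v)` with `∑ b₀ ⊗ b₍₁₎x = Υ(b)(1 ⊗ x)`. -/
def UnitalLeftModule.rightTwist (M : UnitalLeftModule k Q V) (υ : RightCoaction k Q B) :
    V ⊗[k] B →ₗ[k] B ⊗[k] V :=
  TensorProduct.lift (M.exists_rightTwist υ).choose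

theorem UnitalLeftModule.rightTwist_tmul (M : UnitalLeftModule k Q V) (υ : RightCoaction k Q B)
    (b : B) (x : Q) (v : V) : M.rightTwist υ (M.act x v ⊗ₜ b) =
      LinearMap.lTensor B (M.act.flip v) (υ.coverR b x) := by
  simp [UnitalLeftModule.rightTwist, (M.exists_rightTwist υ).choose_spec]

end Twists

/-! ### Vector spaces with a bilinear multiplication -/

section AlgebraOn

variable {k V : Type*} [Field k] [AddCommGroup V] [Module k V]

/-- The vector space `V`, with multiplication the bilinear map `μ`. -/
def AlgebraOn (_μ : V →ₗ[k] V →ₗ[k] V) : Type _ := V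

namespace AlgebraOn

variable (μ : V →ₗ[k] V →ₗ[k] V)

instance : AddCommGroup (AlgebraOn μ) := inferInstanceAs (AddCommGroup V)

instance : Module k (AlgebraOn μ) := inferInstanceAs (Module k V)

/-- The identity map `V → AlgebraOn μ`. -/
def of : V ≃ₗ[k] AlgebraOn μ := LinearEquiv.refl k V

instance : Mul (AlgebraOn μ) := ⟨fun x y => of μ (μ ((of μ).symm x) ((of μ).symm y))⟩

theorem of_mul_of (x y : V) : of μ x * of μ y = of μ (μ x y) := rfl

theorem mul_def (x y : AlgebraOn μ) : x * y = of μ (μ ((of μ).symm x) ((of μ).symm y)) := rfl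

instance : NonUnitalNonAssocRing (AlgebraOn μ) :=
  { (inferInstance : AddCommGroup (AlgebraOn μ)), (inferInstance : Mul (AlgebraOn μ)) with
    left_distrib := fun x y z => by simp [mul_def]
    right_distrib := fun x y z => by simp [mul_def]
    zero_mul := fun x => by simp [mul_def]
    mul_zero := fun x => by simp [mul_def] }

instance : IsScalarTower k (AlgebraOn μ) (AlgebraOn μ) :=
  ⟨fun c x y => by simp only [smul_eq_mul, mul_def, map_smul, LinearMap.smul_apply]⟩

instance : SMulCommClass k (AlgebraOn μ) (AlgebraOn μ) :=
  ⟨fun c x y => by simp only [smul_eq_mul, mul_def, map_smul]⟩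

end AlgebraOn

variable {Q : Type*} [NonUnitalRing Q] [Module k Q] [IsScalarTower k Q Q] [SMulCommClass k Q Q]

/-- A left module structure on `V`, regarded as one on the same space with multiplication `μ`. -/
def UnitalLeftModule.onAlgebra (M : UnitalLeftModule k Q V) (μ : V →ₗ[k] V →ₗ[k] V) :
    UnitalLeftModule k Q (AlgebraOn μ) :=
  ⟨M.act, M.mul_act, M.unital⟩

/-- A right module structure on `V`, regarded as one on the same space with multiplication `μ`. -/
def UnitalRightModule.onAlgebra (M : UnitalRightModule k Q V) (μ : V →ₗ[k] V →ₗ[k] V) :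
    UnitalRightModule k Q (AlgebraOn μ) :=
  ⟨M.act, M.act_mul, M.unital⟩

end AlgebraOn

/-! ### Twisted tensor products -/

section TwistedTensorProducts

variable {k : Type*} [Field k]
variable {A : Type*} [NonUnitalNonAssocRing A] [Module k A] [IsScalarTower k A A]
  [SMulCommClass k A A]
variable {B : Type*} [NonUnitalNonAssocRing B] [Module k B] [IsScalarTower k B B]
  [SMulCommClass k B B]
variable {C : Type*} [NonUnitalNonAssocRing C] [Module k C] [IsScalarTower k C C]
  [SMulCommClass k C C]

/-- The map `(a ⊗ d) ⊗ (c ⊗ b) ↦ ac ⊗ bd`. -/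
def lrCombine : (A ⊗[k] B) ⊗[k] (A ⊗[k] B) →ₗ[k] A ⊗[k] B :=
  TensorProduct.map (LinearMap.mul' k A)
      (LinearMap.mul' k B ∘ₗ (TensorProduct.comm k B B).toLinearMap) ∘ₗ
    (TensorProduct.tensorTensorTensorComm k A B A B).toLinearMap

@[simp] theorem lrCombine_tmul (a c : A) (b d : B) :
    lrCombine (k := k) ((a ⊗ₜ d) ⊗ₜ (c ⊗ₜ b)) = (a * c) ⊗ₜ (b * d) := by
  simp [lrCombine]

/-- The multiplication `(a # b)(c # d) = a_T c_R # b_R d_T` on `A ⊗ B`, where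
`R(b ⊗ c) = c_R ⊗ b_R` and `T(a ⊗ d) = a_T ⊗ d_T`. -/
def lrTwistedMul (R : B ⊗[k] A →ₗ[k] A ⊗[k] B) (T : A ⊗[k] B →ₗ[k] A ⊗[k] B) :
    A ⊗[k] B →ₗ[k] A ⊗[k] B →ₗ[k] A ⊗[k] B :=
  TensorProduct.curry <|
    lrCombine ∘ₗ TensorProduct.map T R ∘ₗ
      (TensorProduct.tensorTensorTensorComm k A B B A).toLinearMap ∘ₗ
      LinearMap.lTensor (A ⊗[k] B) (TensorProduct.comm k A B).toLinearMap

theorem lrTwistedMul_tmul (R : B ⊗[k] A →ₗ[k] A ⊗[k] B) (T : A ⊗[k] B →ₗ[k] A ⊗[k] B)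
    (a c : A) (b d : B) : lrTwistedMul R T (a ⊗ₜ b) (c ⊗ₜ d) =
      lrCombine (T (a ⊗ₜ d) ⊗ₜ R (b ⊗ₜ c)) := by
  simp [lrTwistedMul]

/-- The multiplication `(a # b)(c # d) = a c_R # b_R d` on `A ⊗ B`, where
`R(b ⊗ c) = c_R ⊗ b_R`; this is the preceding one with `T` the identity. -/
def twistedMul (R : B ⊗[k] A →ₗ[k] A ⊗[k] B) : A ⊗[k] B →ₗ[k] A ⊗[k] B →ₗ[k] A ⊗[k] B :=
  lrTwistedMul R LinearMap.id

theorem twistedMul_tmul (R : B ⊗[k] A →ₗ[k] A ⊗[k] B) (a c : A) (b d : B) :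
    twistedMul R (a ⊗ₜ b) (c ⊗ₜ d) =
      TensorProduct.map (LinearMap.mulLeft k a) (LinearMap.mulRight k d) (R (b ⊗ₜ c)) := by
  rw [twistedMul, lrTwistedMul_tmul, LinearMap.id_apply]
  induction R (b ⊗ₜ c) with
  | zero => simp
  | tmul x y => simp
  | add u v hu hv => simp only [TensorProduct.tmul_add, map_add, hu, hv]

/-- The map `(a' ⊗ c) ⊗ (c' ⊗ b) ↦ a' ⊗ (cc' ⊗ b)`. -/
def twoSidedCombine : (A ⊗[k] C) ⊗[k] (C ⊗[k] B) →ₗ[k] A ⊗[k] (C ⊗[k] B) :=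
  LinearMap.lTensor A (LinearMap.rTensor B (LinearMap.mul' k C) ∘ₗ
      (TensorProduct.assoc k C C B).symm.toLinearMap) ∘ₗ
    (TensorProduct.assoc k A C (C ⊗[k] B)).toLinearMap

@[simp] theorem twoSidedCombine_tmul (a : A) (c c' : C) (b : B) :
    twoSidedCombine (k := k) ((a ⊗ₜ c) ⊗ₜ (c' ⊗ₜ b)) = a ⊗ₜ ((c * c') ⊗ₜ b) := by
  simp [twoSidedCombine]

variable (k A B C) in
/-- The permutation `(a ⊗ (c ⊗ b)) ⊗ (a' ⊗ (c' ⊗ b')) ↦ (a ⊗ b') ⊗ ((c ⊗ a') ⊗ (b ⊗ c'))`. -/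
def twoSidedPerm : (A ⊗[k] (C ⊗[k] B)) ⊗[k] (A ⊗[k] (C ⊗[k] B)) →ₗ[k]
    (A ⊗[k] B) ⊗[k] ((C ⊗[k] A) ⊗[k] (B ⊗[k] C)) :=
  (TensorProduct.assoc k (A ⊗[k] B) (C ⊗[k] A) (B ⊗[k] C)).toLinearMap ∘ₗ
    LinearMap.rTensor (B ⊗[k] C)
      (LinearMap.lTensor (A ⊗[k] B) (TensorProduct.comm k A C).toLinearMap ∘ₗ
        (TensorProduct.tensorTensorTensorComm k A A B C).toLinearMap ∘ₗ
        LinearMap.lTensor (A ⊗[k] A) (TensorProduct.comm k C B).toLinearMap) ∘ₗ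
    (TensorProduct.assoc k (A ⊗[k] A) (C ⊗[k] B) (B ⊗[k] C)).symm.toLinearMap ∘ₗ
    LinearMap.lTensor (A ⊗[k] A)
      ((TensorProduct.tensorTensorTensorComm k C B B C).toLinearMap ∘ₗ
        LinearMap.lTensor (C ⊗[k] B) (TensorProduct.comm k C B).toLinearMap) ∘ₗ
    (TensorProduct.tensorTensorTensorComm k A (C ⊗[k] B) A (C ⊗[k] B)).toLinearMap

@[simp] theorem twoSidedPerm_tmul (a a' : A) (b b' : B) (c c' : C) :
    twoSidedPerm k A B C ((a ⊗ₜ (c ⊗ₜ b)) ⊗ₜ (a' ⊗ₜ (c' ⊗ₜ b'))) =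
      (a ⊗ₜ b') ⊗ₜ ((c ⊗ₜ a') ⊗ₜ (b ⊗ₜ c')) := by
  simp [twoSidedPerm]

/-- The multiplication `(a ⋈ c ⋈ b)(a' ⋈ c' ⋈ b') = a a'_R ⋈ c_R c'_T ⋈ b_T b'` on
`A ⊗ C ⊗ B`, where `R(c ⊗ a') = a'_R ⊗ c_R` and `T(b ⊗ c') = c'_T ⊗ b_T`. -/
def twoSidedTwistedMul (R : C ⊗[k] A →ₗ[k] A ⊗[k] C) (T : B ⊗[k] C →ₗ[k] C ⊗[k] B) :
    A ⊗[k] (C ⊗[k] B) →ₗ[k] A ⊗[k] (C ⊗[k] B) →ₗ[k] A ⊗[k] (C ⊗[k] B) :=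
  TensorProduct.curry <|
    TensorProduct.lift (TensorProduct.lift (LinearMap.mk₂ k
      (fun a b' => TensorProduct.map (LinearMap.mulLeft k a)
        (LinearMap.lTensor C (LinearMap.mulRight k b')))
      (fun a a' b => by ext; simp [add_mul, TensorProduct.add_tmul])
      (fun c a b => by ext; simp [smul_mul_assoc, ← TensorProduct.smul_tmul'])
      (fun a b b' => by ext; simp [mul_add, TensorProduct.tmul_add])
      (fun c a b => by ext; simp [mul_smul_comm]))) ∘ₗ
    LinearMap.lTensor (A ⊗[k] B) (twoSidedCombine ∘ₗ TensorProduct.map R T) ∘ₗ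
    twoSidedPerm k A B C

theorem twoSidedTwistedMul_tmul (R : C ⊗[k] A →ₗ[k] A ⊗[k] C) (T : B ⊗[k] C →ₗ[k] C ⊗[k] B)
    (a a' : A) (b b' : B) (c c' : C) :
    twoSidedTwistedMul R T (a ⊗ₜ (c ⊗ₜ b)) (a' ⊗ₜ (c' ⊗ₜ b')) =
      TensorProduct.map (LinearMap.mulLeft k a) (LinearMap.lTensor C (LinearMap.mulRight k b'))
        (twoSidedCombine (R (c ⊗ₜ a') ⊗ₜ T (b ⊗ₜ c'))) := by
  simp [twoSidedTwistedMul]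

end TwistedTensorProducts

/-! ### Smash products -/

section SmashProducts

variable {k Q : Type*} [Field k] [NonUnitalRing Q] [Module k Q]
  [IsScalarTower k Q Q] [SMulCommClass k Q Q] [NondegenerateProduct Q] [LocalUnits Q]

section

variable {V : Type*} [NonUnitalNonAssocRing V] [Module k V] [IsScalarTower k V V]
  [SMulCommClass k V V]
variable {B : Type*} [NonUnitalRing B] [Module k B] [IsScalarTower k B B] [SMulCommClass k B B]
  [NondegenerateProduct B]

/-- The right smash product `B #_r V` on `B ⊗ V`:
`(b' # v')(b # v) = ∑ b'b₀ # (v' ◁ b₍₁₎)v`. -/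
abbrev SmashRight (υ : RightCoaction k Q B) (r : UnitalRightModule k Q V) : Type _ :=
  AlgebraOn (twistedMul (r.rightTwist υ))

/-- The left smash product `V #_l B` on `V ⊗ B`:
`(v # b)(v' # b') = ∑ v(b₍₋₁₎ ▷ v') # b₀b'`. -/
abbrev SmashLeft (l : UnitalLeftModule k Q V) (γ : LeftCoaction k Q B) : Type _ :=
  AlgebraOn (twistedMul (l.leftTwist γ))

/-- The L-R-smash product `B ⋄_r V` on `B ⊗ V`:
`(b' ⋄ v')(b ⋄ v) = ∑ b'₀b₀ ⋄ (v' ◁ b₍₁₎)(b'₍₋₁₎ ▷ v)`. -/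
abbrev DiamondRight (γ : LeftCoaction k Q B) (υ : RightCoaction k Q B)
    (l : UnitalLeftModule k Q V) (r : UnitalRightModule k Q V) : Type _ :=
  AlgebraOn (lrTwistedMul (r.rightTwist υ)
    ((TensorProduct.comm k V B).toLinearMap ∘ₗ l.leftTwist γ))

/-- The L-R-smash product `V ⋄_l B` on `V ⊗ B`:
`(v ⋄ b)(v' ⋄ b') = ∑ (v ◁ b'₍₁₎)(b₍₋₁₎ ▷ v') ⋄ b₀b'₀`. -/
abbrev DiamondLeft (γ : LeftCoaction k Q B) (υ : RightCoaction k Q B)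
    (l : UnitalLeftModule k Q V) (r : UnitalRightModule k Q V) : Type _ :=
  AlgebraOn (lrTwistedMul (l.leftTwist γ)
    ((TensorProduct.comm k B V).toLinearMap ∘ₗ r.rightTwist υ))

/-- The twisted smash product `B ⋆_r V` on `B ⊗ V`:
`(b' ⋆ v')(b ⋆ v) = ∑ b'b₀ ⋆ (S⁻¹(b₍₋₁₎) ▷ v' ◁ b₍₁₎)v`. -/
abbrev StarRight {H : MultiplierHopf k Q} (S : H.Antipode) (γ : LeftCoaction k Q B)
    (υ : RightCoaction k Q B) (l : UnitalLeftModule k Q V) (r : UnitalRightModule k Q V) : Type _ :=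
  AlgebraOn (twistedMul ((TensorProduct.comm k V B).toLinearMap ∘ₗ
    (l.invAntipode S).leftTwist γ ∘ₗ r.rightTwist υ))

/-- The twisted smash product `V ⋆_l B` on `V ⊗ B`:
`(v ⋆ b)(v' ⋆ b') = ∑ v(b₍₋₁₎ ▷ v' ◁ S⁻¹(b₍₁₎)) ⋆ b₀b'`. -/
abbrev StarLeft {H : MultiplierHopf k Q} (S : H.Antipode) (γ : LeftCoaction k Q B)
    (υ : RightCoaction k Q B) (l : UnitalLeftModule k Q V) (r : UnitalRightModule k Q V) : Type _ :=
  AlgebraOn (twistedMul ((TensorProduct.comm k B V).toLinearMap ∘ₗ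
    (r.invAntipode S).rightTwist υ ∘ₗ l.leftTwist γ))

end

section

variable {A : Type*} [NonUnitalRing A] [Module k A] [IsScalarTower k A A] [SMulCommClass k A A]
  [NondegenerateProduct A]
variable {B : Type*} [NonUnitalRing B] [Module k B] [IsScalarTower k B B] [SMulCommClass k B B]
  [NondegenerateProduct B]
variable {C : Type*} [NonUnitalRing C] [Module k C] [IsScalarTower k C C] [SMulCommClass k C C]

/-- The two-sided L-R-smash product `A ⋈ C ⋈ B` on `A ⊗ (C ⊗ B)`:
`(a ⋈ c ⋈ b)(a' ⋈ c' ⋈ b') = ∑ aa'₀ ⋈ (c ◁ a'₍₁₎)(b₍₋₁₎ ▷ c') ⋈ b₀b'`. -/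
abbrev TwoSidedSmash (υ : RightCoaction k Q A) (γ : LeftCoaction k Q B)
    (l : UnitalLeftModule k Q C) (r : UnitalRightModule k Q C) : Type _ :=
  AlgebraOn (twoSidedTwistedMul (r.rightTwist υ) (l.leftTwist γ))

/-- The left action `x ▷ (a # c) = a # (x ▷ c)` on `A #_r C`. -/
def smashRightLeftModule (υ : RightCoaction k Q A) (l : UnitalLeftModule k Q C)
    (r : UnitalRightModule k Q C) : UnitalLeftModule k Q (SmashRight υ r) :=
  (l.lTensor A).onAlgebra _

/-- The right action `(c # b) ◁ x = (c ◁ x) # b` on `C #_l B`. -/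
def smashLeftRightModule (γ : LeftCoaction k Q B) (l : UnitalLeftModule k Q C)
    (r : UnitalRightModule k Q C) : UnitalRightModule k Q (SmashLeft l γ) :=
  (r.rTensor B).onAlgebra _

end

end SmashProducts

section Isomorphisms

/-- `X` and `Y` are isomorphic algebras: there is a bijective algebra homomorphism. -/
def AlgebraIsomorphic (k X Y : Type*) [Field k] [NonUnitalNonAssocRing X] [Module k X]
    [NonUnitalNonAssocRing Y] [Module k Y] : Prop :=
  ∃ f : X →ₙₐ[k] Y, Function.Bijective f

end Isomorphisms

end

/-!
All the multiplications in the statement are built from *twists*: the maps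
`R : C ⊗ A → A ⊗ C`, `c ⊗ a ↦ ∑ a₀ ⊗ (c ◁ a₍₁₎)`, and `T : B ⊗ C → C ⊗ B`,
`b ⊗ c ↦ ∑ (b₍₋₁₎ ▷ c) ⊗ b₀`. Four facts about them carry the proof.

* Twists are *natural* in the module `C`, and the twist of `A ⊗ B` is that of the tensor factor
  which carries the coaction. So (1) and (2) are comparisons of formulas in `R` and `T`. The twist
  `R` commutes with `▷`, because `▷` and `◁` commute; hence `A #_r C` is again a module algebra,
  and its twist with `B` is `T` on the factor `C`, which gives the identifications in (4).
* The twist of a comodule algebra and a module algebra is a *twisting map*, that is, compatible with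
  both products (`UnitalLeftModule.IsModuleAlgebra.isTwistingMap` and its right-handed
  counterpart). Compatibility with the product of the module algebra is the module algebra
  property together with coassociativity of the coaction: both concern elements in the image of
  `T₁` or `T₂`, and these maps are surjective. Twisted tensor products along twisting maps are associative
  (`IsTwistingMap.twistedMul_assoc`), so the smash products are, and so is
  `A ⋈ C ⋈ B = (A #_r C) #_l B`.
* If `S` is an antipode, the twist is *invertible*: its inverse is the twist for the action through
  `S⁻¹` (`UnitalLeftModule.leftTwistEquiv`). This rests on the counit property `(ε ⊗ ι)Γ = ι` of a
  coaction, which follows from coassociativity and the injectivity of `Γ`.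
* An invertible twisting map `T` is an isomorphism from the tensor product twisted by `T⁻¹` to the
  one twisted by `T` (`IsTwistingMap.map_twistedMul_inv`). The product of `(A ⊗ B) ⋆_r C` is, up to
  a permutation of the factors, that of `B ⊗ (A #_r C)` twisted by the inverse of the twist of
  `(A #_r C) #_l B`. This yields the isomorphism with `A ⋈ C ⋈ B`, and likewise for `⋆_l`.

For regular `Q` it remains to construct the counit and the antipode. The counit is read off from
`mT₁⁻¹` by coassociativity, and the antipode from `S(x)y = (ε ⊗ ι)T₁⁻¹(x ⊗ y)`. It takes values in
`Q`, not only in `M(Q)`, because the flip of `Δ` is a comultiplication too, and the antipode of the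
flip is its inverse.
-/

noncomputable section

/-! ### Twisting maps -/

section TwistingMaps

variable {k : Type*} [Field k]
variable {A : Type*} [NonUnitalNonAssocRing A] [Module k A] [IsScalarTower k A A]
  [SMulCommClass k A A]
variable {B : Type*} [NonUnitalNonAssocRing B] [Module k B] [IsScalarTower k B B]
  [SMulCommClass k B B]

/-- Right multiplication by `a'` on the twisted tensor product: `a ⊗ b ↦ a a'_R ⊗ b_R`. -/
def twistMulRight (R : B ⊗[k] A →ₗ[k] A ⊗[k] B) (a' : A) : A ⊗[k] B →ₗ[k] A ⊗[k] B :=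
  LinearMap.rTensor B (LinearMap.mul' k A) ∘ₗ (TensorProduct.assoc k A A B).symm.toLinearMap ∘ₗ
    LinearMap.lTensor A ((TensorProduct.curry R).flip a')

/-- Left multiplication by `b` on the twisted tensor product: `a ⊗ b' ↦ a_R ⊗ b_R b'`. -/
def twistMulLeft (R : B ⊗[k] A →ₗ[k] A ⊗[k] B) (b : B) : A ⊗[k] B →ₗ[k] A ⊗[k] B :=
  LinearMap.lTensor A (LinearMap.mul' k B) ∘ₗ (TensorProduct.assoc k A B B).toLinearMap ∘ₗ
    LinearMap.rTensor B (TensorProduct.curry R b)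

theorem twistMulRight_tmul (R : B ⊗[k] A →ₗ[k] A ⊗[k] B) (a a' : A) (b : B) :
    twistMulRight R a' (a ⊗ₜ b) = LinearMap.rTensor B (LinearMap.mulLeft k a) (R (b ⊗ₜ a')) := by
  simp only [twistMulRight, LinearMap.comp_apply, LinearMap.lTensor_tmul, LinearMap.flip_apply,
    TensorProduct.curry_apply, LinearEquiv.coe_coe]
  induction R (b ⊗ₜ a') with
  | zero => simp
  | tmul x y => simp
  | add u v hu hv => simp only [TensorProduct.tmul_add, map_add, hu, hv]

theorem twistMulLeft_tmul (R : B ⊗[k] A →ₗ[k] A ⊗[k] B) (a : A) (b b' : B) :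
    twistMulLeft R b (a ⊗ₜ b') = LinearMap.lTensor A (LinearMap.mulRight k b') (R (b ⊗ₜ a)) := by
  simp only [twistMulLeft, LinearMap.comp_apply, LinearMap.rTensor_tmul,
    TensorProduct.curry_apply, LinearEquiv.coe_coe]
  induction R (b ⊗ₜ a) with
  | zero => simp
  | tmul x y => simp
  | add u v hu hv => simp only [TensorProduct.add_tmul, map_add, hu, hv]

/-- `R : B ⊗ A → A ⊗ B` is a twisting map: it is compatible with the products of `A` and `B`. -/
structure IsTwistingMap (R : B ⊗[k] A →ₗ[k] A ⊗[k] B) : Prop where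
  tmul_mul : ∀ b a a', R (b ⊗ₜ (a * a')) = twistMulRight R a' (R (b ⊗ₜ a))
  mul_tmul : ∀ b b' a, R ((b * b') ⊗ₜ a) = twistMulLeft R b (R (b' ⊗ₜ a))

theorem twistedMul_tmul_left (R : B ⊗[k] A →ₗ[k] A ⊗[k] B) (a : A) (b : B) (y : A ⊗[k] B) :
    twistedMul R (a ⊗ₜ b) y = LinearMap.rTensor B (LinearMap.mulLeft k a) (twistMulLeft R b y) := by
  induction y with
  | zero => simp
  | add u v hu hv => simp only [map_add, hu, hv]
  | tmul c d =>
    rw [twistedMul_tmul, twistMulLeft_tmul, ← LinearMap.rTensor_comp_lTensor]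
    rfl

theorem twistedMul_tmul_right (R : B ⊗[k] A →ₗ[k] A ⊗[k] B) (a : A) (b : B) (x : A ⊗[k] B) :
    twistedMul R x (a ⊗ₜ b) =
      LinearMap.lTensor A (LinearMap.mulRight k b) (twistMulRight R a x) := by
  induction x with
  | zero => simp
  | add u v hu hv => simp only [map_add, LinearMap.add_apply, hu, hv]
  | tmul c d =>
    rw [twistedMul_tmul, twistMulRight_tmul, ← LinearMap.lTensor_comp_rTensor]
    rfl

theorem twistMulLeft_lTensor (hB : ∀ x y z : B, x * y * z = x * (y * z))
    (R : B ⊗[k] A →ₗ[k] A ⊗[k] B) (b b' : B) (y : A ⊗[k] B) :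
    twistMulLeft R b (LinearMap.lTensor A (LinearMap.mulRight k b') y) =
      LinearMap.lTensor A (LinearMap.mulRight k b') (twistMulLeft R b y) := by
  induction y with
  | zero => simp
  | add u v hu hv => simp only [map_add, hu, hv]
  | tmul c d =>
    rw [LinearMap.lTensor_tmul, twistMulLeft_tmul, twistMulLeft_tmul,
      ← LinearMap.lTensor_comp_apply]
    congr 2
    ext x
    simp [hB]

theorem twistedMul_rTensor (hA : ∀ x y z : A, x * y * z = x * (y * z))
    (R : B ⊗[k] A →ₗ[k] A ⊗[k] B) (a : A) (x y : A ⊗[k] B) :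
    twistedMul R (LinearMap.rTensor B (LinearMap.mulLeft k a) x) y =
      LinearMap.rTensor B (LinearMap.mulLeft k a) (twistedMul R x y) := by
  induction x with
  | zero => simp
  | add u v hu hv => simp only [map_add, LinearMap.add_apply, hu, hv]
  | tmul c d =>
    rw [LinearMap.rTensor_tmul, twistedMul_tmul_left, twistedMul_tmul_left,
      ← LinearMap.rTensor_comp_apply]
    congr 2
    ext x
    simp [hA]

theorem IsTwistingMap.twistMulLeft_mul {R : B ⊗[k] A →ₗ[k] A ⊗[k] B} (hR : IsTwistingMap R)
    (hB : ∀ x y z : B, x * y * z = x * (y * z)) (b b' : B) (y : A ⊗[k] B) :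
    twistMulLeft R (b * b') y = twistMulLeft R b (twistMulLeft R b' y) := by
  induction y with
  | zero => simp
  | add u v hu hv => simp only [map_add, hu, hv]
  | tmul c d =>
    rw [twistMulLeft_tmul, twistMulLeft_tmul, hR.mul_tmul, twistMulLeft_lTensor hB]

theorem IsTwistingMap.twistedMul_apply {R : B ⊗[k] A →ₗ[k] A ⊗[k] B} (hR : IsTwistingMap R)
    (a : A) (b : B) (y : A ⊗[k] B) : twistedMul R (R (b ⊗ₜ a)) y =
      twistMulLeft R b (LinearMap.rTensor B (LinearMap.mulLeft k a) y) := by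
  induction y with
  | zero => simp
  | add u v hu hv => simp only [map_add, hu, hv]
  | tmul c d =>
    rw [twistedMul_tmul_right, LinearMap.rTensor_tmul, LinearMap.mulLeft_apply, twistMulLeft_tmul,
      hR.tmul_mul]

theorem IsTwistingMap.twistedMul_lTensor {R : B ⊗[k] A →ₗ[k] A ⊗[k] B} (hR : IsTwistingMap R)
    (hB : ∀ x y z : B, x * y * z = x * (y * z)) (b : B) (x y : A ⊗[k] B) :
    twistedMul R (LinearMap.lTensor A (LinearMap.mulRight k b) x) y =
      twistedMul R x (twistMulLeft R b y) := by
  induction x with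
  | zero => simp
  | add u v hu hv => simp only [map_add, LinearMap.add_apply, hu, hv]
  | tmul c d =>
    rw [LinearMap.lTensor_tmul, twistedMul_tmul_left, twistedMul_tmul_left,
      LinearMap.mulRight_apply, hR.twistMulLeft_mul hB]

/-- Left multiplication by `a ⊗ b` is `λ_a L_b`, with `λ_a` left multiplication by `a` and `L_b`
left multiplication by `b`. A twisting map is one for which `L` is multiplicative and
`L_b λ_a = λ_{a_R} L_{b_R}`, and associativity is a formal consequence. -/
theorem IsTwistingMap.twistedMul_assoc {R : B ⊗[k] A →ₗ[k] A ⊗[k] B} (hR : IsTwistingMap R)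
    (hA : ∀ x y z : A, x * y * z = x * (y * z)) (hB : ∀ x y z : B, x * y * z = x * (y * z))
    (x y z : A ⊗[k] B) :
    twistedMul R (twistedMul R x y) z = twistedMul R x (twistedMul R y z) := by
  induction x with
  | zero => simp
  | add u v hu hv => simp only [map_add, LinearMap.add_apply, hu, hv]
  | tmul a b =>
    induction y with
    | zero => simp
    | add u v hu hv => simp only [map_add, LinearMap.add_apply, hu, hv]
    | tmul c d =>
      rw [twistedMul_tmul_left, twistMulLeft_tmul, twistedMul_rTensor hA,
        hR.twistedMul_lTensor hB, hR.twistedMul_apply, twistedMul_tmul_left R c d,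
        twistedMul_tmul_left R a b]

/-- If the twisting map `T : B ⊗ V → V ⊗ B` is invertible, it is itself an isomorphism from the
tensor product twisted by its inverse: in the latter `b ⊗ v` stands for the product `bv`. -/
theorem IsTwistingMap.map_twistedMul_inv {T : B ⊗[k] A →ₗ[k] A ⊗[k] B} (hT : IsTwistingMap T)
    {T' : A ⊗[k] B →ₗ[k] B ⊗[k] A} (h : ∀ z, T (T' z) = z) (x y : B ⊗[k] A) :
    T (twistedMul T' x y) = twistedMul T (T x) (T y) := by
  -- `T (b w a) = L_b (T w · a)` for `w` in `B ⊗ A`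
  have key : ∀ (b : B) (a : A) (w : B ⊗[k] A), T (TensorProduct.map (LinearMap.mulLeft k b)
      (LinearMap.mulRight k a) w) = twistMulLeft T b (twistMulRight T a (T w)) := by
    intro b a w
    induction w with
    | zero => simp
    | add u v hu hv => simp only [map_add, hu, hv]
    | tmul c d => simp [hT.mul_tmul, hT.tmul_mul]
  induction x with
  | zero => simp
  | add u v hu hv => simp only [map_add, LinearMap.add_apply, hu, hv]
  | tmul b a =>
    induction y with
    | zero => simp
    | add u v hu hv => simp only [map_add, hu, hv]
    | tmul b' a' =>
      rw [twistedMul_tmul, key, h, twistMulRight_tmul, hT.twistedMul_apply]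

end TwistingMaps

/-! ### Linear isomorphisms between algebras -/

section AlgebraOnEquiv

variable {k V W : Type*} [Field k] [AddCommGroup V] [Module k V] [AddCommGroup W] [Module k W]

/-- A linear isomorphism that preserves products, as an algebra homomorphism. -/
def AlgebraOn.hom {μ : V →ₗ[k] V →ₗ[k] V} {ν : W →ₗ[k] W →ₗ[k] W} (e : V ≃ₗ[k] W)
    (h : ∀ x y, e (μ x y) = ν (e x) (e y)) : AlgebraOn μ →ₙₐ[k] AlgebraOn ν where
  toFun x := AlgebraOn.of ν (e ((AlgebraOn.of μ).symm x))
  map_smul' c x := by simp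
  map_zero' := by simp
  map_add' x y := by simp
  map_mul' x y := by
    rw [AlgebraOn.mul_def, AlgebraOn.mul_def]
    simp [h]

theorem AlgebraOn.hom_bijective {μ : V →ₗ[k] V →ₗ[k] V} {ν : W →ₗ[k] W →ₗ[k] W} (e : V ≃ₗ[k] W)
    (h : ∀ x y, e (μ x y) = ν (e x) (e y)) : Function.Bijective (AlgebraOn.hom e h) :=
  e.bijective

theorem AlgebraOn.mul_assoc_of {μ : V →ₗ[k] V →ₗ[k] V}
    (h : ∀ x y z, μ (μ x y) z = μ x (μ y z)) (x y z : AlgebraOn μ) : x * y * z = x * (y * z) :=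
  h x y z

end AlgebraOnEquiv

section IsomorphismClasses

variable {k : Type*} [Field k]
variable {X Y Z : Type*} [NonUnitalNonAssocRing X] [Module k X] [NonUnitalNonAssocRing Y]
  [Module k Y] [NonUnitalNonAssocRing Z] [Module k Z]

theorem AlgebraIsomorphic.trans (h : AlgebraIsomorphic k X Y) (h' : AlgebraIsomorphic k Y Z) :
    AlgebraIsomorphic k X Z := by
  obtain ⟨f, hf⟩ := h
  obtain ⟨g, hg⟩ := h'
  exact ⟨g.comp f, hg.comp hf⟩

theorem AlgebraIsomorphic.symm (h : AlgebraIsomorphic k X Y) : AlgebraIsomorphic k Y X := by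
  obtain ⟨f, hf⟩ := h
  obtain ⟨g, hl, hr⟩ := Function.bijective_iff_has_inverse.mp hf
  exact ⟨f.inverse g hl hr, Function.bijective_iff_has_inverse.mpr ⟨f, hr, hl⟩⟩

end IsomorphismClasses

/-! ### Multipliers of tensor products -/

namespace Multiplier

variable {k : Type*} [Field k]
variable {A : Type*} [NonUnitalRing A] [Module k A] [IsScalarTower k A A] [SMulCommClass k A A]
variable {B : Type*} [NonUnitalRing B] [Module k B] [IsScalarTower k B B] [SMulCommClass k B B]

theorem left_mul_of [NondegenerateProduct A] (m : Multiplier k A) (a b : A) :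
    m.left (a * b) = m.left a * b := by
  rw [← sub_eq_zero]
  refine NondegenerateProduct.right _ fun c => ?_
  rw [mul_sub, ← right_mul, ← mul_assoc c, ← right_mul, mul_assoc, sub_self]

theorem of_right_mul [NondegenerateProduct A] (m : Multiplier k A) (a b : A) :
    m.right (a * b) = a * m.right b := by
  rw [← sub_eq_zero]
  refine NondegenerateProduct.left _ fun c => ?_
  rw [sub_mul, right_mul, mul_assoc a (m.right b), right_mul, mul_assoc, sub_self]

theorem of_left_apply [NondegenerateProduct A] (m : Multiplier k A) (a : A) :
    of k (m.left a) = m * of k a := by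
  ext x
  · simp [left_mul_of]
  · simp [right_mul]

theorem of_right_apply [NondegenerateProduct A] (m : Multiplier k A) (a : A) :
    of k (m.right a) = of k a * m := by
  ext x
  · simp [right_mul]
  · simp [of_right_mul]

theorem of_rTensor_mulRight (y : A) (z : A ⊗[k] B) :
    of k (LinearMap.rTensor B (LinearMap.mulRight k y) z) = of k z * tmul (of k y) 1 := by
  induction z with
  | zero => simp only [map_zero, zero_mul, ← ofLinear_apply]
  | add u v hu hv =>
    simp only [map_add, add_mul, ← ofLinear_apply] at *
    rw [hu, hv]
  | tmul a b =>
    rw [LinearMap.rTensor_tmul, of_tmul, of_tmul, tmul_mul, mul_one, LinearMap.mulRight_apply,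
      of_mul]

theorem of_rTensor_mulLeft (x : A) (z : A ⊗[k] B) :
    of k (LinearMap.rTensor B (LinearMap.mulLeft k x) z) = tmul (of k x) 1 * of k z := by
  induction z with
  | zero => simp only [map_zero, mul_zero, ← ofLinear_apply]
  | add u v hu hv =>
    simp only [map_add, mul_add, ← ofLinear_apply] at *
    rw [hu, hv]
  | tmul a b =>
    rw [LinearMap.rTensor_tmul, of_tmul, of_tmul, tmul_mul, one_mul, LinearMap.mulLeft_apply,
      of_mul]

theorem of_lTensor_mulRight (y : B) (z : A ⊗[k] B) :
    of k (LinearMap.lTensor A (LinearMap.mulRight k y) z) = of k z * tmul 1 (of k y) := by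
  induction z with
  | zero => simp only [map_zero, zero_mul, ← ofLinear_apply]
  | add u v hu hv =>
    simp only [map_add, add_mul, ← ofLinear_apply] at *
    rw [hu, hv]
  | tmul a b =>
    rw [LinearMap.lTensor_tmul, of_tmul, of_tmul, tmul_mul, mul_one, LinearMap.mulRight_apply,
      of_mul]

theorem of_lTensor_mulLeft (x : B) (z : A ⊗[k] B) :
    of k (LinearMap.lTensor A (LinearMap.mulLeft k x) z) = tmul 1 (of k x) * of k z := by
  induction z with
  | zero => simp only [map_zero, mul_zero, ← ofLinear_apply]
  | add u v hu hv =>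
    simp only [map_add, mul_add, ← ofLinear_apply] at *
    rw [hu, hv]
  | tmul a b =>
    rw [LinearMap.lTensor_tmul, of_tmul, of_tmul, tmul_mul, one_mul, LinearMap.mulLeft_apply,
      of_mul]

end Multiplier

/-! ### The counit of a multiplier Hopf algebra -/

section Slices

variable {k Q : Type*} [Field k] [AddCommGroup Q] [Module k Q]

/-- The slice map `ε ⊗ ι : Q ⊗ Y → Y`. -/
def sliceLeft (ε : Q →ₗ[k] k) (Y : Type*) [AddCommGroup Y] [Module k Y] : Q ⊗[k] Y →ₗ[k] Y :=
  (TensorProduct.lid k Y).toLinearMap ∘ₗ LinearMap.rTensor Y ε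

/-- The slice map `ι ⊗ ε : Y ⊗ Q → Y`. -/
def sliceRight (ε : Q →ₗ[k] k) (Y : Type*) [AddCommGroup Y] [Module k Y] : Y ⊗[k] Q →ₗ[k] Y :=
  (TensorProduct.rid k Y).toLinearMap ∘ₗ LinearMap.lTensor Y ε

@[simp] theorem sliceLeft_tmul (ε : Q →ₗ[k] k) {Y : Type*} [AddCommGroup Y] [Module k Y] (x : Q)
    (y : Y) : sliceLeft ε Y (x ⊗ₜ y) = ε x • y := by
  simp [sliceLeft]

@[simp] theorem sliceRight_tmul (ε : Q →ₗ[k] k) {Y : Type*} [AddCommGroup Y] [Module k Y] (x : Q)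
    (y : Y) : sliceRight ε Y (y ⊗ₜ x) = ε x • y := by
  simp [sliceRight]

end Slices

namespace MultiplierHopf

variable {k Q : Type*} [Field k] [NonUnitalRing Q] [Module k Q]
  [IsScalarTower k Q Q] [SMulCommClass k Q Q] [NondegenerateProduct Q]
variable (H : MultiplierHopf k Q)

theorem comul_left_T₁ (x : Q) (w : Q ⊗[k] Q) : (H.comul x).left (H.T₁ w) =
    H.T₁ (LinearMap.rTensor Q (LinearMap.mulLeft k x) w) := by
  induction w with
  | zero => simp
  | add u v hu hv => simp only [map_add, hu, hv]
  | tmul y z =>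
    apply Multiplier.of_injective (k := k)
    rw [Multiplier.of_left_apply, H.T₁_spec, LinearMap.rTensor_tmul, H.T₁_spec,
      LinearMap.mulLeft_apply, map_mul, mul_assoc]

theorem comul_left_tmul (x y z : Q) : (H.comul x).left (y ⊗ₜ z) =
    LinearMap.rTensor Q (LinearMap.mulRight k y) (H.T₁ (x ⊗ₜ z)) := by
  apply Multiplier.of_injective (k := k)
  rw [Multiplier.of_left_apply, Multiplier.of_rTensor_mulRight, H.T₁_spec, mul_assoc,
    Multiplier.tmul_mul, one_mul, mul_one, Multiplier.of_tmul]

theorem T₁_mul_right (y : Q) (w : Q ⊗[k] Q) :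
    H.T₁ (LinearMap.lTensor Q (LinearMap.mulRight k y) w) =
      LinearMap.lTensor Q (LinearMap.mulRight k y) (H.T₁ w) := by
  induction w with
  | zero => simp
  | add u v hu hv => simp only [map_add, hu, hv]
  | tmul x z =>
    apply Multiplier.of_injective (k := k)
    rw [Multiplier.of_lTensor_mulRight, LinearMap.lTensor_tmul, H.T₁_spec, H.T₁_spec, mul_assoc,
      Multiplier.tmul_mul, one_mul, LinearMap.mulRight_apply, Multiplier.of_mul]

theorem T₂_mul_right (x y z : Q) :
    LinearMap.lTensor Q (LinearMap.mulRight k z) (H.T₂ (x ⊗ₜ y)) =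
      LinearMap.rTensor Q (LinearMap.mulLeft k x) (H.T₁ (y ⊗ₜ z)) := by
  apply Multiplier.of_injective (k := k)
  rw [Multiplier.of_lTensor_mulRight, Multiplier.of_rTensor_mulLeft, H.T₁_spec, H.T₂_spec,
    mul_assoc]

/-- A counit of `H`. -/
structure IsCounit (ε : Q →ₗ[k] k) : Prop where
  sliceLeft_T₁ : ∀ x y : Q, sliceLeft ε Q (H.T₁ (x ⊗ₜ y)) = x * y
  sliceRight_T₂ : ∀ x y : Q, sliceRight ε Q (H.T₂ (x ⊗ₜ y)) = x * y

/-- The coassociativity of `H` says that `(ι ⊗ mT₁⁻¹)(T₂(x ⊗ y) ⊗ z) = xy ⊗ z`. As `T₂` is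
surjective, `mT₁⁻¹(y ⊗ z)` and `mT₂⁻¹(x ⊗ y)` are therefore the same scalar multiple of `z` and
of `x`, respectively. -/
theorem tmul_mul_T₁_symm (x y z : Q) :
    x ⊗ₜ[k] LinearMap.mul' k Q (H.T₁.symm (y ⊗ₜ z)) =
      LinearMap.mul' k Q (H.T₂.symm (x ⊗ₜ y)) ⊗ₜ[k] z := by
  have h1 : ∀ (x : Q) (w : Q ⊗[k] Q), LinearMap.lTensor Q (LinearMap.mul' k Q ∘ₗ
      H.T₁.symm.toLinearMap) (TensorProduct.assoc k Q Q Q (LinearMap.rTensor Q H.T₂.toLinearMap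
        ((TensorProduct.assoc k Q Q Q).symm (x ⊗ₜ w)))) =
      LinearMap.rTensor Q (LinearMap.mulLeft k x) w := by
    intro x w
    obtain ⟨w, rfl⟩ := H.T₁.surjective w
    induction w with
    | zero => simp
    | add u v hu hv => simp only [map_add, TensorProduct.tmul_add, hu, hv]
    | tmul y z =>
      rw [H.coassoc, ← T₂_mul_right, ← LinearMap.lTensor_comp_apply, LinearMap.comp_assoc,
        LinearEquiv.symm_comp, LinearMap.comp_id]
      induction H.T₂ (x ⊗ₜ y) with
      | zero => simp
      | add u v hu hv => simp only [map_add, TensorProduct.add_tmul, hu, hv]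
      | tmul p q => simp
  have h2 : ∀ w : Q ⊗[k] Q, LinearMap.lTensor Q (LinearMap.mul' k Q ∘ₗ
      H.T₁.symm.toLinearMap) (TensorProduct.assoc k Q Q Q (H.T₂ w ⊗ₜ z)) =
      LinearMap.mul' k Q w ⊗ₜ z := by
    intro w
    induction w with
    | zero => simp
    | add u v hu hv => simp only [map_add, TensorProduct.add_tmul, hu, hv]
    | tmul a b => simpa using h1 a (b ⊗ₜ z)
  simpa using h2 (H.T₂.symm (x ⊗ₜ y))

/-- The counit is determined by `ε(y)z = mT₁⁻¹(y ⊗ z)`. -/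
theorem exists_isCounit : ∃ ε : Q →ₗ[k] k, H.IsCounit ε := by
  rcases subsingleton_or_nontrivial Q with hQ | hQ
  · exact ⟨0, fun _ _ => Subsingleton.elim _ _, fun _ _ => Subsingleton.elim _ _⟩
  obtain ⟨p, hp⟩ := exists_ne (0 : Q)
  obtain ⟨ω, hω⟩ := Module.Projective.exists_dual_ne_zero k hp
  let ε : Q →ₗ[k] k := (ω p)⁻¹ • (ω ∘ₗ LinearMap.mul' k Q ∘ₗ H.T₂.symm.toLinearMap ∘ₗ
    TensorProduct.mk k Q Q p)
  have h1 : ∀ w, sliceLeft ε Q w = LinearMap.mul' k Q (H.T₁.symm w) := by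
    intro w
    induction w with
    | zero => simp
    | add u v hu hv => simp only [map_add, hu, hv]
    | tmul q c =>
      have := congrArg (sliceLeft ω Q) (H.tmul_mul_T₁_symm p q c)
      rw [sliceLeft_tmul, sliceLeft_tmul] at this
      rw [sliceLeft_tmul, ← inv_smul_smul₀ hω (LinearMap.mul' k Q _), this]
      simp [ε, mul_smul]
  have h2 : ∀ w, sliceRight ε Q w = LinearMap.mul' k Q (H.T₂.symm w) := by
    intro w
    induction w with
    | zero => simp
    | add u v hu hv => simp only [map_add, hu, hv]
    | tmul x q =>
      have := congrArg (sliceRight ω Q) (H.tmul_mul_T₁_symm x q p)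
      rw [← h1, sliceLeft_tmul, sliceRight_tmul, sliceRight_tmul, map_smul, smul_eq_mul,
        mul_comm, mul_smul] at this
      rw [sliceRight_tmul, ← inv_smul_smul₀ hω (LinearMap.mul' k Q _), ← this,
        inv_smul_smul₀ hω]
  exact ⟨ε, fun x y => by simp [h1], fun x y => by simp [h2]⟩

variable {H}

theorem Antipode.isCounit (S : H.Antipode) : H.IsCounit S.counit :=
  ⟨S.counit_T₁, S.counit_T₂⟩

namespace IsCounit

variable {ε : Q →ₗ[k] k} (hε : H.IsCounit ε)
include hε

theorem sliceLeft_apply_T₁ (w : Q ⊗[k] Q) : sliceLeft ε Q (H.T₁ w) = LinearMap.mul' k Q w := by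
  induction w with
  | zero => simp
  | add u v hu hv => simp only [map_add, hu, hv]
  | tmul x y => simp [hε.sliceLeft_T₁]

theorem map_mul (x y : Q) : ε (x * y) = ε x * ε y := by
  rcases subsingleton_or_nontrivial Q with hQ | hQ
  · rw [Subsingleton.elim (x * y) 0, Subsingleton.elim x 0]
    simp
  -- both sides of `(ε ⊗ ι)(w(y ⊗ 1)) = ε(y)(ε ⊗ ι)(w)` for `w` in the image of `T₁` come from
  -- `(ε ⊗ ι)(Δ(x)v) = x(ε ⊗ ι)(v)`
  have h1 : ∀ x (w : Q ⊗[k] Q), sliceLeft ε Q ((H.comul x).left w) = x * sliceLeft ε Q w := by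
    intro x w
    obtain ⟨w, rfl⟩ := H.T₁.surjective w
    rw [H.comul_left_T₁, hε.sliceLeft_apply_T₁, hε.sliceLeft_apply_T₁]
    induction w with
    | zero => simp
    | add u v hu hv => simp only [map_add, hu, hv, mul_add]
    | tmul a b => simp [mul_assoc]
  have h2 : ∀ w : Q ⊗[k] Q, sliceLeft ε Q (LinearMap.rTensor Q (LinearMap.mulRight k y) w) =
      ε y • sliceLeft ε Q w := by
    intro w
    obtain ⟨w, rfl⟩ := H.T₁.surjective w
    induction w with
    | zero => simp
    | add u v hu hv => simp only [map_add, hu, hv, smul_add]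
    | tmul a b =>
      rw [← H.comul_left_tmul, h1, hε.sliceLeft_T₁, sliceLeft_tmul, mul_smul_comm]
  obtain ⟨q, hq⟩ := exists_ne (0 : Q)
  have := h2 (x ⊗ₜ q)
  rw [LinearMap.rTensor_tmul, sliceLeft_tmul, sliceLeft_tmul, smul_smul,
    LinearMap.mulRight_apply] at this
  rw [smul_left_injective k hq this, mul_comm]

theorem exists_eq_one [Nontrivial Q] : ∃ x, ε x = 1 := by
  by_contra! h
  have h0 : ∀ x, ε x = 0 := fun x => by
    by_contra hx
    exact h ((ε x)⁻¹ • x) (by simp [hx])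
  obtain ⟨q, hq⟩ := exists_ne (0 : Q)
  refine hq (NondegenerateProduct.left q fun b => ?_)
  rw [← hε.sliceLeft_T₁, LinearMap.ext (g := (0 : Q →ₗ[k] k)) h0]
  simp [sliceLeft]

end IsCounit

/-! ### The antipode of a regular multiplier Hopf algebra -/

variable (H) in
/-- The map `x ⊗ y ↦ S(x)y`, in terms of which the antipode `S` is constructed. -/
def antipodeMul (ε : Q →ₗ[k] k) : Q ⊗[k] Q →ₗ[k] Q :=
  sliceLeft ε Q ∘ₗ H.T₁.symm.toLinearMap

theorem antipodeMul_T₁ (ε : Q →ₗ[k] k) (w : Q ⊗[k] Q) :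
    H.antipodeMul ε (H.T₁ w) = sliceLeft ε Q w := by
  simp [antipodeMul]

theorem antipodeMul_mul_right (ε : Q →ₗ[k] k) (y : Q) (w : Q ⊗[k] Q) :
    H.antipodeMul ε (LinearMap.lTensor Q (LinearMap.mulRight k y) w) =
      H.antipodeMul ε w * y := by
  obtain ⟨w, rfl⟩ := H.T₁.surjective w
  rw [← T₁_mul_right, antipodeMul_T₁, antipodeMul_T₁]
  induction w with
  | zero => simp
  | add u v hu hv => simp only [map_add, hu, hv, add_mul]
  | tmul a b => simp [smul_mul_assoc]

theorem IsCounit.antipodeMul_comul_left {ε : Q →ₗ[k] k} (hε : H.IsCounit ε) (x : Q)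
    (w : Q ⊗[k] Q) : H.antipodeMul ε ((H.comul x).left w) = ε x • H.antipodeMul ε w := by
  obtain ⟨w, rfl⟩ := H.T₁.surjective w
  rw [comul_left_T₁, antipodeMul_T₁, antipodeMul_T₁]
  induction w with
  | zero => simp
  | add u v hu hv => simp only [map_add, hu, hv, smul_add]
  | tmul a b => simp [hε.map_mul, mul_smul]

variable (H) in
/-- `H'` is a multiplier Hopf algebra structure whose comultiplication is the flip of that
of `H`. -/
def IsFlip (H' : MultiplierHopf k Q) : Prop :=
  ∀ x : Q, H'.comul x = Multiplier.congr (TensorProduct.comm k Q Q) comm_map_mul (H.comul x)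

theorem congr_comm_congr_comm (m : Multiplier k (Q ⊗[k] Q)) :
    Multiplier.congr (TensorProduct.comm k Q Q) comm_map_mul
      (Multiplier.congr (TensorProduct.comm k Q Q) comm_map_mul m) = m := by
  ext <;> simp

theorem congr_comm_tmul (m n : Multiplier k Q) :
    Multiplier.congr (TensorProduct.comm k Q Q) comm_map_mul (Multiplier.tmul m n) =
      Multiplier.tmul n m := by
  ext <;> simp

namespace IsFlip

variable {H' : MultiplierHopf k Q} (hH : H.IsFlip H')
include hH

theorem symm : H'.IsFlip H := fun x => by
  rw [hH, congr_comm_congr_comm]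

theorem of_comm_T₁ (x y : Q) : Multiplier.of k (TensorProduct.comm k Q Q (H'.T₁ (x ⊗ₜ y))) =
    H.comul x * Multiplier.tmul (Multiplier.of k y) 1 := by
  rw [← Multiplier.congr_of _ comm_map_mul, H'.T₁_spec, Multiplier.congr_mul, hH,
    congr_comm_congr_comm, congr_comm_tmul]

theorem comul_left_tmul (x y z : Q) : (H.comul x).left (y ⊗ₜ z) =
    LinearMap.lTensor Q (LinearMap.mulRight k z)
      (TensorProduct.comm k Q Q (H'.T₁ (x ⊗ₜ y))) := by
  apply Multiplier.of_injective (k := k)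
  rw [Multiplier.of_left_apply, Multiplier.of_lTensor_mulRight, hH.of_comm_T₁, mul_assoc,
    Multiplier.tmul_mul, one_mul, mul_one, Multiplier.of_tmul]

theorem counit_eq {ε ε' : Q →ₗ[k] k} (hε : H.IsCounit ε) (hε' : H'.IsCounit ε') : ε = ε' := by
  rcases subsingleton_or_nontrivial Q with hQ | hQ
  · ext x
    rw [Subsingleton.elim x 0, map_zero, map_zero]
  have h1 : ∀ x y, sliceRight ε Q (TensorProduct.comm k Q Q (H'.T₁ (x ⊗ₜ y))) = x * y := by
    intro x y
    rw [← sub_eq_zero]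
    refine NondegenerateProduct.right _ fun z => ?_
    have h2 : LinearMap.rTensor Q (LinearMap.mulLeft k z)
        (TensorProduct.comm k Q Q (H'.T₁ (x ⊗ₜ y))) =
        LinearMap.rTensor Q (LinearMap.mulRight k y) (H.T₂ (z ⊗ₜ x)) := by
      apply Multiplier.of_injective (k := k)
      rw [Multiplier.of_rTensor_mulLeft, Multiplier.of_rTensor_mulRight, hH.of_comm_T₁,
        H.T₂_spec, mul_assoc]
    have h3 : ∀ w : Q ⊗[k] Q, sliceRight ε Q (LinearMap.rTensor Q (LinearMap.mulLeft k z) w) =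
        z * sliceRight ε Q w := by
      intro w
      induction w with
      | zero => simp
      | add u v hu hv => simp only [map_add, hu, hv, mul_add]
      | tmul a b => simp [mul_smul_comm]
    have h4 : ∀ w : Q ⊗[k] Q, sliceRight ε Q (LinearMap.rTensor Q (LinearMap.mulRight k y) w) =
        sliceRight ε Q w * y := by
      intro w
      induction w with
      | zero => simp
      | add u v hu hv => simp only [map_add, hu, hv, add_mul]
      | tmul a b => simp [smul_mul_assoc]
    rw [mul_sub, ← h3, h2, h4, hε.sliceRight_T₂, mul_assoc, sub_self]
  have h2 : ∀ w : Q ⊗[k] Q, sliceRight ε Q (TensorProduct.comm k Q Q w) = sliceLeft ε' Q w := by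
    intro w
    obtain ⟨w, rfl⟩ := H'.T₁.surjective w
    induction w with
    | zero => simp
    | add u v hu hv => simp only [map_add, hu, hv]
    | tmul a b => rw [h1, hε'.sliceLeft_T₁]
  obtain ⟨q, hq⟩ := exists_ne (0 : Q)
  ext x
  have := h2 (x ⊗ₜ q)
  rw [TensorProduct.comm_tmul, sliceRight_tmul, sliceLeft_tmul] at this
  exact smul_left_injective k hq this

/-- From `S(x₁y)x₂ = ε(x)S(y)`, where `x₁y ⊗ x₂` lies in `Q ⊗ Q` because the flip of `Δ` is a
comultiplication, one sees that the antipode takes values in `Q` and not only in `M(Q)`. -/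
theorem exists_antipode [Nontrivial Q] {ε : Q →ₗ[k] k} (hε : H.IsCounit ε) :
    ∃ S : Q →ₗ[k] Q, (∀ x y, S x * y = H.antipodeMul ε (x ⊗ₜ y)) ∧
      ∀ x y, H.antipodeMul ε (TensorProduct.comm k Q Q (H'.T₁ (x ⊗ₜ y))) = ε x • S y := by
  obtain ⟨e, he⟩ := hε.exists_eq_one
  let S : Q →ₗ[k] Q := H.antipodeMul ε ∘ₗ (TensorProduct.comm k Q Q).toLinearMap ∘ₗ
    H'.T₁.toLinearMap ∘ₗ TensorProduct.mk k Q Q e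
  have h1 : ∀ x y z, H.antipodeMul ε (TensorProduct.comm k Q Q (H'.T₁ (x ⊗ₜ y))) * z =
      ε x • H.antipodeMul ε (y ⊗ₜ z) := by
    intro x y z
    rw [← antipodeMul_mul_right, ← hH.comul_left_tmul, hε.antipodeMul_comul_left]
  have h2 : ∀ x y, S x * y = H.antipodeMul ε (x ⊗ₜ y) := fun x y => by
    rw [← one_smul k (H.antipodeMul ε _), ← he]
    exact h1 e x y
  refine ⟨S, h2, fun x y => ?_⟩
  rw [← sub_eq_zero]
  refine NondegenerateProduct.left _ fun z => ?_
  rw [sub_mul, h1, smul_mul_assoc, h2, sub_self]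

end IsFlip

section AntipodeAxioms

variable {ε : Q →ₗ[k] k} (hε : H.IsCounit ε) {S : Q →ₗ[k] Q}
  (hS : ∀ x y, S x * y = H.antipodeMul ε (x ⊗ₜ y))
include hε hS

theorem mul_rTensor_antipode (w : Q ⊗[k] Q) :
    LinearMap.mul' k Q (LinearMap.rTensor Q S w) = H.antipodeMul ε w := by
  induction w with
  | zero => simp
  | add u v hu hv => simp only [map_add, hu, hv]
  | tmul a b => simp [hS]

theorem antipode_mul (x y : Q) : S (x * y) = S y * S x := by
  have h1 : ∀ w : Q ⊗[k] Q, H.antipodeMul ε (LinearMap.rTensor Q (LinearMap.mulRight k y) w) =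
      H.antipodeMul ε (y ⊗ₜ H.antipodeMul ε w) := by
    intro w
    obtain ⟨w, rfl⟩ := H.T₁.surjective w
    induction w with
    | zero => simp
    | add u v hu hv => simp only [map_add, TensorProduct.tmul_add, hu, hv]
    | tmul a b =>
      rw [← comul_left_tmul, hε.antipodeMul_comul_left, antipodeMul_T₁, sliceLeft_tmul,
        TensorProduct.tmul_smul, map_smul]
  rw [← sub_eq_zero]
  refine NondegenerateProduct.left _ fun z => ?_
  rw [sub_mul, mul_assoc, hS, hS, hS, ← h1]
  simp

theorem mul_lTensor_antipode (x y : Q) :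
    LinearMap.mul' k Q (LinearMap.lTensor Q S (H.T₂ (x ⊗ₜ y))) = ε y • x := by
  have h1 : ∀ w : Q ⊗[k] Q, LinearMap.mul' k Q (LinearMap.lTensor Q (H.antipodeMul ε)
      (TensorProduct.assoc k Q Q Q (LinearMap.rTensor Q H.T₂.toLinearMap
        ((TensorProduct.assoc k Q Q Q).symm (x ⊗ₜ w))))) = x * sliceLeft ε Q w := by
    intro w
    obtain ⟨w, rfl⟩ := H.T₁.surjective w
    induction w with
    | zero => simp
    | add u v hu hv => simp only [map_add, TensorProduct.tmul_add, hu, hv, mul_add]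
    | tmul b c =>
      rw [H.coassoc, hε.sliceLeft_T₁, ← mul_assoc, ← hε.sliceRight_T₂ x b]
      induction H.T₂ (x ⊗ₜ b) with
      | zero => simp
      | add u v hu hv => simp only [map_add, TensorProduct.add_tmul, hu, hv, add_mul]
      | tmul p q => simp [antipodeMul_T₁, smul_mul_assoc]
  rw [← sub_eq_zero]
  refine NondegenerateProduct.left _ fun z => ?_
  have h2 := h1 (y ⊗ₜ z)
  rw [sliceLeft_tmul, mul_smul_comm] at h2
  rw [sub_mul, smul_mul_assoc, ← h2, sub_eq_zero, TensorProduct.assoc_symm_tmul,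
    LinearMap.rTensor_tmul, LinearEquiv.coe_coe]
  induction H.T₂ (x ⊗ₜ y) with
  | zero => simp
  | add u v hu hv => simp only [map_add, TensorProduct.add_tmul, hu, hv, add_mul]
  | tmul p q => simp [← hS, mul_assoc]

theorem eq_zero_of_antipode_mul [Nontrivial Q] (d : Q) (hd : ∀ p, S p * d = 0) : d = 0 := by
  obtain ⟨e, he⟩ := hε.exists_eq_one
  have h1 : ∀ w : Q ⊗[k] Q, LinearMap.mul' k Q (LinearMap.lTensor Q S w) * d = 0 := by
    intro w
    induction w with
    | zero => simp
    | add u v hu hv => simp only [map_add, hu, hv, add_mul, add_zero]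
    | tmul a b => simp [mul_assoc, hd]
  refine NondegenerateProduct.right _ fun x => ?_
  have h2 := h1 (H.T₂ (x ⊗ₜ e))
  rwa [mul_lTensor_antipode hε hS, he, one_smul] at h2

end AntipodeAxioms

/-- The antipode of the flip of `H` is inverse to that of `H`: as `S(x₁y)x₂ = ε(x)S(y)`
and `S'(x₂)x₁y = ε(x)y`, both `q` and `S(S'(q))` have the same products with all `S(p)`. -/
theorem antipode_antipode [Nontrivial Q] {H' : MultiplierHopf k Q}
    {ε : Q →ₗ[k] k} (hε : H.IsCounit ε) {S S' : Q →ₗ[k] Q}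
    (hS : ∀ x y, S x * y = H.antipodeMul ε (x ⊗ₜ y))
    (hS' : ∀ x y, S' x * y = H'.antipodeMul ε (x ⊗ₜ y))
    (h : ∀ x y, H.antipodeMul ε (TensorProduct.comm k Q Q (H'.T₁ (x ⊗ₜ y))) = ε x • S y)
    (q : Q) : S (S' q) = q := by
  have h1 : ∀ w : Q ⊗[k] Q, LinearMap.mul' k Q (TensorProduct.map S (S ∘ₗ S')
      (TensorProduct.comm k Q Q w)) = H.antipodeMul ε (TensorProduct.comm k Q Q w) := by
    intro w
    obtain ⟨w, rfl⟩ := H'.T₁.surjective w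
    induction w with
    | zero => simp
    | add u v hu hv => simp only [map_add, hu, hv]
    | tmul x y =>
      rw [h]
      have h2 : ∀ w : Q ⊗[k] Q, LinearMap.mul' k Q (TensorProduct.map S (S ∘ₗ S')
          (TensorProduct.comm k Q Q w)) = S (H'.antipodeMul ε w) := by
        intro w
        induction w with
        | zero => simp
        | add u v hu hv => simp only [map_add, hu, hv]
        | tmul a b => simp [← hS', antipode_mul hε hS]
      rw [h2, antipodeMul_T₁, sliceLeft_tmul, map_smul]
  rw [← sub_eq_zero]
  refine eq_zero_of_antipode_mul hε hS _ fun p => ?_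
  have h2 := h1 (q ⊗ₜ p)
  rw [TensorProduct.comm_tmul, ← hS] at h2
  simpa [mul_sub, sub_eq_zero] using h2

/-- A regular multiplier Hopf algebra has an antipode: those of `H` and of its flip are inverse to
each other. -/
theorem IsRegular.nonempty_antipode (h : H.IsRegular) : Nonempty H.Antipode := by
  obtain ⟨H', hH⟩ := h
  change H.IsFlip H' at hH
  rcases subsingleton_or_nontrivial Q with hQ | hQ
  · exact ⟨⟨0, LinearEquiv.refl k Q, fun _ _ => Subsingleton.elim _ _,
      fun _ _ => Subsingleton.elim _ _, fun _ _ => Subsingleton.elim _ _,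
      fun _ _ => Subsingleton.elim _ _, fun _ _ => Subsingleton.elim _ _⟩⟩
  obtain ⟨ε, hε⟩ := H.exists_isCounit
  obtain ⟨ε', hε'⟩ := H'.exists_isCounit
  obtain rfl := hH.counit_eq hε hε'
  obtain ⟨S, hS, hS1⟩ := hH.exists_antipode hε
  obtain ⟨S', hS', hS1'⟩ := hH.symm.exists_antipode hε'
  refine ⟨⟨ε, LinearEquiv.ofLinearMap S S' ?_ ?_, hε.sliceLeft_T₁, hε.sliceRight_T₂, ?_, ?_, ?_⟩⟩
  · ext q
    exact antipode_antipode hε hS hS' hS1 q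
  · ext q
    exact antipode_antipode hε' hS' hS hS1' q
  · intro x y
    refine (mul_rTensor_antipode hε hS _).trans ?_
    rw [antipodeMul_T₁, sliceLeft_tmul]
  · exact mul_lTensor_antipode hε hS
  · exact antipode_mul hε hS

end MultiplierHopf

/-! ### Coassociativity of coactions -/

section LinearAlgebra

variable {k : Type*} [Field k]

theorem mulLeft_add_apply {X : Type*} [NonUnitalNonAssocRing X] [Module k X]
    [IsScalarTower k X X] [SMulCommClass k X X] (x y : X) :
    LinearMap.mulLeft k (x + y) = LinearMap.mulLeft k x + LinearMap.mulLeft k y := by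
  ext
  simp [add_mul]

theorem mulRight_add_apply {X : Type*} [NonUnitalNonAssocRing X] [Module k X]
    [IsScalarTower k X X] [SMulCommClass k X X] (x y : X) :
    LinearMap.mulRight k (x + y) = LinearMap.mulRight k x + LinearMap.mulRight k y := by
  ext
  simp [mul_add]

theorem rTensor_lTensor_apply {X X' Y Y' : Type*} [AddCommGroup X] [Module k X]
    [AddCommGroup X'] [Module k X'] [AddCommGroup Y] [Module k Y] [AddCommGroup Y'] [Module k Y']
    (f : X →ₗ[k] X') (g : Y →ₗ[k] Y') (z : X ⊗[k] Y) :
    LinearMap.rTensor Y' f (LinearMap.lTensor X g z) =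
      LinearMap.lTensor X' g (LinearMap.rTensor Y f z) := by
  induction z with
  | zero => simp
  | tmul x y => simp
  | add u v hu hv => simp only [map_add, hu, hv]

end LinearAlgebra

section CoactionLemmas

variable {k Q : Type*} [Field k] [NonUnitalRing Q] [Module k Q]
  [IsScalarTower k Q Q] [SMulCommClass k Q Q] [NondegenerateProduct Q]
variable {B : Type*} [NonUnitalRing B] [Module k B] [IsScalarTower k B B] [SMulCommClass k B B]
  [NondegenerateProduct B]

theorem MultiplierHopf.T₂_mul_T₁ (H : MultiplierHopf k Q) (x y z w : Q) :
    H.T₂ (x ⊗ₜ y) * H.T₁ (z ⊗ₜ w) =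
      LinearMap.rTensor Q (LinearMap.mulLeft k x) (H.T₁ ((y * z) ⊗ₜ w)) := by
  apply Multiplier.of_injective (k := k)
  rw [Multiplier.of_mul, Multiplier.of_rTensor_mulLeft, H.T₁_spec, H.T₁_spec, H.T₂_spec, map_mul]
  simp only [mul_assoc]

theorem MultiplierHopf.eq_zero_of_mul_T₁ (H : MultiplierHopf k Q) (w : Q ⊗[k] Q)
    (h : ∀ i : Q × Q, w * H.T₁ (i.1 ⊗ₜ i.2) = 0) : w = 0 := by
  refine NondegenerateProduct.left w fun v => ?_
  obtain ⟨v, rfl⟩ := H.T₁.surjective v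
  induction v with
  | zero => simp
  | add u v hu hv => rw [map_add, mul_add, hu, hv, add_zero]
  | tmul x y => exact h (x, y)

namespace LeftCoaction

variable (γ : LeftCoaction k Q B)

theorem coact_left_tmul (b c : B) (x : Q) : (γ.coact b).left (x ⊗ₜ c) =
    LinearMap.lTensor Q (LinearMap.mulRight k c) (γ.coverR b x) := by
  apply Multiplier.of_injective (k := k)
  rw [Multiplier.of_left_apply, Multiplier.of_lTensor_mulRight, γ.coverR_spec, mul_assoc,
    Multiplier.tmul_mul, one_mul, mul_one, Multiplier.of_tmul]

theorem mulRight_coverL (b : B) (x y : Q) :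
    LinearMap.rTensor B (LinearMap.mulRight k y) (γ.coverL b x) =
      LinearMap.rTensor B (LinearMap.mulLeft k x) (γ.coverR b y) := by
  apply Multiplier.of_injective (k := k)
  rw [Multiplier.of_rTensor_mulRight, Multiplier.of_rTensor_mulLeft, γ.coverR_spec, γ.coverL_spec,
    mul_assoc]

/-- The map `u ⊗ v ↦ (ι ⊗ Γ)(Γ(b)(u ⊗ 1))(1 ⊗ v ⊗ 1)`. -/
def coverR₂ (b : B) : Q ⊗[k] Q →ₗ[k] Q ⊗[k] (Q ⊗[k] B) :=
  TensorProduct.lift ((LinearMap.lTensorHom Q ∘ₗ γ.coverR.flip).flip ∘ₗ γ.coverR b)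

/-- The map `u ⊗ v ↦ (1 ⊗ v ⊗ 1)(ι ⊗ Γ)((u ⊗ 1)Γ(b))`. -/
def coverL₂ (b : B) : Q ⊗[k] Q →ₗ[k] Q ⊗[k] (Q ⊗[k] B) :=
  TensorProduct.lift ((LinearMap.lTensorHom Q ∘ₗ γ.coverL.flip).flip ∘ₗ γ.coverL b)

theorem coverR₂_tmul (b : B) (u v : Q) :
    γ.coverR₂ b (u ⊗ₜ v) = LinearMap.lTensor Q (γ.coverR.flip v) (γ.coverR b u) := by
  simp [coverR₂]

theorem coverL₂_tmul (b : B) (u v : Q) :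
    γ.coverL₂ b (u ⊗ₜ v) = LinearMap.lTensor Q (γ.coverL.flip v) (γ.coverL b u) := by
  simp [coverL₂]

theorem coverR₂_add (b c : B) (t : Q ⊗[k] Q) :
    γ.coverR₂ (b + c) t = γ.coverR₂ b t + γ.coverR₂ c t := by
  induction t with
  | zero => simp
  | add u v hu hv => rw [map_add, map_add, map_add, hu, hv, add_add_add_comm]
  | tmul u v => simp [coverR₂_tmul]

theorem coverR₂_zero (t : Q ⊗[k] Q) : γ.coverR₂ 0 t = 0 := by
  simpa using γ.coverR₂_add 0 0 t

theorem mulRight_coverL₂ (b : B) (w w' : Q ⊗[k] Q) :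
    LinearMap.rTensor B (LinearMap.mulRight k w')
        ((TensorProduct.assoc k Q Q B).symm (γ.coverL₂ b w)) =
      LinearMap.rTensor B (LinearMap.mulLeft k w)
        ((TensorProduct.assoc k Q Q B).symm (γ.coverR₂ b w')) := by
  have h1 : ∀ (v u' v' : Q) (z : Q ⊗[k] B), LinearMap.rTensor B (LinearMap.mulRight k (u' ⊗ₜ v'))
      ((TensorProduct.assoc k Q Q B).symm (LinearMap.lTensor Q (γ.coverL.flip v) z)) =
      (TensorProduct.assoc k Q Q B).symm (LinearMap.lTensor Q
        (LinearMap.rTensor B (LinearMap.mulLeft k v) ∘ₗ γ.coverR.flip v')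
        (LinearMap.rTensor B (LinearMap.mulRight k u') z)) := by
    intro v u' v' z
    induction z with
    | zero => simp
    | add x y hx hy => simp only [map_add, hx, hy]
    | tmul p c =>
      simp only [LinearMap.lTensor_tmul, LinearMap.rTensor_tmul, LinearMap.comp_apply,
        LinearMap.flip_apply, ← mulRight_coverL]
      induction γ.coverL c v with
      | zero => simp
      | add x y hx hy => simp only [map_add, TensorProduct.tmul_add, hx, hy]
      | tmul q d => simp
  have h2 : ∀ (u v v' : Q) (z : Q ⊗[k] B), LinearMap.rTensor B (LinearMap.mulLeft k (u ⊗ₜ v))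
      ((TensorProduct.assoc k Q Q B).symm (LinearMap.lTensor Q (γ.coverR.flip v') z)) =
      (TensorProduct.assoc k Q Q B).symm (LinearMap.lTensor Q
        (LinearMap.rTensor B (LinearMap.mulLeft k v) ∘ₗ γ.coverR.flip v')
        (LinearMap.rTensor B (LinearMap.mulLeft k u) z)) := by
    intro u v v' z
    induction z with
    | zero => simp
    | add x y hx hy => simp only [map_add, hx, hy]
    | tmul p c =>
      simp only [LinearMap.lTensor_tmul, LinearMap.rTensor_tmul, LinearMap.comp_apply,
        LinearMap.flip_apply]
      induction γ.coverR c v' with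
      | zero => simp
      | add x y hx hy => simp only [map_add, TensorProduct.tmul_add, hx, hy]
      | tmul q d => simp
  induction w with
  | zero => simp [LinearMap.mulLeft_zero_eq_zero]
  | add x y hx hy =>
    rw [map_add, map_add, map_add, hx, hy, mulLeft_add_apply, LinearMap.rTensor_add,
      LinearMap.add_apply]
  | tmul u v =>
    induction w' with
    | zero => simp [LinearMap.mulRight_zero_eq_zero]
    | add x y hx hy =>
      rw [mulRight_add_apply, LinearMap.rTensor_add, LinearMap.add_apply, hx, hy, map_add,
        map_add, map_add]
    | tmul u' v' => rw [coverL₂_tmul, coverR₂_tmul, h1, mulRight_coverL, ← h2]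

variable {γ}

/-- Coassociativity `(ι ⊗ Γ)Γ = (Δ ⊗ ι)Γ`, multiplied on the left by `(y ⊗ 1)Δ(z) ⊗ 1`. -/
theorem IsComoduleAlgebra.coassoc_coverL {H : MultiplierHopf k Q} (hγ : γ.IsComoduleAlgebra H)
    (b : B) (z y : Q) : TensorProduct.assoc k Q Q B
      (LinearMap.rTensor B (H.T₂.toLinearMap ∘ₗ TensorProduct.mk k Q Q y) (γ.coverL b z)) =
      γ.coverL₂ b (H.T₂ (y ⊗ₜ z)) := by
  rw [← LinearEquiv.eq_symm_apply, ← sub_eq_zero]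
  refine rTensor_jointly_injective (fun i : Q × Q => LinearMap.mulRight k (H.T₁ (i.1 ⊗ₜ i.2)))
    H.eq_zero_of_mul_T₁ _ fun i => ?_
  -- both sides become `(y ⊗ 1 ⊗ 1)(Δ ⊗ ι)((z ⊗ 1)Γ(b)(i₁ ⊗ 1))(1 ⊗ i₂ ⊗ 1)`
  have h1 : LinearMap.mulRight k (H.T₁ (i.1 ⊗ₜ i.2)) ∘ₗ H.T₂.toLinearMap ∘ₗ
      TensorProduct.mk k Q Q y = (LinearMap.rTensor Q (LinearMap.mulLeft k y) ∘ₗ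
        H.T₁.toLinearMap ∘ₗ (TensorProduct.mk k Q Q).flip i.2) ∘ₗ LinearMap.mulRight k i.1 := by
    ext p
    simp [H.T₂_mul_T₁]
  have h2 : (LinearMap.rTensor Q (LinearMap.mulLeft k y) ∘ₗ
        H.T₁.toLinearMap ∘ₗ (TensorProduct.mk k Q Q).flip i.2) ∘ₗ LinearMap.mulLeft k z =
      LinearMap.mulLeft k (H.T₂ (y ⊗ₜ z)) ∘ₗ H.T₁.toLinearMap ∘ₗ
        (TensorProduct.mk k Q Q).flip i.2 := by
    ext p
    simp [H.T₂_mul_T₁]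
  rw [map_sub, mulRight_coverL₂, sub_eq_zero, ← LinearMap.rTensor_comp_apply, h1,
    LinearMap.rTensor_comp_apply, mulRight_coverL, ← LinearMap.rTensor_comp_apply, h2,
    LinearMap.rTensor_comp_apply]
  congr 1
  rw [LinearEquiv.eq_symm_apply]
  exact hγ.coassoc b i.1 i.2

end LeftCoaction

namespace RightCoaction

variable (υ : RightCoaction k Q B)

theorem coact_right_tmul (b c : B) (x : Q) : (υ.coact b).right (c ⊗ₜ x) =
    LinearMap.rTensor Q (LinearMap.mulLeft k c) (υ.coverL b x) := by
  apply Multiplier.of_injective (k := k)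
  rw [Multiplier.of_right_apply, Multiplier.of_rTensor_mulLeft, υ.coverL_spec, ← mul_assoc,
    Multiplier.tmul_mul, one_mul, mul_one, Multiplier.of_tmul]

theorem mulRight_coverL (b : B) (x y : Q) :
    LinearMap.lTensor B (LinearMap.mulRight k y) (υ.coverL b x) =
      LinearMap.lTensor B (LinearMap.mulLeft k x) (υ.coverR b y) := by
  apply Multiplier.of_injective (k := k)
  rw [Multiplier.of_lTensor_mulRight, Multiplier.of_lTensor_mulLeft, υ.coverR_spec, υ.coverL_spec,
    mul_assoc]

/-- The map `u ⊗ v ↦ (Υ ⊗ ι)(Υ(b)(1 ⊗ v))(1 ⊗ u ⊗ 1)`. -/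
def coverR₂ (b : B) : Q ⊗[k] Q →ₗ[k] B ⊗[k] (Q ⊗[k] Q) :=
  (TensorProduct.assoc k B Q Q).toLinearMap ∘ₗ TensorProduct.lift
    (((LinearMap.rTensorHom Q ∘ₗ υ.coverR.flip).flip ∘ₗ υ.coverR b).flip)

/-- The map `u ⊗ v ↦ (1 ⊗ u ⊗ 1)(Υ ⊗ ι)((1 ⊗ v)Υ(b))`. -/
def coverL₂ (b : B) : Q ⊗[k] Q →ₗ[k] B ⊗[k] (Q ⊗[k] Q) :=
  (TensorProduct.assoc k B Q Q).toLinearMap ∘ₗ TensorProduct.lift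
    (((LinearMap.rTensorHom Q ∘ₗ υ.coverL.flip).flip ∘ₗ υ.coverL b).flip)

theorem coverR₂_tmul (b : B) (u v : Q) : υ.coverR₂ b (u ⊗ₜ v) =
    TensorProduct.assoc k B Q Q (LinearMap.rTensor Q (υ.coverR.flip u) (υ.coverR b v)) := by
  simp [coverR₂]

theorem coverL₂_tmul (b : B) (u v : Q) : υ.coverL₂ b (u ⊗ₜ v) =
    TensorProduct.assoc k B Q Q (LinearMap.rTensor Q (υ.coverL.flip u) (υ.coverL b v)) := by
  simp [coverL₂]

theorem coverR₂_add (b c : B) (t : Q ⊗[k] Q) :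
    υ.coverR₂ (b + c) t = υ.coverR₂ b t + υ.coverR₂ c t := by
  induction t with
  | zero => simp
  | add u v hu hv => rw [map_add, map_add, map_add, hu, hv, add_add_add_comm]
  | tmul u v => simp [coverR₂_tmul]

theorem coverR₂_zero (t : Q ⊗[k] Q) : υ.coverR₂ 0 t = 0 := by
  simpa using υ.coverR₂_add 0 0 t

theorem mulRight_coverL₂ (b : B) (w w' : Q ⊗[k] Q) :
    LinearMap.lTensor B (LinearMap.mulRight k w') (υ.coverL₂ b w) =
      LinearMap.lTensor B (LinearMap.mulLeft k w) (υ.coverR₂ b w') := by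
  have h1 : ∀ (u u' v' : Q) (z : B ⊗[k] Q), LinearMap.lTensor B (LinearMap.mulRight k (u' ⊗ₜ v'))
      (TensorProduct.assoc k B Q Q (LinearMap.rTensor Q (υ.coverL.flip u) z)) =
      TensorProduct.assoc k B Q Q (LinearMap.rTensor Q
        (LinearMap.lTensor B (LinearMap.mulLeft k u) ∘ₗ υ.coverR.flip u')
        (LinearMap.lTensor B (LinearMap.mulRight k v') z)) := by
    intro u u' v' z
    induction z with
    | zero => simp
    | add x y hx hy => simp only [map_add, hx, hy]
    | tmul c p =>
      simp only [LinearMap.lTensor_tmul, LinearMap.rTensor_tmul, LinearMap.comp_apply,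
        LinearMap.flip_apply, ← mulRight_coverL]
      induction υ.coverL c u with
      | zero => simp
      | add x y hx hy => simp only [map_add, TensorProduct.add_tmul, hx, hy]
      | tmul d q => simp
  have h2 : ∀ (u v u' : Q) (z : B ⊗[k] Q), LinearMap.lTensor B (LinearMap.mulLeft k (u ⊗ₜ v))
      (TensorProduct.assoc k B Q Q (LinearMap.rTensor Q (υ.coverR.flip u') z)) =
      TensorProduct.assoc k B Q Q (LinearMap.rTensor Q
        (LinearMap.lTensor B (LinearMap.mulLeft k u) ∘ₗ υ.coverR.flip u')
        (LinearMap.lTensor B (LinearMap.mulLeft k v) z)) := by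
    intro u v u' z
    induction z with
    | zero => simp
    | add x y hx hy => simp only [map_add, hx, hy]
    | tmul c p =>
      simp only [LinearMap.lTensor_tmul, LinearMap.rTensor_tmul, LinearMap.comp_apply,
        LinearMap.flip_apply]
      induction υ.coverR c u' with
      | zero => simp
      | add x y hx hy => simp only [map_add, TensorProduct.add_tmul, hx, hy]
      | tmul d q => simp
  induction w with
  | zero => simp [LinearMap.mulLeft_zero_eq_zero]
  | add x y hx hy =>
    rw [map_add, map_add, hx, hy, mulLeft_add_apply, LinearMap.lTensor_add,
      LinearMap.add_apply]
  | tmul u v =>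
    induction w' with
    | zero => simp [LinearMap.mulRight_zero_eq_zero]
    | add x y hx hy =>
      rw [mulRight_add_apply, LinearMap.lTensor_add, LinearMap.add_apply, hx, hy, map_add,
        map_add]
    | tmul u' v' => rw [coverL₂_tmul, coverR₂_tmul, h1, mulRight_coverL, ← h2]

variable {υ}

/-- Coassociativity `(Υ ⊗ ι)Υ = (ι ⊗ Δ)Υ`, multiplied on the left by `1 ⊗ (y ⊗ 1)Δ(z)`. -/
theorem IsComoduleAlgebra.coassoc_coverL {H : MultiplierHopf k Q} (hυ : υ.IsComoduleAlgebra H)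
    (b : B) (z y : Q) :
    LinearMap.lTensor B (H.T₂.toLinearMap ∘ₗ TensorProduct.mk k Q Q y) (υ.coverL b z) =
      υ.coverL₂ b (H.T₂ (y ⊗ₜ z)) := by
  rw [← sub_eq_zero]
  refine lTensor_jointly_injective (fun i : Q × Q => LinearMap.mulRight k (H.T₁ (i.1 ⊗ₜ i.2)))
    H.eq_zero_of_mul_T₁ _ fun i => ?_
  -- both sides become `(1 ⊗ y ⊗ 1)(ι ⊗ Δ)((1 ⊗ z)Υ(b)(1 ⊗ i₁))(1 ⊗ 1 ⊗ i₂)`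
  have h1 : LinearMap.mulRight k (H.T₁ (i.1 ⊗ₜ i.2)) ∘ₗ H.T₂.toLinearMap ∘ₗ
      TensorProduct.mk k Q Q y = (LinearMap.rTensor Q (LinearMap.mulLeft k y) ∘ₗ
        H.T₁.toLinearMap ∘ₗ (TensorProduct.mk k Q Q).flip i.2) ∘ₗ LinearMap.mulRight k i.1 := by
    ext p
    simp [H.T₂_mul_T₁]
  have h2 : (LinearMap.rTensor Q (LinearMap.mulLeft k y) ∘ₗ
        H.T₁.toLinearMap ∘ₗ (TensorProduct.mk k Q Q).flip i.2) ∘ₗ LinearMap.mulLeft k z =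
      LinearMap.mulLeft k (H.T₂ (y ⊗ₜ z)) ∘ₗ H.T₁.toLinearMap ∘ₗ
        (TensorProduct.mk k Q Q).flip i.2 := by
    ext p
    simp [H.T₂_mul_T₁]
  rw [map_sub, mulRight_coverL₂, sub_eq_zero, ← LinearMap.lTensor_comp_apply, h1,
    LinearMap.lTensor_comp_apply, mulRight_coverL, ← LinearMap.lTensor_comp_apply, h2,
    LinearMap.lTensor_comp_apply]
  congr 1
  exact hυ.coassoc b i.1 i.2

end RightCoaction

end CoactionLemmas

/-! ### The twists of a module algebra are twisting maps -/

section TwistsAreTwistingMaps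

variable {k Q : Type*} [Field k] [NonUnitalRing Q] [Module k Q]
  [IsScalarTower k Q Q] [SMulCommClass k Q Q] [NondegenerateProduct Q] [LocalUnits Q]
variable {B : Type*} [NonUnitalRing B] [Module k B] [IsScalarTower k B B] [SMulCommClass k B B]
  [NondegenerateProduct B]
variable {V : Type*} [NonUnitalNonAssocRing V] [Module k V] [IsScalarTower k V V]
  [SMulCommClass k V V]

theorem UnitalLeftModule.induction_on {V : Type*} [AddCommGroup V] [Module k V]
    (M : UnitalLeftModule k Q V) {p : V → Prop} (v : V) (zero : p 0)
    (act : ∀ x w, p (M.act x w)) (add : ∀ u v, p u → p v → p (u + v)) : p v := by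
  obtain ⟨z, rfl⟩ := M.unital v
  induction z with
  | zero => simpa using zero
  | tmul x w => simpa using act x w
  | add u v hu hv => simpa using add _ _ hu hv

theorem UnitalRightModule.induction_on {V : Type*} [AddCommGroup V] [Module k V]
    (M : UnitalRightModule k Q V) {p : V → Prop} (v : V) (zero : p 0)
    (act : ∀ x w, p (M.act x w)) (add : ∀ u v, p u → p v → p (u + v)) : p v := by
  obtain ⟨z, rfl⟩ := M.unital v
  induction z with
  | zero => simpa using zero
  | tmul x w => simpa using act x w
  | add u v hu hv => simpa using add _ _ hu hv

theorem UnitalLeftModule.leftTwist_mul_tmul {H : MultiplierHopf k Q} (M : UnitalLeftModule k Q V)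
    {γ : LeftCoaction k Q B} (hγ : γ.IsComoduleAlgebra H) (b b' : B) (v : V) :
    M.leftTwist γ ((b * b') ⊗ₜ v) =
      twistMulLeft (M.leftTwist γ) b (M.leftTwist γ (b' ⊗ₜ v)) := by
  have h1 : ∀ (w : V) (z : Q ⊗[k] B), twistMulLeft (M.leftTwist γ) b
      (LinearMap.rTensor B (M.act.flip w) z) =
      LinearMap.rTensor B (M.act.flip w) ((γ.coact b).left z) := by
    intro w z
    induction z with
    | zero => simp
    | add u v hu hv => simp only [map_add, hu, hv]
    | tmul q c =>
      rw [LinearMap.rTensor_tmul, twistMulLeft_tmul, LinearMap.flip_apply, M.leftTwist_tmul,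
        γ.coact_left_tmul, rTensor_lTensor_apply]
  induction v using M.induction_on with
  | zero => simp
  | add u v hu hv => simp only [TensorProduct.tmul_add, map_add, hu, hv]
  | act x w =>
    rw [M.leftTwist_tmul, M.leftTwist_tmul, h1]
    congr 1
    apply Multiplier.of_injective (k := k)
    rw [Multiplier.of_left_apply, γ.coverR_spec, γ.coverR_spec, hγ.map_mul, mul_assoc]

/-- The twist `b ⊗ v ↦ ∑ (b₍₋₁₎ ▷ v) ⊗ b₀` is a twisting map. In
`b ⊗ vv' ↦ ∑ (b₍₋₂₎ ▷ v)(b₍₋₁₎ ▷ v') ⊗ b₀` one may take `v = q ▷ w`, `v' = y ▷ w'`; with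
`q ⊗ y = T₁(t)` the module algebra property and coassociativity apply to `t`. -/
theorem UnitalLeftModule.IsModuleAlgebra.isTwistingMap {H : MultiplierHopf k Q}
    {M : UnitalLeftModule k Q V} (hM : M.IsModuleAlgebra H) {γ : LeftCoaction k Q B}
    (hγ : γ.IsComoduleAlgebra H) : IsTwistingMap (M.leftTwist γ) where
  mul_tmul := M.leftTwist_mul_tmul hγ
  tmul_mul b v v' := by
    induction v using M.induction_on with
    | zero => simp
    | add u v hu hv => simp only [TensorProduct.tmul_add, map_add, add_mul, hu, hv]
    | act q w =>
      induction v' using M.induction_on with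
      | zero => simp [twistMulRight]
      | add u v hu hv =>
        simp only [TensorProduct.tmul_add, map_add, mul_add, hu, hv]
        simp [twistMulRight, LinearMap.lTensor_add]
      | act y w' =>
        let F : Q ⊗[k] Q →ₗ[k] V :=
          LinearMap.mul' k V ∘ₗ TensorProduct.map (M.act.flip w) (M.act.flip w')
        have h1 : ∀ t, M.leftTwist γ (b ⊗ₜ F t) = LinearMap.rTensor B F
            ((TensorProduct.assoc k Q Q B).symm (γ.coverR₂ b t)) := by
          intro t
          obtain ⟨t, rfl⟩ := H.T₁.surjective t
          induction t with
          | zero => simp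
          | add u v hu hv => simp only [map_add, TensorProduct.tmul_add, hu, hv]
          | tmul z x =>
            have h2 : ∀ p, F (H.T₁ (p ⊗ₜ x)) = M.act p (w * M.act x w') :=
              fun p => (hM p x w w').symm
            have h3 := hγ.coassoc b z x
            rw [← LinearEquiv.eq_symm_apply] at h3
            rw [LeftCoaction.coverR₂, ← h3, h2, M.leftTwist_tmul, ← LinearMap.rTensor_comp_apply]
            congr 2
            ext p
            simp [h2]
        have h2 : M.act q w * M.act y w' = F (q ⊗ₜ y) := by simp [F]
        rw [h2, h1, γ.coverR₂_tmul, M.leftTwist_tmul]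
        induction γ.coverR b q with
        | zero => simp
        | add u v hu hv => simp only [map_add, hu, hv]
        | tmul p c =>
          rw [LinearMap.rTensor_tmul, twistMulRight_tmul, M.leftTwist_tmul, LinearMap.lTensor_tmul,
            LinearMap.flip_apply, LinearMap.flip_apply]
          induction γ.coverR c y with
          | zero => simp
          | add u v hu hv => simp only [map_add, TensorProduct.tmul_add, hu, hv]
          | tmul x d => simp [F]

theorem UnitalRightModule.rightTwist_tmul_mul {H : MultiplierHopf k Q}
    (M : UnitalRightModule k Q V) {υ : RightCoaction k Q B} (hυ : υ.IsComoduleAlgebra H)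
    (v : V) (b b' : B) : M.rightTwist υ (v ⊗ₜ (b * b')) =
      twistMulRight (M.rightTwist υ) b' (M.rightTwist υ (v ⊗ₜ b)) := by
  have h1 : ∀ (w : V) (z : B ⊗[k] Q), twistMulRight (M.rightTwist υ) b'
      (LinearMap.lTensor B (M.act.flip w) z) =
      LinearMap.lTensor B (M.act.flip w) ((υ.coact b').right z) := by
    intro w z
    induction z with
    | zero => simp
    | add u v hu hv => simp only [map_add, hu, hv]
    | tmul c q =>
      rw [LinearMap.lTensor_tmul, twistMulRight_tmul, LinearMap.flip_apply, M.rightTwist_tmul,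
        υ.coact_right_tmul, rTensor_lTensor_apply]
  induction v using M.induction_on with
  | zero => simp
  | add u v hu hv => simp only [TensorProduct.add_tmul, map_add, hu, hv]
  | act x w =>
    rw [M.rightTwist_tmul, M.rightTwist_tmul, h1]
    congr 1
    apply Multiplier.of_injective (k := k)
    rw [Multiplier.of_right_apply, υ.coverL_spec, υ.coverL_spec, hυ.map_mul, mul_assoc]

/-- The twist `v ⊗ b ↦ ∑ b₀ ⊗ (v ◁ b₍₁₎)` is a twisting map. -/
theorem UnitalRightModule.IsModuleAlgebra.isTwistingMap {H : MultiplierHopf k Q}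
    {M : UnitalRightModule k Q V} (hM : M.IsModuleAlgebra H) {υ : RightCoaction k Q B}
    (hυ : υ.IsComoduleAlgebra H) : IsTwistingMap (M.rightTwist υ) where
  tmul_mul := M.rightTwist_tmul_mul hυ
  mul_tmul v v' b := by
    induction v using M.induction_on with
    | zero => simp [twistMulLeft]
    | add u v hu hv =>
      simp only [TensorProduct.add_tmul, map_add, add_mul, hu, hv]
      simp [twistMulLeft, LinearMap.rTensor_add]
    | act q w =>
      induction v' using M.induction_on with
      | zero => simp
      | add u v hu hv => simp only [TensorProduct.add_tmul, map_add, mul_add, hu, hv]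
      | act y w' =>
        let F : Q ⊗[k] Q →ₗ[k] V :=
          LinearMap.mul' k V ∘ₗ TensorProduct.map (M.act.flip w) (M.act.flip w')
        have h1 : ∀ t, M.rightTwist υ (F t ⊗ₜ b) = LinearMap.lTensor B F (υ.coverL₂ b t) := by
          intro t
          obtain ⟨t, rfl⟩ := H.T₂.surjective t
          induction t with
          | zero => simp
          | add u v hu hv => simp only [map_add, TensorProduct.add_tmul, hu, hv]
          | tmul x z =>
            have h2 : ∀ p, F (H.T₂ (x ⊗ₜ p)) = M.act p (M.act x w * w') :=
              fun p => (hM p x w w').symm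
            rw [← hυ.coassoc_coverL, h2, M.rightTwist_tmul, ← LinearMap.lTensor_comp_apply]
            congr 2
            ext p
            simp [h2]
        have h2 : M.act q w * M.act y w' = F (q ⊗ₜ y) := by simp [F]
        rw [h2, h1, υ.coverL₂_tmul, M.rightTwist_tmul]
        induction υ.coverL b y with
        | zero => simp
        | add u v hu hv => simp only [map_add, hu, hv]
        | tmul c p =>
          rw [LinearMap.lTensor_tmul, twistMulLeft_tmul, M.rightTwist_tmul, LinearMap.rTensor_tmul,
            LinearMap.flip_apply, LinearMap.flip_apply]
          induction υ.coverL c q with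
          | zero => simp
          | add u v hu hv => simp only [map_add, TensorProduct.add_tmul, hu, hv]
          | tmul d x => simp [F]

end TwistsAreTwistingMaps

/-! ### The bicomodule algebra `A ⊗ B` -/

section OnTensor

variable {k Q : Type*} [Field k] [NonUnitalRing Q] [Module k Q]
  [IsScalarTower k Q Q] [SMulCommClass k Q Q] [NondegenerateProduct Q]
variable {A : Type*} [NonUnitalRing A] [Module k A] [IsScalarTower k A A] [SMulCommClass k A A]
  [NondegenerateProduct A]
variable {B : Type*} [NonUnitalRing B] [Module k B] [IsScalarTower k B B] [SMulCommClass k B B]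
  [NondegenerateProduct B]

theorem LeftCoaction.onTensor_coact_tmul (γ : LeftCoaction k Q B) (a : A) (b : B) :
    (γ.onTensor A).coact (a ⊗ₜ b) =
      Multiplier.leftComm k A Q B (Multiplier.tmul (Multiplier.of k a) (γ.coact b)) :=
  rfl

theorem LeftCoaction.onTensor_coverR_tmul (γ : LeftCoaction k Q B) (a : A) (b : B) (x : Q) :
    (γ.onTensor A).coverR (a ⊗ₜ b) x = TensorProduct.leftComm k A Q B (a ⊗ₜ γ.coverR b x) :=
  rfl

theorem LeftCoaction.onTensor_coverL_tmul (γ : LeftCoaction k Q B) (a : A) (b : B) (x : Q) :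
    (γ.onTensor A).coverL (a ⊗ₜ b) x = TensorProduct.leftComm k A Q B (a ⊗ₜ γ.coverL b x) :=
  rfl

theorem RightCoaction.onTensor_coact_tmul (υ : RightCoaction k Q A) (a : A) (b : B) :
    (υ.onTensor B).coact (a ⊗ₜ b) =
      Multiplier.rightComm k A Q B (Multiplier.tmul (υ.coact a) (Multiplier.of k b)) :=
  rfl

theorem RightCoaction.onTensor_coverR_tmul (υ : RightCoaction k Q A) (a : A) (b : B) (x : Q) :
    (υ.onTensor B).coverR (a ⊗ₜ b) x = TensorProduct.rightComm k A Q B (υ.coverR a x ⊗ₜ b) :=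
  rfl

theorem RightCoaction.onTensor_coverL_tmul (υ : RightCoaction k Q A) (a : A) (b : B) (x : Q) :
    (υ.onTensor B).coverL (a ⊗ₜ b) x = TensorProduct.rightComm k A Q B (υ.coverL a x ⊗ₜ b) :=
  rfl

theorem LeftCoaction.coact_eq_zero {γ : LeftCoaction k Q B} {b : B}
    (h : ∀ x, γ.coverR b x = 0) : γ.coact b = 0 := by
  have hl : (γ.coact b).left = 0 := by
    ext x c
    simp [γ.coact_left_tmul, h]
  apply Multiplier.ext'
  · exact hl
  · refine LinearMap.ext fun z => ?_
    refine NondegenerateProduct.left _ fun w => ?_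
    rw [Multiplier.right_mul, hl, LinearMap.zero_apply, mul_zero]

theorem RightCoaction.coact_eq_zero {υ : RightCoaction k Q A} {a : A}
    (h : ∀ x, υ.coverL a x = 0) : υ.coact a = 0 := by
  have hr : (υ.coact a).right = 0 := by
    ext c x
    simp [υ.coact_right_tmul, h]
  apply Multiplier.ext'
  · refine LinearMap.ext fun z => ?_
    refine NondegenerateProduct.right _ fun w => ?_
    rw [← Multiplier.right_mul, hr, LinearMap.zero_apply, zero_mul]
  · exact hr

theorem LeftCoaction.onTensor_coverR₂ (γ : LeftCoaction k Q B) (a : A) (b : B) (t : Q ⊗[k] Q) :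
    (γ.onTensor A).coverR₂ (a ⊗ₜ b) t = LinearMap.lTensor Q
      (TensorProduct.leftComm k A Q B).toLinearMap
      (TensorProduct.leftComm k A Q (Q ⊗[k] B) (a ⊗ₜ γ.coverR₂ b t)) := by
  induction t with
  | zero => simp
  | add u v hu hv => simp only [map_add, TensorProduct.tmul_add, hu, hv]
  | tmul u v =>
    rw [coverR₂_tmul, coverR₂_tmul, onTensor_coverR_tmul]
    induction γ.coverR b u with
    | zero => simp
    | add u v hu hv => simp only [map_add, TensorProduct.tmul_add, hu, hv]
    | tmul p c => simp [onTensor_coverR_tmul]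

theorem LeftCoaction.IsComoduleAlgebra.onTensor {H : MultiplierHopf k Q} {γ : LeftCoaction k Q B}
    (hγ : γ.IsComoduleAlgebra H) : (γ.onTensor A).IsComoduleAlgebra H where
  map_mul s t := by
    induction s with
    | zero => simp
    | add u v hu hv => simp only [map_add, add_mul, hu, hv]
    | tmul a b =>
      induction t with
      | zero => simp
      | add u v hu hv => simp only [map_add, mul_add, hu, hv]
      | tmul a' b' =>
        rw [Algebra.TensorProduct.tmul_mul_tmul, onTensor_coact_tmul, onTensor_coact_tmul,
          onTensor_coact_tmul, ← Multiplier.leftComm_mul, Multiplier.tmul_mul, hγ.map_mul,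
          Multiplier.of_mul]
  injective := by
    rw [injective_iff_map_eq_zero]
    intro t ht
    refine lTensor_jointly_injective (fun x => γ.coverR.flip x) (fun b hb => ?_) t fun x => ?_
    · exact (injective_iff_map_eq_zero _).mp hγ.injective b (coact_eq_zero hb)
    · have h1 : ∀ t, (γ.onTensor A).coverR t x =
          TensorProduct.leftComm k A Q B (LinearMap.lTensor A (γ.coverR.flip x) t) := by
        intro t
        induction t with
        | zero => simp
        | add u v hu hv => simp only [map_add, LinearMap.add_apply, hu, hv]
        | tmul a b => simp [onTensor_coverR_tmul]
      apply (TensorProduct.leftComm k A Q B).injective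
      apply Multiplier.of_injective (k := k)
      rw [← h1, (γ.onTensor A).coverR_spec, ht, zero_mul, map_zero]
      exact ((Multiplier.ofLinear k _).map_zero).symm
  coassoc t z y := by
    change _ = (γ.onTensor A).coverR₂ t (H.T₁ (z ⊗ₜ y))
    induction t with
    | zero => simp [coverR₂_zero]
    | add u v hu hv => rw [coverR₂_add, ← hu, ← hv, map_add, LinearMap.add_apply, map_add, map_add]
    | tmul a b =>
      rw [onTensor_coverR₂, coverR₂, ← hγ.coassoc, onTensor_coverR_tmul]
      induction γ.coverR b z with
      | zero => simp
      | add u v hu hv => simp only [map_add, TensorProduct.tmul_add, hu, hv]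
      | tmul q c =>
        simp only [TensorProduct.leftComm_tmul, LinearMap.rTensor_tmul, LinearMap.comp_apply]
        induction H.T₁.toLinearMap ((TensorProduct.mk k Q Q).flip y q) with
        | zero => simp
        | add u v hu hv => simp only [map_add, TensorProduct.tmul_add, TensorProduct.add_tmul, hu, hv]
        | tmul u v => simp

theorem RightCoaction.onTensor_coverR₂ (υ : RightCoaction k Q A) (a : A) (b : B) (t : Q ⊗[k] Q) :
    (υ.onTensor B).coverR₂ (a ⊗ₜ b) t =
      TensorProduct.rightComm k A (Q ⊗[k] Q) B (υ.coverR₂ a t ⊗ₜ b) := by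
  induction t with
  | zero => simp
  | add u v hu hv => simp only [map_add, TensorProduct.add_tmul, hu, hv]
  | tmul u v =>
    rw [coverR₂_tmul, coverR₂_tmul, onTensor_coverR_tmul]
    induction υ.coverR a v with
    | zero => simp
    | add u v hu hv => simp only [map_add, TensorProduct.add_tmul, hu, hv]
    | tmul c p =>
      simp only [TensorProduct.rightComm_tmul, LinearMap.rTensor_tmul, LinearMap.flip_apply,
        onTensor_coverR_tmul]
      induction υ.coverR c u with
      | zero => simp
      | add u v hu hv => simp only [map_add, TensorProduct.add_tmul, hu, hv]
      | tmul d q => simp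

theorem RightCoaction.IsComoduleAlgebra.onTensor {H : MultiplierHopf k Q}
    {υ : RightCoaction k Q A} (hυ : υ.IsComoduleAlgebra H) :
    (υ.onTensor B).IsComoduleAlgebra H where
  map_mul s t := by
    induction s with
    | zero => simp
    | add u v hu hv => simp only [map_add, add_mul, hu, hv]
    | tmul a b =>
      induction t with
      | zero => simp
      | add u v hu hv => simp only [map_add, mul_add, hu, hv]
      | tmul a' b' =>
        rw [Algebra.TensorProduct.tmul_mul_tmul, onTensor_coact_tmul, onTensor_coact_tmul,
          onTensor_coact_tmul, ← Multiplier.rightComm_mul, Multiplier.tmul_mul, hυ.map_mul,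
          Multiplier.of_mul]
  injective := by
    rw [injective_iff_map_eq_zero]
    intro t ht
    refine rTensor_jointly_injective (fun x => υ.coverL.flip x) (fun b hb => ?_) t fun x => ?_
    · exact (injective_iff_map_eq_zero _).mp hυ.injective b (coact_eq_zero hb)
    · have h1 : ∀ t, (υ.onTensor B).coverL t x =
          TensorProduct.rightComm k A Q B (LinearMap.rTensor B (υ.coverL.flip x) t) := by
        intro t
        induction t with
        | zero => simp
        | add u v hu hv => simp only [map_add, LinearMap.add_apply, hu, hv]
        | tmul a b => simp [onTensor_coverL_tmul]
      apply (TensorProduct.rightComm k A Q B).injective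
      apply Multiplier.of_injective (k := k)
      rw [← h1, (υ.onTensor B).coverL_spec, ht, mul_zero, map_zero]
      exact ((Multiplier.ofLinear k _).map_zero).symm
  coassoc t z y := by
    change _ = (υ.onTensor B).coverR₂ t (H.T₁ (z ⊗ₜ y))
    induction t with
    | zero => simp [coverR₂_zero]
    | add u v hu hv => rw [coverR₂_add, ← hu, ← hv, map_add, LinearMap.add_apply, map_add]
    | tmul a b =>
      have h1 : υ.coverR₂ a (H.T₁ (z ⊗ₜ y)) = _ := (hυ.coassoc a z y).symm
      rw [onTensor_coverR₂, h1, onTensor_coverR_tmul]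
      induction υ.coverR a z with
      | zero => simp
      | add u v hu hv => simp only [map_add, TensorProduct.add_tmul, hu, hv]
      | tmul c q => simp

theorem isBicomoduleAlgebra_onTensor {H : MultiplierHopf k Q} {υ : RightCoaction k Q A}
    (hυ : υ.IsComoduleAlgebra H) {γ : LeftCoaction k Q B} (hγ : γ.IsComoduleAlgebra H) :
    IsBicomoduleAlgebra H (γ.onTensor A) (υ.onTensor B) where
  left := hγ.onTensor
  right := hυ.onTensor
  bicomodule x y t := by
    induction t with
    | zero => simp
    | add u v hu hv => simp only [map_add, LinearMap.add_apply, hu, hv]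
    | tmul a b =>
      rw [LeftCoaction.onTensor_coverR_tmul, RightCoaction.onTensor_coverL_tmul]
      -- both sides are the sum of the `q ⊗ (a₀ ⊗ c) ⊗ p` over `υ.coverL a x = ∑ a₀ ⊗ p` and
      -- `γ.coverR b y = ∑ q ⊗ c`
      have h1 : ∀ w : Q ⊗[k] B, LinearMap.lTensor Q ((υ.onTensor B).coverL.flip x)
          (TensorProduct.leftComm k A Q B (a ⊗ₜ w)) = LinearMap.lTensor Q
          ((TensorProduct.rightComm k A Q B).toLinearMap ∘ₗ TensorProduct.mk k _ B (υ.coverL a x))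
          w := by
        intro w
        induction w with
        | zero => simp
        | add u v hu hv => simp only [map_add, TensorProduct.tmul_add, hu, hv]
        | tmul q c => simp [RightCoaction.onTensor_coverL_tmul]
      have h2 : ∀ v : A ⊗[k] Q, TensorProduct.assoc k Q (A ⊗[k] B) Q
          (LinearMap.rTensor Q ((γ.onTensor A).coverR.flip y)
            (TensorProduct.rightComm k A Q B (v ⊗ₜ b))) = LinearMap.lTensor Q
          ((TensorProduct.rightComm k A Q B).toLinearMap ∘ₗ TensorProduct.mk k _ B v)
          (γ.coverR b y) := by
        intro v
        induction v with
        | zero => simp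
        | add u v hu hv =>
          simp only [map_add, TensorProduct.add_tmul, hu, hv, LinearMap.comp_add,
            LinearMap.lTensor_add, LinearMap.add_apply]
        | tmul d p =>
          simp only [TensorProduct.rightComm_tmul, LinearMap.rTensor_tmul, LinearMap.flip_apply,
            LeftCoaction.onTensor_coverR_tmul]
          induction γ.coverR b y with
          | zero => simp
          | add u v hu hv =>
            simp only [map_add, TensorProduct.tmul_add, TensorProduct.add_tmul, hu, hv]
          | tmul q c => simp
      rw [h1, h2]

end OnTensor

/-! ### Naturality of the twists -/

section Naturality

variable {k Q : Type*} [Field k] [NonUnitalRing Q] [Module k Q]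
  [IsScalarTower k Q Q] [SMulCommClass k Q Q] [NondegenerateProduct Q] [LocalUnits Q]
variable {A : Type*} [NonUnitalRing A] [Module k A] [IsScalarTower k A A] [SMulCommClass k A A]
  [NondegenerateProduct A]
variable {B : Type*} [NonUnitalRing B] [Module k B] [IsScalarTower k B B] [SMulCommClass k B B]
  [NondegenerateProduct B]
variable {V W : Type*} [AddCommGroup V] [Module k V] [AddCommGroup W] [Module k W]

/-- The twists are natural with respect to maps of modules. -/
theorem UnitalLeftModule.leftTwist_map (M : UnitalLeftModule k Q V) (N : UnitalLeftModule k Q W)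
    (γ : LeftCoaction k Q B) (F : V →ₗ[k] W) (hF : ∀ x v, F (M.act x v) = N.act x (F v))
    (b : B) (v : V) :
    N.leftTwist γ (b ⊗ₜ F v) = LinearMap.rTensor B F (M.leftTwist γ (b ⊗ₜ v)) := by
  induction v using M.induction_on with
  | zero => simp
  | add u v hu hv => simp only [TensorProduct.tmul_add, map_add, hu, hv]
  | act x w =>
    rw [hF, M.leftTwist_tmul, N.leftTwist_tmul, ← LinearMap.rTensor_comp_apply]
    congr 2
    ext y
    simp [hF]

theorem UnitalRightModule.leftTwist_map (M : UnitalRightModule k Q V)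
    (N : UnitalRightModule k Q W) (γ : LeftCoaction k Q B) (F : V →ₗ[k] W)
    (hF : ∀ x v, F (M.act x v) = N.act x (F v)) (b : B) (v : V) :
    N.leftTwist γ (b ⊗ₜ F v) = LinearMap.rTensor B F (M.leftTwist γ (b ⊗ₜ v)) := by
  induction v using M.induction_on with
  | zero => simp
  | add u v hu hv => simp only [TensorProduct.tmul_add, map_add, hu, hv]
  | act x w =>
    rw [hF, M.leftTwist_tmul, N.leftTwist_tmul, ← LinearMap.rTensor_comp_apply]
    congr 2
    ext y
    simp [hF]

theorem UnitalRightModule.rightTwist_map (M : UnitalRightModule k Q V)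
    (N : UnitalRightModule k Q W) (υ : RightCoaction k Q B) (F : V →ₗ[k] W)
    (hF : ∀ x v, F (M.act x v) = N.act x (F v)) (b : B) (v : V) :
    N.rightTwist υ (F v ⊗ₜ b) = LinearMap.lTensor B F (M.rightTwist υ (v ⊗ₜ b)) := by
  induction v using M.induction_on with
  | zero => simp
  | add u v hu hv => simp only [TensorProduct.add_tmul, map_add, hu, hv]
  | act x w =>
    rw [hF, M.rightTwist_tmul, N.rightTwist_tmul, ← LinearMap.lTensor_comp_apply]
    congr 2
    ext y
    simp [hF]

theorem UnitalLeftModule.rightTwist_map (M : UnitalLeftModule k Q V)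
    (N : UnitalLeftModule k Q W) (υ : RightCoaction k Q B) (F : V →ₗ[k] W)
    (hF : ∀ x v, F (M.act x v) = N.act x (F v)) (b : B) (v : V) :
    N.rightTwist υ (F v ⊗ₜ b) = LinearMap.lTensor B F (M.rightTwist υ (v ⊗ₜ b)) := by
  induction v using M.induction_on with
  | zero => simp
  | add u v hu hv => simp only [TensorProduct.add_tmul, map_add, hu, hv]
  | act x w =>
    rw [hF, M.rightTwist_tmul, N.rightTwist_tmul, ← LinearMap.lTensor_comp_apply]
    congr 2
    ext y
    simp [hF]

theorem UnitalLeftModule.leftTwist_onTensor (M : UnitalLeftModule k Q V) (γ : LeftCoaction k Q B)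
    (a : A) (b : B) (v : V) : M.leftTwist (γ.onTensor A) ((a ⊗ₜ b) ⊗ₜ v) =
      TensorProduct.leftComm k A V B (a ⊗ₜ M.leftTwist γ (b ⊗ₜ v)) := by
  induction v using M.induction_on with
  | zero => simp
  | add u v hu hv => simp only [TensorProduct.tmul_add, map_add, hu, hv]
  | act x w =>
    rw [M.leftTwist_tmul, M.leftTwist_tmul, LeftCoaction.onTensor_coverR_tmul]
    induction γ.coverR b x with
    | zero => simp
    | add u v hu hv => simp only [TensorProduct.tmul_add, map_add, hu, hv]
    | tmul q c => simp

theorem UnitalRightModule.leftTwist_onTensor (M : UnitalRightModule k Q V)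
    (γ : LeftCoaction k Q B) (a : A) (b : B) (v : V) :
    M.leftTwist (γ.onTensor A) ((a ⊗ₜ b) ⊗ₜ v) =
      TensorProduct.leftComm k A V B (a ⊗ₜ M.leftTwist γ (b ⊗ₜ v)) := by
  induction v using M.induction_on with
  | zero => simp
  | add u v hu hv => simp only [TensorProduct.tmul_add, map_add, hu, hv]
  | act x w =>
    rw [M.leftTwist_tmul, M.leftTwist_tmul, LeftCoaction.onTensor_coverL_tmul]
    induction γ.coverL b x with
    | zero => simp
    | add u v hu hv => simp only [TensorProduct.tmul_add, map_add, hu, hv]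
    | tmul q c => simp

theorem UnitalRightModule.rightTwist_onTensor (M : UnitalRightModule k Q V)
    (υ : RightCoaction k Q A) (a : A) (b : B) (v : V) :
    M.rightTwist (υ.onTensor B) (v ⊗ₜ (a ⊗ₜ b)) =
      TensorProduct.rightComm k A V B (M.rightTwist υ (v ⊗ₜ a) ⊗ₜ b) := by
  induction v using M.induction_on with
  | zero => simp
  | add u v hu hv => simp only [TensorProduct.add_tmul, map_add, hu, hv]
  | act x w =>
    rw [M.rightTwist_tmul, M.rightTwist_tmul, RightCoaction.onTensor_coverL_tmul]
    induction υ.coverL a x with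
    | zero => simp
    | add u v hu hv => simp only [TensorProduct.add_tmul, map_add, hu, hv]
    | tmul q c => simp

theorem UnitalLeftModule.rightTwist_onTensor (M : UnitalLeftModule k Q V)
    (υ : RightCoaction k Q A) (a : A) (b : B) (v : V) :
    M.rightTwist (υ.onTensor B) (v ⊗ₜ (a ⊗ₜ b)) =
      TensorProduct.rightComm k A V B (M.rightTwist υ (v ⊗ₜ a) ⊗ₜ b) := by
  induction v using M.induction_on with
  | zero => simp
  | add u v hu hv => simp only [TensorProduct.add_tmul, map_add, hu, hv]
  | act x w =>
    rw [M.rightTwist_tmul, M.rightTwist_tmul, RightCoaction.onTensor_coverR_tmul]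
    induction υ.coverR a x with
    | zero => simp
    | add u v hu hv => simp only [TensorProduct.add_tmul, map_add, hu, hv]
    | tmul q c => simp

end Naturality

/-! ### Smash products and the two-sided L-R-smash product -/

section SmashAlgebras

variable {k Q : Type*} [Field k] [NonUnitalRing Q] [Module k Q]
  [IsScalarTower k Q Q] [SMulCommClass k Q Q] [NondegenerateProduct Q] [LocalUnits Q]
variable {A : Type*} [NonUnitalRing A] [Module k A] [IsScalarTower k A A] [SMulCommClass k A A]
  [NondegenerateProduct A]
variable {B : Type*} [NonUnitalRing B] [Module k B] [IsScalarTower k B B] [SMulCommClass k B B]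
  [NondegenerateProduct B]
variable {C : Type*} [NonUnitalRing C] [Module k C] [IsScalarTower k C C] [SMulCommClass k C C]

theorem bilinear_ext_left {X Y Z P W : Type*} [AddCommGroup X] [Module k X] [AddCommGroup Y]
    [Module k Y] [AddCommGroup Z] [Module k Z] [AddCommGroup P] [Module k P] [AddCommGroup W]
    [Module k W] (e : X ⊗[k] Y ≃ₗ[k] P) {f g : P ⊗[k] Z →ₗ[k] P ⊗[k] Z →ₗ[k] W}
    (h : ∀ x y z x' y' z', f (e (x ⊗ₜ y) ⊗ₜ z) (e (x' ⊗ₜ y') ⊗ₜ z') =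
      g (e (x ⊗ₜ y) ⊗ₜ z) (e (x' ⊗ₜ y') ⊗ₜ z')) : f = g := by
  refine TensorProduct.ext' fun p z => TensorProduct.ext' fun p' z' => ?_
  obtain ⟨p, rfl⟩ := e.surjective p
  obtain ⟨p', rfl⟩ := e.surjective p'
  induction p with
  | zero => simp
  | add u v hu hv => simp only [map_add, TensorProduct.add_tmul, LinearMap.add_apply, hu, hv]
  | tmul x y =>
    induction p' with
    | zero => simp
    | add u v hu hv => simp only [map_add, TensorProduct.add_tmul, hu, hv]
    | tmul x' y' => exact h x y z x' y' z'

theorem bilinear_ext_right {X Y Z P W : Type*} [AddCommGroup X] [Module k X] [AddCommGroup Y]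
    [Module k Y] [AddCommGroup Z] [Module k Z] [AddCommGroup P] [Module k P] [AddCommGroup W]
    [Module k W] (e : Y ⊗[k] Z ≃ₗ[k] P) {f g : X ⊗[k] P →ₗ[k] X ⊗[k] P →ₗ[k] W}
    (h : ∀ x y z x' y' z', f (x ⊗ₜ e (y ⊗ₜ z)) (x' ⊗ₜ e (y' ⊗ₜ z')) =
      g (x ⊗ₜ e (y ⊗ₜ z)) (x' ⊗ₜ e (y' ⊗ₜ z'))) : f = g := by
  refine TensorProduct.ext' fun x p => TensorProduct.ext' fun x' p' => ?_
  obtain ⟨p, rfl⟩ := e.surjective p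
  obtain ⟨p', rfl⟩ := e.surjective p'
  induction p with
  | zero => simp
  | add u v hu hv => simp only [map_add, TensorProduct.tmul_add, LinearMap.add_apply, hu, hv]
  | tmul y z =>
    induction p' with
    | zero => simp
    | add u v hu hv => simp only [map_add, TensorProduct.tmul_add, hu, hv]
    | tmul y' z' => exact h x y z x' y' z'

/-- `x ▷ (a # c) = a # (x ▷ c)` makes `A #_r C` a left module algebra: the twist of `A` and `C` is
natural in `C`, hence commutes with the left action. -/
theorem isModuleAlgebra_smashRight {H : MultiplierHopf k Q} {l : UnitalLeftModule k Q C}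
    {r : UnitalRightModule k Q C} (hC : IsBimoduleAlgebra H l r) (υ : RightCoaction k Q A) :
    (smashRightLeftModule υ l r).IsModuleAlgebra H := by
  intro x y s t
  let μ := twistedMul (r.rightTwist υ)
  let act : Q →ₗ[k] A ⊗[k] C →ₗ[k] A ⊗[k] C := LinearMap.lTensorHom A ∘ₗ l.act
  have key : ∀ s t : A ⊗[k] C, act x (μ s (act y t)) =
      TensorProduct.lift μ (TensorProduct.map (act.flip s) (act.flip t) (H.T₁ (x ⊗ₜ y))) := by
    intro s t
    induction s with
    | zero => simp
    | add u v hu hv =>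
      simp only [map_add, LinearMap.add_apply, hu, hv, TensorProduct.map_add_left]
    | tmul a c =>
      induction t with
      | zero => simp
      | add u v hu hv =>
        simp only [map_add, LinearMap.add_apply, hu, hv, TensorProduct.map_add_right]
      | tmul a' c' =>
        -- `Θ (u ⊗ v)` is the map `d ↦ (u ▷ d)(v ▷ c')`
        let Θ : Q ⊗[k] Q →ₗ[k] C →ₗ[k] C := TensorProduct.lift
          (((LinearMap.llcomp k C C C).flip ∘ₗ l.act).compl₂
            ((LinearMap.mul k C).flip ∘ₗ l.act.flip c'))
        have hΘ : ∀ w d, Θ w d = LinearMap.mul' k C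
            (TensorProduct.map (l.act.flip d) (l.act.flip c') w) := by
          intro w d
          induction w with
          | zero => simp
          | add u v hu hv => simp only [map_add, LinearMap.add_apply, hu, hv]
          | tmul u v => simp [Θ]
        have hr : ∀ w, TensorProduct.lift μ
            (TensorProduct.map (act.flip (a ⊗ₜ c)) (act.flip (a' ⊗ₜ c')) w) =
            TensorProduct.map (LinearMap.mulLeft k a) (Θ w) (r.rightTwist υ (c ⊗ₜ a')) := by
          intro w
          induction w with
          | zero => simp
          | add u v hu hv =>
            rw [map_add, map_add, hu, hv, map_add Θ, TensorProduct.map_add_right, LinearMap.add_apply]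
          | tmul u v =>
            have h2 := r.rightTwist_map r υ (l.act u) (fun x v => (hC.bimodule u x v).symm) a' c
            simp only [TensorProduct.lift.tmul, TensorProduct.map_tmul, LinearMap.flip_apply, act,
              μ, LinearMap.comp_apply, LinearMap.coe_lTensorHom, LinearMap.lTensor_tmul]
            rw [twistedMul_tmul, h2, ← LinearMap.comp_apply, LinearMap.map_comp_lTensor]
            rfl
        rw [hr]
        have hΘ' : Θ (H.T₁ (x ⊗ₜ y)) = l.act x ∘ₗ LinearMap.mulRight k (l.act y c') := by
          ext d
          rw [hΘ, ← hC.left]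
          rfl
        have h3 : act y (a' ⊗ₜ c') = a' ⊗ₜ l.act y c' := by simp [act]
        rw [hΘ', h3, twistedMul_tmul, ← LinearMap.lTensor_comp_map]
        rfl
  have h1 : LinearMap.mul' k (SmashRight υ r) ∘ₗ TensorProduct.map
      ((smashRightLeftModule υ l r).act.flip s) ((smashRightLeftModule υ l r).act.flip t) =
      TensorProduct.lift μ ∘ₗ TensorProduct.map (act.flip s) (act.flip t) := by
    ext u v
    rfl
  exact (key s t).trans (LinearMap.congr_fun h1 _).symm

/-- `(c # b) ◁ x = (c ◁ x) # b` makes `C #_l B` a right module algebra. -/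
theorem isModuleAlgebra_smashLeft {H : MultiplierHopf k Q} {l : UnitalLeftModule k Q C}
    {r : UnitalRightModule k Q C} (hC : IsBimoduleAlgebra H l r) (γ : LeftCoaction k Q B) :
    (smashLeftRightModule γ l r).IsModuleAlgebra H := by
  intro x y s t
  let μ := twistedMul (l.leftTwist γ)
  let act : Q →ₗ[k] C ⊗[k] B →ₗ[k] C ⊗[k] B := LinearMap.rTensorHom B ∘ₗ r.act
  have key : ∀ s t : C ⊗[k] B, act x (μ (act y s) t) =
      TensorProduct.lift μ (TensorProduct.map (act.flip s) (act.flip t) (H.T₂ (y ⊗ₜ x))) := by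
    intro s t
    induction s with
    | zero => simp
    | add u v hu hv =>
      simp only [map_add, LinearMap.add_apply, hu, hv, TensorProduct.map_add_left]
    | tmul c b =>
      induction t with
      | zero => simp
      | add u v hu hv =>
        simp only [map_add, LinearMap.add_apply, hu, hv, TensorProduct.map_add_right]
      | tmul c' b' =>
        -- `Θ (u ⊗ v)` is the map `d ↦ (c ◁ u)(d ◁ v)`
        let Θ : Q ⊗[k] Q →ₗ[k] C →ₗ[k] C := TensorProduct.lift
          ((LinearMap.llcomp k C C C).compl₁₂ (LinearMap.mul k C ∘ₗ r.act.flip c) r.act)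
        have hΘ : ∀ w d, Θ w d = LinearMap.mul' k C
            (TensorProduct.map (r.act.flip c) (r.act.flip d) w) := by
          intro w d
          induction w with
          | zero => simp
          | add u v hu hv => simp only [map_add, LinearMap.add_apply, hu, hv]
          | tmul u v => simp [Θ]
        have hr : ∀ w, TensorProduct.lift μ
            (TensorProduct.map (act.flip (c ⊗ₜ b)) (act.flip (c' ⊗ₜ b')) w) =
            TensorProduct.map (Θ w) (LinearMap.mulRight k b') (l.leftTwist γ (b ⊗ₜ c')) := by
          intro w
          induction w with
          | zero => simp
          | add u v hu hv =>
            rw [map_add, map_add, hu, hv, map_add Θ, TensorProduct.map_add_left, LinearMap.add_apply]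
          | tmul u v =>
            have h2 := l.leftTwist_map l γ (r.act v) (fun x w => hC.bimodule x v w) b c'
            simp only [TensorProduct.lift.tmul, TensorProduct.map_tmul, LinearMap.flip_apply, act,
              μ, LinearMap.comp_apply, LinearMap.coe_rTensorHom, LinearMap.rTensor_tmul]
            rw [twistedMul_tmul, h2, ← LinearMap.comp_apply, LinearMap.map_comp_rTensor]
            rfl
        rw [hr]
        have hΘ' : Θ (H.T₂ (y ⊗ₜ x)) = r.act x ∘ₗ LinearMap.mulLeft k (r.act y c) := by
          ext d
          rw [hΘ, ← hC.right]
          rfl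
        have h3 : act y (c ⊗ₜ b) = r.act y c ⊗ₜ b := by simp [act]
        rw [hΘ', h3, twistedMul_tmul, ← LinearMap.rTensor_comp_map]
        rfl
  have h1 : LinearMap.mul' k (SmashLeft l γ) ∘ₗ TensorProduct.map
      ((smashLeftRightModule γ l r).act.flip s) ((smashLeftRightModule γ l r).act.flip t) =
      TensorProduct.lift μ ∘ₗ TensorProduct.map (act.flip s) (act.flip t) := by
    ext u v
    rfl
  exact (key s t).trans (LinearMap.congr_fun h1 _).symm

section Isomorphisms

variable (υ : RightCoaction k Q A) (γ : LeftCoaction k Q B) (l : UnitalLeftModule k Q C)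
  (r : UnitalRightModule k Q C)

/-- The canonical map `(A #_r C) ⊗ B → A ⊗ (C ⊗ B)`. -/
def smashRightAssoc : SmashRight υ r ⊗[k] B ≃ₗ[k] A ⊗[k] (C ⊗[k] B) :=
  TensorProduct.congr (AlgebraOn.of _).symm (LinearEquiv.refl k B) ≪≫ₗ TensorProduct.assoc k A C B

theorem smashRightAssoc_tmul (z : A ⊗[k] C) (b : B) :
    smashRightAssoc υ r (AlgebraOn.of _ z ⊗ₜ b) = TensorProduct.assoc k A C B (z ⊗ₜ b) :=
  rfl

theorem smashRight_of_mul_of (a a' : A) (c c' : C) :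
    (AlgebraOn.of _ (a ⊗ₜ c) : SmashRight υ r) * AlgebraOn.of _ (a' ⊗ₜ c') =
      AlgebraOn.of _ (TensorProduct.map (LinearMap.mulLeft k a) (LinearMap.mulRight k c')
        (r.rightTwist υ (c ⊗ₜ a'))) := by
  rw [AlgebraOn.of_mul_of, twistedMul_tmul]

theorem smashRightLeftModule_leftTwist (a : A) (b : B) (c : C) :
    (smashRightLeftModule υ l r).leftTwist γ (b ⊗ₜ AlgebraOn.of _ (a ⊗ₜ c)) =
      LinearMap.rTensor B ((AlgebraOn.of _).toLinearMap ∘ₗ TensorProduct.mk k A C a)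
        (l.leftTwist γ (b ⊗ₜ c)) :=
  l.leftTwist_map (smashRightLeftModule υ l r) γ
    ((AlgebraOn.of _).toLinearMap ∘ₗ TensorProduct.mk k A C a) (fun _ _ => rfl) b c

/-- The canonical map `(A #_r C) #_l B → A ⋈ C ⋈ B` preserves products. -/
theorem smashRightAssoc_twistedMul (x y : SmashRight υ r ⊗[k] B) :
    smashRightAssoc υ r (twistedMul ((smashRightLeftModule υ l r).leftTwist γ) x y) =
    twoSidedTwistedMul (r.rightTwist υ) (l.leftTwist γ) (smashRightAssoc υ r x)
      (smashRightAssoc υ r y) := by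
  have h : (twistedMul ((smashRightLeftModule υ l r).leftTwist γ)).compr₂
      (smashRightAssoc υ r).toLinearMap =
      (twoSidedTwistedMul (r.rightTwist υ) (l.leftTwist γ)).compl₁₂
        (smashRightAssoc υ r).toLinearMap (smashRightAssoc υ r).toLinearMap := by
    refine bilinear_ext_left (AlgebraOn.of _) fun a c b a' c' b' => ?_
    rw [LinearMap.compr₂_apply, LinearMap.compl₁₂_apply, twistedMul_tmul,
      smashRightLeftModule_leftTwist, LinearEquiv.coe_coe, smashRightAssoc_tmul,
      smashRightAssoc_tmul, TensorProduct.assoc_tmul, TensorProduct.assoc_tmul,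
      twoSidedTwistedMul_tmul]
    induction l.leftTwist γ (b ⊗ₜ c') with
    | zero => simp
    | add u v hu hv => simp only [map_add, TensorProduct.tmul_add, hu, hv]
    | tmul d e =>
      rw [LinearMap.rTensor_tmul, TensorProduct.map_tmul, LinearMap.comp_apply,
        LinearEquiv.coe_coe, TensorProduct.mk_apply, LinearMap.mulLeft_apply,
        smashRight_of_mul_of, smashRightAssoc_tmul]
      induction r.rightTwist υ (c ⊗ₜ a') with
      | zero => simp
      | add u v hu hv => simp only [map_add, TensorProduct.add_tmul, hu, hv]
      | tmul f g => simp
  exact LinearMap.congr_fun (LinearMap.congr_fun h x) y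

/-- The canonical map `A ⊗ (C #_l B) → A ⊗ (C ⊗ B)`. -/
def smashLeftAssoc : A ⊗[k] SmashLeft l γ ≃ₗ[k] A ⊗[k] (C ⊗[k] B) :=
  TensorProduct.congr (LinearEquiv.refl k A) (AlgebraOn.of _).symm

theorem smashLeftAssoc_tmul (z : C ⊗[k] B) (a : A) :
    smashLeftAssoc γ l (a ⊗ₜ AlgebraOn.of _ z) = a ⊗ₜ z :=
  rfl

theorem smashLeft_of_mul_of (c c' : C) (b b' : B) :
    (AlgebraOn.of _ (c ⊗ₜ b) : SmashLeft l γ) * AlgebraOn.of _ (c' ⊗ₜ b') =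
      AlgebraOn.of _ (TensorProduct.map (LinearMap.mulLeft k c) (LinearMap.mulRight k b')
        (l.leftTwist γ (b ⊗ₜ c'))) := by
  rw [AlgebraOn.of_mul_of, twistedMul_tmul]

theorem smashLeftRightModule_rightTwist (a : A) (b : B) (c : C) :
    (smashLeftRightModule γ l r).rightTwist υ (AlgebraOn.of _ (c ⊗ₜ b) ⊗ₜ a) =
      LinearMap.lTensor A ((AlgebraOn.of _).toLinearMap ∘ₗ (TensorProduct.mk k C B).flip b)
        (r.rightTwist υ (c ⊗ₜ a)) :=
  r.rightTwist_map (smashLeftRightModule γ l r) υ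
    ((AlgebraOn.of _).toLinearMap ∘ₗ (TensorProduct.mk k C B).flip b) (fun _ _ => rfl) a c

/-- The canonical map `A #_r (C #_l B) → A ⋈ C ⋈ B` preserves products. -/
theorem smashLeftAssoc_twistedMul (x y : A ⊗[k] SmashLeft l γ) :
    smashLeftAssoc γ l (twistedMul ((smashLeftRightModule γ l r).rightTwist υ) x y) =
    twoSidedTwistedMul (r.rightTwist υ) (l.leftTwist γ) (smashLeftAssoc γ l x)
      (smashLeftAssoc γ l y) := by
  have h : (twistedMul ((smashLeftRightModule γ l r).rightTwist υ)).compr₂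
      (smashLeftAssoc γ l).toLinearMap =
      (twoSidedTwistedMul (r.rightTwist υ) (l.leftTwist γ)).compl₁₂
        (smashLeftAssoc γ l).toLinearMap (smashLeftAssoc γ l).toLinearMap := by
    refine bilinear_ext_right (AlgebraOn.of _) fun a c b a' c' b' => ?_
    rw [LinearMap.compr₂_apply, LinearMap.compl₁₂_apply, twistedMul_tmul,
      smashLeftRightModule_rightTwist, LinearEquiv.coe_coe, smashLeftAssoc_tmul,
      smashLeftAssoc_tmul, twoSidedTwistedMul_tmul]
    induction r.rightTwist υ (c ⊗ₜ a') with
    | zero => simp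
    | add u v hu hv => simp only [map_add, TensorProduct.add_tmul, hu, hv]
    | tmul f g =>
      rw [LinearMap.lTensor_tmul, TensorProduct.map_tmul, LinearMap.comp_apply,
        LinearEquiv.coe_coe, LinearMap.flip_apply, TensorProduct.mk_apply,
        LinearMap.mulRight_apply, smashLeft_of_mul_of, smashLeftAssoc_tmul]
      induction l.leftTwist γ (b ⊗ₜ c') with
      | zero => simp
      | add u v hu hv => simp only [map_add, TensorProduct.tmul_add, hu, hv]
      | tmul d e => simp
  exact LinearMap.congr_fun (LinearMap.congr_fun h x) y

/-- The map `(a ⊗ b) ⋄ c ↦ a ⋈ c ⋈ b` preserves products. -/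
theorem diamondRight_map_mul (x y : (A ⊗[k] B) ⊗[k] C) :
    (TensorProduct.assoc k A B C ≪≫ₗ (TensorProduct.comm k B C).lTensor A)
      (lrTwistedMul (r.rightTwist (υ.onTensor B)) ((TensorProduct.comm k C (A ⊗[k] B)).toLinearMap ∘ₗ
        l.leftTwist (γ.onTensor A)) x y) =
    twoSidedTwistedMul (r.rightTwist υ) (l.leftTwist γ)
      ((TensorProduct.assoc k A B C ≪≫ₗ (TensorProduct.comm k B C).lTensor A) x)
      ((TensorProduct.assoc k A B C ≪≫ₗ (TensorProduct.comm k B C).lTensor A) y) := by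
  have h : (lrTwistedMul (r.rightTwist (υ.onTensor B))
      ((TensorProduct.comm k C (A ⊗[k] B)).toLinearMap ∘ₗ l.leftTwist (γ.onTensor A))).compr₂
        (TensorProduct.assoc k A B C ≪≫ₗ (TensorProduct.comm k B C).lTensor A).toLinearMap =
      (twoSidedTwistedMul (r.rightTwist υ) (l.leftTwist γ)).compl₁₂
        (TensorProduct.assoc k A B C ≪≫ₗ (TensorProduct.comm k B C).lTensor A).toLinearMap
        (TensorProduct.assoc k A B C ≪≫ₗ (TensorProduct.comm k B C).lTensor A).toLinearMap := by
    refine bilinear_ext_left (LinearEquiv.refl k _) fun a b c a' b' c' => ?_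
    rw [LinearMap.compr₂_apply, LinearMap.compl₁₂_apply]
    simp only [LinearEquiv.refl_apply, lrTwistedMul_tmul, LinearMap.comp_apply,
      LinearEquiv.coe_coe, l.leftTwist_onTensor, r.rightTwist_onTensor, LinearEquiv.trans_apply,
      TensorProduct.assoc_tmul, LinearEquiv.lTensor_tmul, TensorProduct.comm_tmul,
      twoSidedTwistedMul_tmul]
    induction l.leftTwist γ (b ⊗ₜ c') with
    | zero => simp
    | add u v hu hv => simp only [map_add, TensorProduct.tmul_add, TensorProduct.add_tmul, hu, hv]
    | tmul d e =>
      induction r.rightTwist υ (c ⊗ₜ a') with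
      | zero => simp
      | add u v hu hv =>
        simp only [map_add, TensorProduct.tmul_add, TensorProduct.add_tmul, hu, hv]
      | tmul f g => simp
  exact LinearMap.congr_fun (LinearMap.congr_fun h x) y

/-- The map `c ⋄ (a ⊗ b) ↦ a ⋈ c ⋈ b` preserves products. -/
theorem diamondLeft_map_mul (x y : C ⊗[k] (A ⊗[k] B)) :
    TensorProduct.leftComm k C A B (lrTwistedMul (l.leftTwist (γ.onTensor A))
      ((TensorProduct.comm k (A ⊗[k] B) C).toLinearMap ∘ₗ r.rightTwist (υ.onTensor B)) x y) =
    twoSidedTwistedMul (r.rightTwist υ) (l.leftTwist γ) (TensorProduct.leftComm k C A B x)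
      (TensorProduct.leftComm k C A B y) := by
  have h : (lrTwistedMul (l.leftTwist (γ.onTensor A))
      ((TensorProduct.comm k (A ⊗[k] B) C).toLinearMap ∘ₗ r.rightTwist (υ.onTensor B))).compr₂
        (TensorProduct.leftComm k C A B).toLinearMap =
      (twoSidedTwistedMul (r.rightTwist υ) (l.leftTwist γ)).compl₁₂
        (TensorProduct.leftComm k C A B).toLinearMap
        (TensorProduct.leftComm k C A B).toLinearMap := by
    refine bilinear_ext_right (LinearEquiv.refl k _) fun c a b c' a' b' => ?_
    rw [LinearMap.compr₂_apply, LinearMap.compl₁₂_apply]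
    simp only [LinearEquiv.refl_apply, lrTwistedMul_tmul, LinearMap.comp_apply,
      LinearEquiv.coe_coe, l.leftTwist_onTensor, r.rightTwist_onTensor,
      TensorProduct.leftComm_tmul, twoSidedTwistedMul_tmul]
    induction l.leftTwist γ (b ⊗ₜ c') with
    | zero => simp
    | add u v hu hv => simp only [map_add, TensorProduct.tmul_add, hu, hv]
    | tmul d e =>
      induction r.rightTwist υ (c ⊗ₜ a') with
      | zero => simp
      | add u v hu hv =>
        simp only [map_add, TensorProduct.add_tmul, hu, hv]
      | tmul f g => simp
  exact LinearMap.congr_fun (LinearMap.congr_fun h x) y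

end Isomorphisms

end SmashAlgebras

/-! ### Counit and antipode for coactions -/

section CounitAntipode

variable {k Q : Type*} [Field k] [NonUnitalRing Q] [Module k Q]
  [IsScalarTower k Q Q] [SMulCommClass k Q Q] [NondegenerateProduct Q]
variable {B : Type*} [NonUnitalRing B] [Module k B] [IsScalarTower k B B] [SMulCommClass k B B]
  [NondegenerateProduct B]
variable {H : MultiplierHopf k Q}

namespace MultiplierHopf

namespace IsCounit

variable {ε : Q →ₗ[k] k} (hε : H.IsCounit ε)
include hε

theorem sliceLeft_mulRight (y : Q) (w : Q ⊗[k] B) :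
    sliceLeft ε B (LinearMap.rTensor B (LinearMap.mulRight k y) w) = ε y • sliceLeft ε B w := by
  induction w with
  | zero => simp
  | add u v hu hv => simp only [map_add, hu, hv, smul_add]
  | tmul x b => simp [hε.map_mul, smul_smul, mul_comm]

theorem sliceLeft_mulLeft (y : Q) (w : Q ⊗[k] B) :
    sliceLeft ε B (LinearMap.rTensor B (LinearMap.mulLeft k y) w) = ε y • sliceLeft ε B w := by
  induction w with
  | zero => simp
  | add u v hu hv => simp only [map_add, hu, hv, smul_add]
  | tmul x b => simp [hε.map_mul, smul_smul]

theorem sliceRight_mulRight (y : Q) (w : B ⊗[k] Q) :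
    sliceRight ε B (LinearMap.lTensor B (LinearMap.mulRight k y) w) = ε y • sliceRight ε B w := by
  induction w with
  | zero => simp
  | add u v hu hv => simp only [map_add, hu, hv, smul_add]
  | tmul x b => simp [hε.map_mul, smul_smul, mul_comm]

theorem sliceRight_mulLeft (y : Q) (w : B ⊗[k] Q) :
    sliceRight ε B (LinearMap.lTensor B (LinearMap.mulLeft k y) w) = ε y • sliceRight ε B w := by
  induction w with
  | zero => simp
  | add u v hu hv => simp only [map_add, hu, hv, smul_add]
  | tmul x b => simp [hε.map_mul, smul_smul]

end IsCounit

namespace Antipode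

variable (S : H.Antipode)

theorem symm_mul (x y : Q) : S.S.symm (x * y) = S.S.symm y * S.S.symm x := by
  apply S.S.injective
  simp [S.anti_mul]

/-- The identity `S⁻¹(x₂y)x₁ = ε(x)S⁻¹(y)`. -/
theorem symm_T₁ (x y : Q) : LinearMap.mul' k Q (LinearMap.rTensor Q S.S.symm.toLinearMap
    (TensorProduct.comm k Q Q (H.T₁ (x ⊗ₜ y)))) = S.counit x • S.S.symm y := by
  rw [← map_smul, ← S.antipode_T₁]
  induction H.T₁ (x ⊗ₜ y) with
  | zero => simp
  | add u v hu hv => simp only [map_add, hu, hv]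
  | tmul p q => simp [S.symm_mul]

/-- The identity `y₂S⁻¹(xy₁) = ε(y)S⁻¹(x)`. -/
theorem symm_T₂ (x y : Q) : LinearMap.mul' k Q (LinearMap.lTensor Q S.S.symm.toLinearMap
    (TensorProduct.comm k Q Q (H.T₂ (x ⊗ₜ y)))) = S.counit y • S.S.symm x := by
  rw [← map_smul, ← S.antipode_T₂]
  induction H.T₂ (x ⊗ₜ y) with
  | zero => simp
  | add u v hu hv => simp only [map_add, hu, hv]
  | tmul p q => simp [S.symm_mul]

end Antipode

end MultiplierHopf

namespace LeftCoaction.IsComoduleAlgebra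

variable {γ : LeftCoaction k Q B} (hγ : γ.IsComoduleAlgebra H)
include hγ

/-- The counit property `(ε ⊗ ι)Γ(b) = b`: by coassociativity both sides have the same image
under the injective map `Γ`. -/
theorem sliceLeft_coverR {ε : Q →ₗ[k] k} (hε : H.IsCounit ε) (b : B) (z : Q) :
    sliceLeft ε B (γ.coverR b z) = ε z • b := by
  have h1 : ∀ t, LinearMap.rTensor B (sliceLeft ε Q)
      ((TensorProduct.assoc k Q Q B).symm (γ.coverR₂ b t)) = γ.coverR b (sliceLeft ε Q t) := by
    intro t
    obtain ⟨t, rfl⟩ := H.T₁.surjective t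
    induction t with
    | zero => simp
    | add u v hu hv => simp only [map_add, hu, hv]
    | tmul z y =>
      have h2 : γ.coverR₂ b (H.T₁ (z ⊗ₜ y)) = _ := (hγ.coassoc b z y).symm
      rw [h2, LinearEquiv.symm_apply_apply, hε.sliceLeft_T₁, γ.coverR_mul,
        ← LinearMap.rTensor_comp_apply]
      congr 2
      ext q
      simp [hε.sliceLeft_T₁]
  rw [← sub_eq_zero]
  refine (injective_iff_map_eq_zero _).mp hγ.injective _ (coact_eq_zero fun y => ?_)
  have h2 := h1 (z ⊗ₜ y)
  rw [sliceLeft_tmul, γ.coverR₂_tmul, map_smul] at h2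
  rw [map_sub, map_smul, LinearMap.sub_apply, LinearMap.smul_apply, ← h2, sub_eq_zero]
  induction γ.coverR b z with
  | zero => simp
  | add u v hu hv => simp only [map_add, LinearMap.add_apply, hu, hv]
  | tmul p c =>
    simp only [sliceLeft_tmul, map_smul, LinearMap.smul_apply, LinearMap.lTensor_tmul,
      LinearMap.flip_apply]
    induction γ.coverR c y with
    | zero => simp
    | add u v hu hv => simp only [map_add, smul_add, TensorProduct.tmul_add, hu, hv]
    | tmul q d => simp [TensorProduct.smul_tmul']

theorem sliceLeft_coverL {ε : Q →ₗ[k] k} (hε : H.IsCounit ε) (b : B) (z : Q) :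
    sliceLeft ε B (γ.coverL b z) = ε z • b := by
  rcases subsingleton_or_nontrivial Q with hQ | hQ
  · rw [Subsingleton.elim z 0]
    simp
  obtain ⟨e, he⟩ := hε.exists_eq_one
  have := congrArg (sliceLeft ε B) (γ.mulRight_coverL b z e)
  rwa [hε.sliceLeft_mulRight, hε.sliceLeft_mulLeft, hγ.sliceLeft_coverR hε, he, one_smul,
    one_smul] at this

/-- The identity `∑ S(b₍₋₂₎x)b₍₋₁₎ ⊗ b₀ = S(x) ⊗ b`. -/
theorem coverL_antipode_coverR (S : H.Antipode) (b : B) (x : Q) :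
    TensorProduct.lift (γ.coverL.flip ∘ₗ S.S.toLinearMap) (γ.coverR b x) = S.S x ⊗ₜ b := by
  let K : Q ⊗[k] Q →ₗ[k] Q := LinearMap.mul' k Q ∘ₗ LinearMap.rTensor Q S.S.toLinearMap
  have h1 : ∀ t, LinearMap.rTensor B K ((TensorProduct.assoc k Q Q B).symm (γ.coverR₂ b t)) =
      K t ⊗ₜ b := by
    intro t
    obtain ⟨t, rfl⟩ := H.T₁.surjective t
    induction t with
    | zero => simp
    | add u v hu hv => simp only [map_add, TensorProduct.add_tmul, hu, hv]
    | tmul z y =>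
      have h2 : γ.coverR₂ b (H.T₁ (z ⊗ₜ y)) = _ := (hγ.coassoc b z y).symm
      have h3 : ∀ q, K (H.T₁ (q ⊗ₜ y)) = S.counit q • y := fun q => S.antipode_T₁ q y
      rw [h2, LinearEquiv.symm_apply_apply, h3, TensorProduct.smul_tmul,
        ← hγ.sliceLeft_coverR S.isCounit, ← LinearMap.rTensor_comp_apply]
      induction γ.coverR b z with
      | zero => simp
      | add u v hu hv => simp only [map_add, TensorProduct.tmul_add, hu, hv]
      | tmul p c => simp [h3, TensorProduct.smul_tmul]
  rw [← sub_eq_zero]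
  refine rTensor_jointly_injective (fun y => LinearMap.mulRight k y)
    (fun x hx => NondegenerateProduct.left x hx) _ fun y => ?_
  have h2 : ∀ w : Q ⊗[k] B, LinearMap.rTensor B (LinearMap.mulRight k y)
      (TensorProduct.lift (γ.coverL.flip ∘ₗ S.S.toLinearMap) w) = LinearMap.rTensor B K
        ((TensorProduct.assoc k Q Q B).symm (LinearMap.lTensor Q (γ.coverR.flip y) w)) := by
    intro w
    induction w with
    | zero => simp
    | add u v hu hv => simp only [map_add, hu, hv]
    | tmul p c =>
      simp only [TensorProduct.lift.tmul, LinearMap.comp_apply, LinearMap.flip_apply,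
        γ.mulRight_coverL, LinearMap.lTensor_tmul]
      induction γ.coverR c y with
      | zero => simp
      | add u v hu hv => simp only [map_add, TensorProduct.tmul_add, hu, hv]
      | tmul q d => simp [K]
  rw [map_sub, h2, ← γ.coverR₂_tmul, h1]
  simp [K]

/-- The identity `∑ b₍₋₁₎S⁻¹(xb₍₋₂₎) ⊗ b₀ = S⁻¹(x) ⊗ b`. -/
theorem coverR_antipode_coverL (S : H.Antipode) (b : B) (x : Q) :
    TensorProduct.lift (γ.coverR.flip ∘ₗ S.S.symm.toLinearMap) (γ.coverL b x) =
      S.S.symm x ⊗ₜ b := by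
  let K : Q ⊗[k] Q →ₗ[k] Q := LinearMap.mul' k Q ∘ₗ LinearMap.lTensor Q S.S.symm.toLinearMap ∘ₗ
    (TensorProduct.comm k Q Q).toLinearMap
  have h1 : ∀ t, LinearMap.rTensor B K ((TensorProduct.assoc k Q Q B).symm (γ.coverL₂ b t)) =
      K t ⊗ₜ b := by
    intro t
    obtain ⟨t, rfl⟩ := H.T₂.surjective t
    induction t with
    | zero => simp
    | add u v hu hv => simp only [map_add, TensorProduct.add_tmul, hu, hv]
    | tmul y z =>
      have h3 : ∀ q, K (H.T₂ (y ⊗ₜ q)) = S.counit q • S.S.symm y := fun q => S.symm_T₂ y q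
      rw [← hγ.coassoc_coverL, LinearEquiv.symm_apply_apply, h3, TensorProduct.smul_tmul,
        ← hγ.sliceLeft_coverL S.isCounit, ← LinearMap.rTensor_comp_apply]
      induction γ.coverL b z with
      | zero => simp
      | add u v hu hv => simp only [map_add, TensorProduct.tmul_add, hu, hv]
      | tmul p c => simp [h3, TensorProduct.smul_tmul]
  rw [← sub_eq_zero]
  refine rTensor_jointly_injective (fun y => LinearMap.mulLeft k y)
    (fun x hx => NondegenerateProduct.right x hx) _ fun y => ?_
  have h2 : ∀ w : Q ⊗[k] B, LinearMap.rTensor B (LinearMap.mulLeft k y)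
      (TensorProduct.lift (γ.coverR.flip ∘ₗ S.S.symm.toLinearMap) w) = LinearMap.rTensor B K
        ((TensorProduct.assoc k Q Q B).symm (LinearMap.lTensor Q (γ.coverL.flip y) w)) := by
    intro w
    induction w with
    | zero => simp
    | add u v hu hv => simp only [map_add, hu, hv]
    | tmul p c =>
      simp only [TensorProduct.lift.tmul, LinearMap.comp_apply, LinearMap.flip_apply,
        ← γ.mulRight_coverL, LinearMap.lTensor_tmul]
      induction γ.coverL c y with
      | zero => simp
      | add u v hu hv => simp only [map_add, TensorProduct.tmul_add, hu, hv]
      | tmul q d => simp [K]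
  rw [map_sub, h2, ← γ.coverL₂_tmul, h1]
  simp [K]

end LeftCoaction.IsComoduleAlgebra

namespace RightCoaction.IsComoduleAlgebra

variable {υ : RightCoaction k Q B} (hυ : υ.IsComoduleAlgebra H)
include hυ

/-- The counit property `(ι ⊗ ε)Υ(b) = b`. -/
theorem sliceRight_coverL {ε : Q →ₗ[k] k} (hε : H.IsCounit ε) (b : B) (z : Q) :
    sliceRight ε B (υ.coverL b z) = ε z • b := by
  have h1 : ∀ t, LinearMap.lTensor B (sliceRight ε Q) (υ.coverL₂ b t) =
      υ.coverL b (sliceRight ε Q t) := by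
    intro t
    obtain ⟨t, rfl⟩ := H.T₂.surjective t
    induction t with
    | zero => simp
    | add u v hu hv => simp only [map_add, hu, hv]
    | tmul y z =>
      rw [← hυ.coassoc_coverL, hε.sliceRight_T₂, υ.coverL_mul, ← LinearMap.lTensor_comp_apply]
      congr 2
      ext q
      simp [hε.sliceRight_T₂]
  rw [← sub_eq_zero]
  refine (injective_iff_map_eq_zero _).mp hυ.injective _ (coact_eq_zero fun y => ?_)
  have h2 := h1 (y ⊗ₜ z)
  rw [sliceRight_tmul, υ.coverL₂_tmul, map_smul] at h2
  rw [map_sub, map_smul, LinearMap.sub_apply, LinearMap.smul_apply, ← h2, sub_eq_zero]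
  induction υ.coverL b z with
  | zero => simp
  | add u v hu hv => simp only [map_add, LinearMap.add_apply, hu, hv]
  | tmul c p =>
    simp only [sliceRight_tmul, map_smul, LinearMap.smul_apply, LinearMap.rTensor_tmul,
      LinearMap.flip_apply]
    induction υ.coverL c y with
    | zero => simp
    | add u v hu hv => simp only [map_add, smul_add, TensorProduct.add_tmul, hu, hv]
    | tmul d q => simp

theorem sliceRight_coverR {ε : Q →ₗ[k] k} (hε : H.IsCounit ε) (b : B) (z : Q) :
    sliceRight ε B (υ.coverR b z) = ε z • b := by
  rcases subsingleton_or_nontrivial Q with hQ | hQ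
  · rw [Subsingleton.elim z 0]
    simp
  obtain ⟨e, he⟩ := hε.exists_eq_one
  have := congrArg (sliceRight ε B) (υ.mulRight_coverL b e z)
  rwa [hε.sliceRight_mulRight, hε.sliceRight_mulLeft, hυ.sliceRight_coverL hε, he, one_smul,
    one_smul, eq_comm] at this

/-- The identity `∑ b₀ ⊗ b₍₁₎S(xb₍₂₎) = b ⊗ S(x)`. -/
theorem coverR_antipode_coverL (S : H.Antipode) (b : B) (x : Q) :
    TensorProduct.lift (υ.coverR.compl₂ S.S.toLinearMap) (υ.coverL b x) = b ⊗ₜ S.S x := by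
  let K : Q ⊗[k] Q →ₗ[k] Q := LinearMap.mul' k Q ∘ₗ LinearMap.lTensor Q S.S.toLinearMap
  have h1 : ∀ t, LinearMap.lTensor B K (υ.coverL₂ b t) = b ⊗ₜ K t := by
    intro t
    obtain ⟨t, rfl⟩ := H.T₂.surjective t
    induction t with
    | zero => simp
    | add u v hu hv => simp only [map_add, TensorProduct.tmul_add, hu, hv]
    | tmul y z =>
      have h3 : ∀ q, K (H.T₂ (y ⊗ₜ q)) = S.counit q • y := fun q => S.antipode_T₂ y q
      rw [← hυ.coassoc_coverL, h3, ← TensorProduct.smul_tmul, ← hυ.sliceRight_coverL S.isCounit,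
        ← LinearMap.lTensor_comp_apply]
      induction υ.coverL b z with
      | zero => simp
      | add u v hu hv => simp only [map_add, TensorProduct.add_tmul, hu, hv]
      | tmul c p => simp [h3, TensorProduct.smul_tmul]
  rw [← sub_eq_zero]
  refine lTensor_jointly_injective (fun y => LinearMap.mulLeft k y)
    (fun x hx => NondegenerateProduct.right x hx) _ fun y => ?_
  have h2 : ∀ w : B ⊗[k] Q, LinearMap.lTensor B (LinearMap.mulLeft k y)
      (TensorProduct.lift (υ.coverR.compl₂ S.S.toLinearMap) w) = LinearMap.lTensor B K
        (TensorProduct.assoc k B Q Q (LinearMap.rTensor Q (υ.coverL.flip y) w)) := by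
    intro w
    induction w with
    | zero => simp
    | add u v hu hv => simp only [map_add, hu, hv]
    | tmul c p =>
      simp only [TensorProduct.lift.tmul, LinearMap.compl₂_apply, LinearMap.flip_apply,
        ← υ.mulRight_coverL, LinearMap.rTensor_tmul]
      induction υ.coverL c y with
      | zero => simp
      | add u v hu hv => simp only [map_add, TensorProduct.add_tmul, hu, hv]
      | tmul d q => simp [K]
  rw [map_sub, h2, ← υ.coverL₂_tmul, h1]
  simp [K]

/-- The identity `∑ b₀ ⊗ S⁻¹(b₍₂₎x)b₍₁₎ = b ⊗ S⁻¹(x)`. -/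
theorem coverL_antipode_coverR (S : H.Antipode) (b : B) (x : Q) :
    TensorProduct.lift (υ.coverL.compl₂ S.S.symm.toLinearMap) (υ.coverR b x) =
      b ⊗ₜ S.S.symm x := by
  let K : Q ⊗[k] Q →ₗ[k] Q := LinearMap.mul' k Q ∘ₗ LinearMap.rTensor Q S.S.symm.toLinearMap ∘ₗ
    (TensorProduct.comm k Q Q).toLinearMap
  have h1 : ∀ t, LinearMap.lTensor B K (υ.coverR₂ b t) = b ⊗ₜ K t := by
    intro t
    obtain ⟨t, rfl⟩ := H.T₁.surjective t
    induction t with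
    | zero => simp
    | add u v hu hv => simp only [map_add, TensorProduct.tmul_add, hu, hv]
    | tmul z y =>
      have h2 : υ.coverR₂ b (H.T₁ (z ⊗ₜ y)) = _ := (hυ.coassoc b z y).symm
      have h3 : ∀ q, K (H.T₁ (q ⊗ₜ y)) = S.counit q • S.S.symm y := fun q => S.symm_T₁ q y
      rw [h2, h3, ← TensorProduct.smul_tmul, ← hυ.sliceRight_coverR S.isCounit,
        ← LinearMap.lTensor_comp_apply]
      induction υ.coverR b z with
      | zero => simp
      | add u v hu hv => simp only [map_add, TensorProduct.add_tmul, hu, hv]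
      | tmul c p => simp [h3, TensorProduct.smul_tmul]
  rw [← sub_eq_zero]
  refine lTensor_jointly_injective (fun y => LinearMap.mulRight k y)
    (fun x hx => NondegenerateProduct.left x hx) _ fun y => ?_
  have h2 : ∀ w : B ⊗[k] Q, LinearMap.lTensor B (LinearMap.mulRight k y)
      (TensorProduct.lift (υ.coverL.compl₂ S.S.symm.toLinearMap) w) = LinearMap.lTensor B K
        (TensorProduct.assoc k B Q Q (LinearMap.rTensor Q (υ.coverR.flip y) w)) := by
    intro w
    induction w with
    | zero => simp
    | add u v hu hv => simp only [map_add, hu, hv]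
    | tmul c p =>
      simp only [TensorProduct.lift.tmul, LinearMap.compl₂_apply, LinearMap.flip_apply,
        υ.mulRight_coverL, LinearMap.rTensor_tmul]
      induction υ.coverR c y with
      | zero => simp
      | add u v hu hv => simp only [map_add, TensorProduct.add_tmul, hu, hv]
      | tmul d q => simp [K]
  rw [map_sub, h2, ← υ.coverR₂_tmul, h1]
  simp [K]

end RightCoaction.IsComoduleAlgebra

end CounitAntipode

/-! ### The inverses of the twists -/

section InverseTwists

variable {k Q : Type*} [Field k] [NonUnitalRing Q] [Module k Q]
  [IsScalarTower k Q Q] [SMulCommClass k Q Q] [NondegenerateProduct Q] [LocalUnits Q]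
variable {B : Type*} [NonUnitalRing B] [Module k B] [IsScalarTower k B B] [SMulCommClass k B B]
  [NondegenerateProduct B]
variable {V : Type*} [AddCommGroup V] [Module k V] {H : MultiplierHopf k Q}

theorem UnitalLeftModule.leftTwist_leftTwist_invAntipode (M : UnitalLeftModule k Q V)
    {γ : LeftCoaction k Q B} (hγ : γ.IsComoduleAlgebra H) (S : H.Antipode) (b : B) (v : V) :
    M.leftTwist γ (TensorProduct.comm k V B ((M.invAntipode S).leftTwist γ (b ⊗ₜ v))) =
      v ⊗ₜ b := by
  induction v using (M.invAntipode S).induction_on with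
  | zero => simp
  | add u v hu hv => simp only [TensorProduct.tmul_add, TensorProduct.add_tmul, map_add, hu, hv]
  | act x w =>
    have h1 : ∀ z : Q ⊗[k] B, M.leftTwist γ (TensorProduct.comm k V B
        (LinearMap.rTensor B ((M.invAntipode S).act.flip w) z)) =
        LinearMap.rTensor B (M.act.flip w)
          (TensorProduct.lift (γ.coverR.flip ∘ₗ S.S.symm.toLinearMap) z) := by
      intro z
      induction z with
      | zero => simp
      | add u v hu hv => simp only [map_add, hu, hv]
      | tmul p c => exact M.leftTwist_tmul γ c (S.S.symm p) w
    rw [(M.invAntipode S).leftTwist_tmul, h1, hγ.coverR_antipode_coverL]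
    rfl

theorem UnitalLeftModule.leftTwist_invAntipode_leftTwist (M : UnitalLeftModule k Q V)
    {γ : LeftCoaction k Q B} (hγ : γ.IsComoduleAlgebra H) (S : H.Antipode) (b : B) (v : V) :
    (M.invAntipode S).leftTwist γ (TensorProduct.comm k V B (M.leftTwist γ (b ⊗ₜ v))) =
      v ⊗ₜ b := by
  induction v using M.induction_on with
  | zero => simp
  | add u v hu hv => simp only [TensorProduct.tmul_add, TensorProduct.add_tmul, map_add, hu, hv]
  | act x w =>
    have h2 : ∀ p, (M.invAntipode S).act (S.S p) w = M.act p w := fun p =>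
      congrArg (M.act · w) (S.S.symm_apply_apply p)
    have h1 : ∀ z : Q ⊗[k] B, (M.invAntipode S).leftTwist γ (TensorProduct.comm k V B
        (LinearMap.rTensor B (M.act.flip w) z)) =
        LinearMap.rTensor B ((M.invAntipode S).act.flip w)
          (TensorProduct.lift (γ.coverL.flip ∘ₗ S.S.toLinearMap) z) := by
      intro z
      induction z with
      | zero => simp
      | add u v hu hv => simp only [map_add, hu, hv]
      | tmul p c =>
        rw [LinearMap.rTensor_tmul, TensorProduct.comm_tmul, LinearMap.flip_apply, ← h2,
          (M.invAntipode S).leftTwist_tmul]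
        rfl
    rw [M.leftTwist_tmul, h1, hγ.coverL_antipode_coverR, LinearMap.rTensor_tmul,
      LinearMap.flip_apply, h2]

theorem UnitalRightModule.rightTwist_rightTwist_invAntipode (M : UnitalRightModule k Q V)
    {υ : RightCoaction k Q B} (hυ : υ.IsComoduleAlgebra H) (S : H.Antipode) (b : B) (v : V) :
    M.rightTwist υ (TensorProduct.comm k B V ((M.invAntipode S).rightTwist υ (v ⊗ₜ b))) =
      b ⊗ₜ v := by
  induction v using (M.invAntipode S).induction_on with
  | zero => simp
  | add u v hu hv => simp only [TensorProduct.tmul_add, TensorProduct.add_tmul, map_add, hu, hv]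
  | act x w =>
    have h1 : ∀ z : B ⊗[k] Q, M.rightTwist υ (TensorProduct.comm k B V
        (LinearMap.lTensor B ((M.invAntipode S).act.flip w) z)) =
        LinearMap.lTensor B (M.act.flip w)
          (TensorProduct.lift (υ.coverL.compl₂ S.S.symm.toLinearMap) z) := by
      intro z
      induction z with
      | zero => simp
      | add u v hu hv => simp only [map_add, hu, hv]
      | tmul c p => exact M.rightTwist_tmul υ c (S.S.symm p) w
    rw [(M.invAntipode S).rightTwist_tmul, h1, hυ.coverL_antipode_coverR]
    rfl

theorem UnitalRightModule.rightTwist_invAntipode_rightTwist (M : UnitalRightModule k Q V)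
    {υ : RightCoaction k Q B} (hυ : υ.IsComoduleAlgebra H) (S : H.Antipode) (b : B) (v : V) :
    (M.invAntipode S).rightTwist υ (TensorProduct.comm k B V (M.rightTwist υ (v ⊗ₜ b))) =
      b ⊗ₜ v := by
  induction v using M.induction_on with
  | zero => simp
  | add u v hu hv => simp only [TensorProduct.tmul_add, TensorProduct.add_tmul, map_add, hu, hv]
  | act x w =>
    have h2 : ∀ p, (M.invAntipode S).act (S.S p) w = M.act p w := fun p =>
      congrArg (M.act · w) (S.S.symm_apply_apply p)
    have h1 : ∀ z : B ⊗[k] Q, (M.invAntipode S).rightTwist υ (TensorProduct.comm k B V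
        (LinearMap.lTensor B (M.act.flip w) z)) =
        LinearMap.lTensor B ((M.invAntipode S).act.flip w)
          (TensorProduct.lift (υ.coverR.compl₂ S.S.toLinearMap) z) := by
      intro z
      induction z with
      | zero => simp
      | add u v hu hv => simp only [map_add, hu, hv]
      | tmul c p =>
        rw [LinearMap.lTensor_tmul, TensorProduct.comm_tmul, LinearMap.flip_apply, ← h2,
          (M.invAntipode S).rightTwist_tmul]
        rfl
    rw [M.rightTwist_tmul, h1, hυ.coverR_antipode_coverL, LinearMap.lTensor_tmul,
      LinearMap.flip_apply, h2]

/-- The twist `b ⊗ v ↦ ∑ (b₍₋₁₎ ▷ v) ⊗ b₀` as a linear isomorphism, with inverse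
`v ⊗ b ↦ ∑ b₀ ⊗ (S⁻¹(b₍₋₁₎) ▷ v)`. -/
def UnitalLeftModule.leftTwistEquiv (M : UnitalLeftModule k Q V)
    {γ : LeftCoaction k Q B} (hγ : γ.IsComoduleAlgebra H) (S : H.Antipode) :
    B ⊗[k] V ≃ₗ[k] V ⊗[k] B :=
  LinearEquiv.ofLinearMap (M.leftTwist γ)
    ((TensorProduct.comm k V B).toLinearMap ∘ₗ (M.invAntipode S).leftTwist γ ∘ₗ
      (TensorProduct.comm k V B).toLinearMap)
    (TensorProduct.ext' fun v b => M.leftTwist_leftTwist_invAntipode hγ S b v)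
    (TensorProduct.ext' fun b v =>
      congrArg (TensorProduct.comm k V B) (M.leftTwist_invAntipode_leftTwist hγ S b v))

/-- The twist `v ⊗ b ↦ ∑ b₀ ⊗ (v ◁ b₍₁₎)` as a linear isomorphism, with inverse
`b ⊗ v ↦ ∑ (v ◁ S⁻¹(b₍₁₎)) ⊗ b₀`. -/
def UnitalRightModule.rightTwistEquiv (M : UnitalRightModule k Q V)
    {υ : RightCoaction k Q B} (hυ : υ.IsComoduleAlgebra H) (S : H.Antipode) :
    V ⊗[k] B ≃ₗ[k] B ⊗[k] V :=
  LinearEquiv.ofLinearMap (M.rightTwist υ)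
    ((TensorProduct.comm k B V).toLinearMap ∘ₗ (M.invAntipode S).rightTwist υ ∘ₗ
      (TensorProduct.comm k B V).toLinearMap)
    (TensorProduct.ext' fun b v => M.rightTwist_rightTwist_invAntipode hυ S b v)
    (TensorProduct.ext' fun v b =>
      congrArg (TensorProduct.comm k B V) (M.rightTwist_invAntipode_rightTwist hυ S b v))

end InverseTwists

/-! ### The twisted smash products -/

section TwistedSmashProducts

variable {k Q : Type*} [Field k] [NonUnitalRing Q] [Module k Q]
  [IsScalarTower k Q Q] [SMulCommClass k Q Q] [NondegenerateProduct Q] [LocalUnits Q]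
variable {A : Type*} [NonUnitalRing A] [Module k A] [IsScalarTower k A A] [SMulCommClass k A A]
  [NondegenerateProduct A]
variable {B : Type*} [NonUnitalRing B] [Module k B] [IsScalarTower k B B] [SMulCommClass k B B]
  [NondegenerateProduct B]

/-- Twisting `V` past `A` commutes with twisting it past `B`, provided that the twist `R` with `A`
commutes with the action of `Q` that the twist `T` with `B` is made of. -/
theorem leftTwist_comm_of_natural {V : Type*} [AddCommGroup V] [Module k V]
    {act : Q →ₗ[k] V →ₗ[k] V} (hact : Function.Surjective (TensorProduct.lift act))
    {cover : B →ₗ[k] Q →ₗ[k] Q ⊗[k] B} {T : B ⊗[k] V →ₗ[k] V ⊗[k] B}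
    (hT : ∀ b x v, T (b ⊗ₜ act x v) = LinearMap.rTensor B (act.flip v) (cover b x))
    {R : V ⊗[k] A →ₗ[k] A ⊗[k] V}
    (hR : ∀ x v a, R (act x v ⊗ₜ a) = LinearMap.lTensor A (act x) (R (v ⊗ₜ a)))
    (a : A) (b : B) (v : V) :
    LinearMap.lTensor A (T ∘ₗ TensorProduct.mk k B V b) (R (v ⊗ₜ a)) =
      TensorProduct.assoc k A V B
        (LinearMap.rTensor B (R ∘ₗ (TensorProduct.mk k V A).flip a) (T (b ⊗ₜ v))) := by
  obtain ⟨t, rfl⟩ := hact v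
  induction t with
  | zero => simp
  | add u v hu hv => simp only [TensorProduct.tmul_add, TensorProduct.add_tmul, map_add, hu, hv]
  | tmul x w =>
    have hR' : (R ∘ₗ (TensorProduct.mk k V A).flip a) ∘ₗ act.flip w =
        (LinearMap.lTensorHom A ∘ₗ act).flip (R (w ⊗ₜ a)) := by
      ext p
      simp [hR]
    rw [TensorProduct.lift.tmul, hR, hT, ← LinearMap.rTensor_comp_apply, hR']
    induction R (w ⊗ₜ a) with
    | zero => simp
    | add u v hu hv => simp only [map_add, LinearMap.rTensor_add, LinearMap.add_apply, hu, hv]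
    | tmul f g =>
      simp only [LinearMap.lTensor_tmul, LinearMap.comp_apply, TensorProduct.mk_apply, hT]
      induction cover b x with
      | zero => simp
      | add u v hu hv => simp only [map_add, TensorProduct.tmul_add, hu, hv]
      | tmul p e => simp

section Isomorphisms

variable {C : Type*} [NonUnitalRing C] [Module k C] [IsScalarTower k C C] [SMulCommClass k C C]
variable {H : MultiplierHopf k Q} (S : H.Antipode)
  (υ : RightCoaction k Q A) (γ : LeftCoaction k Q B)
  {l : UnitalLeftModule k Q C} {r : UnitalRightModule k Q C}

/-- Twisting `C` past `A` commutes with the twist by `S⁻¹` past `B`. -/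
theorem leftTwist_invAntipode_comm (hlr : ∀ x y c, r.act y (l.act x c) = l.act x (r.act y c))
    (a : A) (b : B) (c : C) :
    LinearMap.lTensor A ((l.invAntipode S).leftTwist γ ∘ₗ TensorProduct.mk k B C b)
        (r.rightTwist υ (c ⊗ₜ a)) =
      TensorProduct.assoc k A C B (LinearMap.rTensor B
        (r.rightTwist υ ∘ₗ (TensorProduct.mk k C A).flip a)
        ((l.invAntipode S).leftTwist γ (b ⊗ₜ c))) :=
  leftTwist_comm_of_natural (l.invAntipode S).unital ((l.invAntipode S).leftTwist_tmul γ)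
    (fun x v a => r.rightTwist_map r υ (l.act (S.S.symm x))
      (fun y v => (hlr _ y v).symm) a v) a b c

/-- The twist by `S⁻¹` of `C` past `A` commutes with twisting `C` past `B`. -/
theorem rightTwist_invAntipode_comm (hlr : ∀ x y c, r.act y (l.act x c) = l.act x (r.act y c))
    (a : A) (b : B) (c : C) :
    LinearMap.lTensor A (l.leftTwist γ ∘ₗ TensorProduct.mk k B C b)
        ((r.invAntipode S).rightTwist υ (c ⊗ₜ a)) =
      TensorProduct.assoc k A C B (LinearMap.rTensor B
        ((r.invAntipode S).rightTwist υ ∘ₗ (TensorProduct.mk k C A).flip a)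
        (l.leftTwist γ (b ⊗ₜ c))) :=
  leftTwist_comm_of_natural l.unital (l.leftTwist_tmul γ)
    (fun x v a => (r.invAntipode S).rightTwist_map (r.invAntipode S) υ (l.act x)
      (fun _ v => (hlr x _ v).symm) a v) a b c

variable (r) in
/-- The canonical map `(A ⊗ B) ⊗ C → B ⊗ (A #_r C)`. -/
def starRightComm : (A ⊗[k] B) ⊗[k] C ≃ₗ[k] B ⊗[k] SmashRight υ r :=
  TensorProduct.congr (TensorProduct.comm k A B) (LinearEquiv.refl k C) ≪≫ₗ
    TensorProduct.assoc k B A C ≪≫ₗ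
    TensorProduct.congr (LinearEquiv.refl k B) (AlgebraOn.of _)

theorem starRightComm_tmul (a : A) (b : B) (c : C) :
    starRightComm υ r ((a ⊗ₜ b) ⊗ₜ c) = b ⊗ₜ AlgebraOn.of _ (a ⊗ₜ c) :=
  rfl

/-- The canonical map identifies `(A ⊗ B) ⋆_r C` with `B ⊗ (A #_r C)`, twisted by the inverse of the
twist of `(A #_r C) #_l B`. -/
theorem starRightComm_twistedMul (hlr : ∀ x y c, r.act y (l.act x c) = l.act x (r.act y c))
    (x y : (A ⊗[k] B) ⊗[k] C) :
    starRightComm υ r (twistedMul ((TensorProduct.comm k C (A ⊗[k] B)).toLinearMap ∘ₗ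
      (l.invAntipode S).leftTwist (γ.onTensor A) ∘ₗ r.rightTwist (υ.onTensor B)) x y) =
    twistedMul ((TensorProduct.comm k (SmashRight υ r) B).toLinearMap ∘ₗ
      ((smashRightLeftModule υ l r).invAntipode S).leftTwist γ ∘ₗ
      (TensorProduct.comm k (SmashRight υ r) B).toLinearMap)
      (starRightComm υ r x) (starRightComm υ r y) := by
  have h : (twistedMul ((TensorProduct.comm k C (A ⊗[k] B)).toLinearMap ∘ₗ
      (l.invAntipode S).leftTwist (γ.onTensor A) ∘ₗ r.rightTwist (υ.onTensor B))).compr₂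
        (starRightComm υ r).toLinearMap =
      (twistedMul ((TensorProduct.comm k (SmashRight υ r) B).toLinearMap ∘ₗ
        ((smashRightLeftModule υ l r).invAntipode S).leftTwist γ ∘ₗ
        (TensorProduct.comm k (SmashRight υ r) B).toLinearMap)).compl₁₂
        (starRightComm υ r).toLinearMap (starRightComm υ r).toLinearMap := by
    refine bilinear_ext_left (LinearEquiv.refl k _) fun a b c a' b' c' => ?_
    -- both products are the image under `G` of one side of the exchange identity
    let G : A ⊗[k] (C ⊗[k] B) →ₗ[k] B ⊗[k] SmashRight υ r :=
      (starRightComm υ r).toLinearMap ∘ₗ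
        TensorProduct.map (LinearMap.mulLeft k (a ⊗ₜ[k] b)) (LinearMap.mulRight k c') ∘ₗ
        (TensorProduct.assoc k A B C).symm.toLinearMap ∘ₗ
        LinearMap.lTensor A (TensorProduct.comm k C B).toLinearMap
    have h1 : ((smashRightLeftModule υ l r).invAntipode S).leftTwist γ
        (b' ⊗ₜ AlgebraOn.of _ (a ⊗ₜ c)) = LinearMap.rTensor B
          ((AlgebraOn.of _).toLinearMap ∘ₗ TensorProduct.mk k A C a)
          ((l.invAntipode S).leftTwist γ (b' ⊗ₜ c)) :=
      (l.invAntipode S).leftTwist_map ((smashRightLeftModule υ l r).invAntipode S) γ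
        ((AlgebraOn.of _).toLinearMap ∘ₗ TensorProduct.mk k A C a) (fun _ _ => rfl) b' c
    have h2 := congrArg G (leftTwist_invAntipode_comm S υ γ hlr a' b' c)
    simp only [LinearMap.compr₂_apply, LinearMap.compl₁₂_apply, LinearEquiv.refl_apply,
      LinearEquiv.coe_coe, starRightComm_tmul, twistedMul_tmul, LinearMap.comp_apply,
      TensorProduct.comm_tmul, h1, r.rightTwist_onTensor]
    trans G (LinearMap.lTensor A ((l.invAntipode S).leftTwist γ ∘ₗ TensorProduct.mk k B C b')
        (r.rightTwist υ (c ⊗ₜ a')))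
    · induction r.rightTwist υ (c ⊗ₜ a') with
      | zero => simp
      | add u v hu hv => simp only [map_add, TensorProduct.add_tmul, hu, hv]
      | tmul f g =>
        simp only [TensorProduct.rightComm_tmul, (l.invAntipode S).leftTwist_onTensor,
          LinearMap.lTensor_tmul, LinearMap.comp_apply, TensorProduct.mk_apply]
        induction (l.invAntipode S).leftTwist γ (b' ⊗ₜ g) with
        | zero => simp
        | add u v hu hv => simp only [map_add, TensorProduct.tmul_add, hu, hv]
        | tmul d e => simp [G]
    rw [h2]
    induction (l.invAntipode S).leftTwist γ (b' ⊗ₜ c) with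
    | zero => simp
    | add u v hu hv => simp only [map_add, hu, hv]
    | tmul d e =>
      simp only [LinearMap.rTensor_tmul, LinearMap.comp_apply, LinearEquiv.coe_coe,
        TensorProduct.mk_apply, LinearMap.flip_apply, TensorProduct.comm_tmul,
        TensorProduct.map_tmul, LinearMap.mulRight_apply, smashRight_of_mul_of]
      induction r.rightTwist υ (d ⊗ₜ a') with
      | zero => simp
      | add u v hu hv => simp only [map_add, TensorProduct.add_tmul, TensorProduct.tmul_add, hu, hv]
      | tmul f g => simp [G, starRightComm_tmul]
  exact LinearMap.congr_fun (LinearMap.congr_fun h x) y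

variable (l) in
/-- The canonical map `C ⊗ (A ⊗ B) → (C #_l B) ⊗ A`. -/
def starLeftComm : C ⊗[k] (A ⊗[k] B) ≃ₗ[k] SmashLeft l γ ⊗[k] A :=
  TensorProduct.congr (LinearEquiv.refl k C) (TensorProduct.comm k A B) ≪≫ₗ
    (TensorProduct.assoc k C B A).symm ≪≫ₗ
    TensorProduct.congr (AlgebraOn.of _) (LinearEquiv.refl k A)

theorem starLeftComm_tmul (a : A) (b : B) (c : C) :
    starLeftComm γ l (c ⊗ₜ (a ⊗ₜ b)) = AlgebraOn.of _ (c ⊗ₜ b) ⊗ₜ a :=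
  rfl

/-- The canonical map identifies `C ⋆_l (A ⊗ B)` with `(C #_l B) ⊗ A`, twisted by the inverse of the
twist of `A #_r (C #_l B)`. -/
theorem starLeftComm_twistedMul (hlr : ∀ x y c, r.act y (l.act x c) = l.act x (r.act y c))
    (x y : C ⊗[k] (A ⊗[k] B)) :
    starLeftComm γ l (twistedMul ((TensorProduct.comm k (A ⊗[k] B) C).toLinearMap ∘ₗ
      (r.invAntipode S).rightTwist (υ.onTensor B) ∘ₗ l.leftTwist (γ.onTensor A)) x y) =
    twistedMul ((TensorProduct.comm k A (SmashLeft l γ)).toLinearMap ∘ₗ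
      ((smashLeftRightModule γ l r).invAntipode S).rightTwist υ ∘ₗ
      (TensorProduct.comm k A (SmashLeft l γ)).toLinearMap)
      (starLeftComm γ l x) (starLeftComm γ l y) := by
  have h : (twistedMul ((TensorProduct.comm k (A ⊗[k] B) C).toLinearMap ∘ₗ
      (r.invAntipode S).rightTwist (υ.onTensor B) ∘ₗ l.leftTwist (γ.onTensor A))).compr₂
        (starLeftComm γ l).toLinearMap =
      (twistedMul ((TensorProduct.comm k A (SmashLeft l γ)).toLinearMap ∘ₗ
        ((smashLeftRightModule γ l r).invAntipode S).rightTwist υ ∘ₗ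
        (TensorProduct.comm k A (SmashLeft l γ)).toLinearMap)).compl₁₂
        (starLeftComm γ l).toLinearMap (starLeftComm γ l).toLinearMap := by
    refine bilinear_ext_right (LinearEquiv.refl k _) fun c a b c' a' b' => ?_
    -- both products are the image under `G` of one side of the exchange identity
    let G : A ⊗[k] (C ⊗[k] B) →ₗ[k] SmashLeft l γ ⊗[k] A :=
      (starLeftComm γ l).toLinearMap ∘ₗ
        TensorProduct.map (LinearMap.mulLeft k c) (LinearMap.mulRight k (a' ⊗ₜ[k] b')) ∘ₗ
        (TensorProduct.leftComm k A C B).toLinearMap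
    have h1 : ((smashLeftRightModule γ l r).invAntipode S).rightTwist υ
        (AlgebraOn.of _ (c' ⊗ₜ b') ⊗ₜ a) = LinearMap.lTensor A
          ((AlgebraOn.of _).toLinearMap ∘ₗ (TensorProduct.mk k C B).flip b')
          ((r.invAntipode S).rightTwist υ (c' ⊗ₜ a)) :=
      (r.invAntipode S).rightTwist_map ((smashLeftRightModule γ l r).invAntipode S) υ
        ((AlgebraOn.of _).toLinearMap ∘ₗ (TensorProduct.mk k C B).flip b') (fun _ _ => rfl) a c'
    have h2 := congrArg G (rightTwist_invAntipode_comm S υ γ hlr a b c')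
    simp only [LinearMap.compr₂_apply, LinearMap.compl₁₂_apply, LinearEquiv.refl_apply,
      LinearEquiv.coe_coe, starLeftComm_tmul, twistedMul_tmul, LinearMap.comp_apply,
      TensorProduct.comm_tmul, h1, l.leftTwist_onTensor]
    trans G (LinearMap.lTensor A (l.leftTwist γ ∘ₗ TensorProduct.mk k B C b)
        ((r.invAntipode S).rightTwist υ (c' ⊗ₜ a)))
    · rw [h2]
      induction l.leftTwist γ (b ⊗ₜ c') with
      | zero => simp
      | add u v hu hv => simp only [map_add, TensorProduct.tmul_add, hu, hv]
      | tmul d e =>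
        simp only [TensorProduct.leftComm_tmul, (r.invAntipode S).rightTwist_onTensor,
          LinearMap.rTensor_tmul, LinearMap.comp_apply, TensorProduct.mk_apply,
          LinearMap.flip_apply]
        induction (r.invAntipode S).rightTwist υ (d ⊗ₜ a) with
        | zero => simp
        | add u v hu hv => simp only [map_add, TensorProduct.add_tmul, hu, hv]
        | tmul f g => simp [G]
    induction (r.invAntipode S).rightTwist υ (c' ⊗ₜ a) with
    | zero => simp
    | add u v hu hv => simp only [map_add, hu, hv]
    | tmul f g =>
      simp only [LinearMap.lTensor_tmul, LinearMap.comp_apply, LinearEquiv.coe_coe,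
        TensorProduct.mk_apply, LinearMap.flip_apply, TensorProduct.comm_tmul,
        TensorProduct.map_tmul, LinearMap.mulLeft_apply, smashLeft_of_mul_of]
      induction l.leftTwist γ (b ⊗ₜ g) with
      | zero => simp
      | add u v hu hv => simp only [map_add, TensorProduct.add_tmul, TensorProduct.tmul_add, hu, hv]
      | tmul d e => simp [G, starLeftComm_tmul]
  exact LinearMap.congr_fun (LinearMap.congr_fun h x) y

variable {υ γ}

/-- The isomorphism `(A ⊗ B) ⋆_r C ≅ (A ⊗ B) ⋄_r C`: through `(A #_r C) #_l B`, it is the twist of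
`B` and `A #_r C`. -/
theorem starRight_isomorphic_diamondRight (hγ : γ.IsComoduleAlgebra H)
    (hC : IsBimoduleAlgebra H l r) (υ : RightCoaction k Q A) :
    AlgebraIsomorphic k (StarRight S (γ.onTensor A) (υ.onTensor B) l r)
      (DiamondRight (γ.onTensor A) (υ.onTensor B) l r) := by
  let M := smashRightLeftModule υ l r
  have hT : IsTwistingMap (M.leftTwist γ) := (isModuleAlgebra_smashRight hC υ).isTwistingMap hγ
  refine AlgebraIsomorphic.trans
    (Y := TwoSidedSmash υ γ l r)
    ⟨AlgebraOn.hom (starRightComm υ r ≪≫ₗ M.leftTwistEquiv hγ S ≪≫ₗ smashRightAssoc υ r)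
      fun x y => ?_, AlgebraOn.hom_bijective _ _⟩
    (AlgebraIsomorphic.symm ⟨AlgebraOn.hom _ (diamondRight_map_mul υ γ l r),
      AlgebraOn.hom_bijective _ _⟩)
  rw [LinearEquiv.trans_apply, LinearEquiv.trans_apply, starRightComm_twistedMul S υ γ hC.bimodule]
  have := hT.map_twistedMul_inv (M.leftTwistEquiv hγ S).apply_symm_apply
    (starRightComm υ r x) (starRightComm υ r y)
  exact (congrArg (smashRightAssoc υ r) this).trans (smashRightAssoc_twistedMul υ γ l r _ _)

/-- The isomorphism `C ⋄_l (A ⊗ B) ≅ C ⋆_l (A ⊗ B)`: through `A #_r (C #_l B)`, its inverse is the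
twist of `C #_l B` and `A`. -/
theorem diamondLeft_isomorphic_starLeft (hυ : υ.IsComoduleAlgebra H)
    (hC : IsBimoduleAlgebra H l r) (γ : LeftCoaction k Q B) :
    AlgebraIsomorphic k (DiamondLeft (γ.onTensor A) (υ.onTensor B) l r)
      (StarLeft S (γ.onTensor A) (υ.onTensor B) l r) := by
  let M := smashLeftRightModule γ l r
  have hR : IsTwistingMap (M.rightTwist υ) := (isModuleAlgebra_smashLeft hC γ).isTwistingMap hυ
  refine AlgebraIsomorphic.trans
    (Y := TwoSidedSmash υ γ l r)
    ⟨AlgebraOn.hom _ (diamondLeft_map_mul υ γ l r), AlgebraOn.hom_bijective _ _⟩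
    (AlgebraIsomorphic.symm
      ⟨AlgebraOn.hom (starLeftComm γ l ≪≫ₗ M.rightTwistEquiv hυ S ≪≫ₗ smashLeftAssoc γ l)
        fun x y => ?_, AlgebraOn.hom_bijective _ _⟩)
  rw [LinearEquiv.trans_apply, LinearEquiv.trans_apply, starLeftComm_twistedMul S υ γ hC.bimodule]
  have := hR.map_twistedMul_inv (M.rightTwistEquiv hυ S).apply_symm_apply
    (starLeftComm γ l x) (starLeftComm γ l y)
  exact (congrArg (smashLeftAssoc γ l) this).trans (smashLeftAssoc_twistedMul υ γ l r _ _)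

end Isomorphisms

end TwistedSmashProducts

end

theorem proposition3p2p1 {k Q A B C : Type*} [Field k]
    [NonUnitalRing Q] [Module k Q] [IsScalarTower k Q Q] [SMulCommClass k Q Q]
    [NondegenerateProduct Q] [LocalUnits Q]
    [NonUnitalRing A] [Module k A] [IsScalarTower k A A] [SMulCommClass k A A]
    [NondegenerateProduct A]
    [NonUnitalRing B] [Module k B] [IsScalarTower k B B] [SMulCommClass k B B]
    [NondegenerateProduct B]
    [NonUnitalRing C] [Module k C] [IsScalarTower k C C] [SMulCommClass k C C]
    [NondegenerateProduct C]
    (H : MultiplierHopf k Q)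
    (υ : RightCoaction k Q A) (hA : υ.IsComoduleAlgebra H)
    (γ : LeftCoaction k Q B) (hB : γ.IsComoduleAlgebra H)
    (l : UnitalLeftModule k Q C) (r : UnitalRightModule k Q C) (hC : IsBimoduleAlgebra H l r) :
    -- the algebra `A ⋈ C ⋈ B` is associative
    (∀ x y z : TwoSidedSmash υ γ l r, x * y * z = x * (y * z)) ∧
    -- `A ⊗ B` is a `Q`-bicomodule algebra
    IsBicomoduleAlgebra H (γ.onTensor A) (υ.onTensor B) ∧
    -- (1)
    (∃ φ : DiamondRight (γ.onTensor A) (υ.onTensor B) l r →ₙₐ[k] TwoSidedSmash υ γ l r,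
      Function.Bijective φ ∧ ∀ (a : A) (b : B) (c : C),
        φ (AlgebraOn.of _ ((a ⊗ₜ[k] b) ⊗ₜ[k] c)) = AlgebraOn.of _ (a ⊗ₜ[k] (c ⊗ₜ[k] b))) ∧
    -- (2)
    (∃ ψ : DiamondLeft (γ.onTensor A) (υ.onTensor B) l r →ₙₐ[k] TwoSidedSmash υ γ l r,
      Function.Bijective ψ ∧ ∀ (a : A) (b : B) (c : C),
        ψ (AlgebraOn.of _ (c ⊗ₜ[k] (a ⊗ₜ[k] b))) = AlgebraOn.of _ (a ⊗ₜ[k] (c ⊗ₜ[k] b))) ∧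
    -- (3)
    (H.IsRegular → Nonempty H.Antipode ∧ ∀ S : H.Antipode,
      AlgebraIsomorphic k (StarRight S (γ.onTensor A) (υ.onTensor B) l r)
        (DiamondRight (γ.onTensor A) (υ.onTensor B) l r) ∧
      AlgebraIsomorphic k (DiamondRight (γ.onTensor A) (υ.onTensor B) l r)
        (DiamondLeft (γ.onTensor A) (υ.onTensor B) l r) ∧
      AlgebraIsomorphic k (DiamondLeft (γ.onTensor A) (υ.onTensor B) l r)
        (StarLeft S (γ.onTensor A) (υ.onTensor B) l r)) ∧
    -- (4): the smash products `A #_r C` and `C #_l B` are associative, `A #_r C` is a left and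
    -- `C #_l B` a right `Q`-module algebra, and
    -- `(A #_r C) #_l B = A #_r (C #_l B) = A ⋈ C ⋈ B` under `(a ⊗ c) ⊗ b = a ⊗ (c ⊗ b)`
    (∀ x y z : SmashRight υ r, x * y * z = x * (y * z)) ∧
    (∀ x y z : SmashLeft l γ, x * y * z = x * (y * z)) ∧
    (smashRightLeftModule υ l r).IsModuleAlgebra H ∧
    (smashLeftRightModule γ l r).IsModuleAlgebra H ∧
    (∃ θ : SmashLeft (smashRightLeftModule υ l r) γ →ₙₐ[k] TwoSidedSmash υ γ l r,
      Function.Bijective θ ∧ ∀ (a : A) (b : B) (c : C),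
        θ (AlgebraOn.of _ ((AlgebraOn.of _ (a ⊗ₜ[k] c) : SmashRight υ r) ⊗ₜ[k] b)) =
          AlgebraOn.of _ (a ⊗ₜ[k] (c ⊗ₜ[k] b))) ∧
    (∃ θ : SmashRight υ (smashLeftRightModule γ l r) →ₙₐ[k] TwoSidedSmash υ γ l r,
      Function.Bijective θ ∧ ∀ (a : A) (b : B) (c : C),
        θ (AlgebraOn.of _ (a ⊗ₜ[k] (AlgebraOn.of _ (c ⊗ₜ[k] b) : SmashLeft l γ))) =
          AlgebraOn.of _ (a ⊗ₜ[k] (c ⊗ₜ[k] b))) := by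
  have hV : ∀ x y z : SmashRight υ r, x * y * z = x * (y * z) := AlgebraOn.mul_assoc_of
    ((hC.right.isTwistingMap hA).twistedMul_assoc mul_assoc mul_assoc)
  have hW : ∀ x y z : SmashLeft l γ, x * y * z = x * (y * z) := AlgebraOn.mul_assoc_of
    ((hC.left.isTwistingMap hB).twistedMul_assoc mul_assoc mul_assoc)
  have hM := isModuleAlgebra_smashRight hC υ
  refine ⟨AlgebraOn.mul_assoc_of fun x y z => ?_, isBicomoduleAlgebra_onTensor hA hB,
    ⟨AlgebraOn.hom _ (diamondRight_map_mul υ γ l r), AlgebraOn.hom_bijective _ _,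
      fun a b c => rfl⟩,
    ⟨AlgebraOn.hom _ (diamondLeft_map_mul υ γ l r), AlgebraOn.hom_bijective _ _,
      fun a b c => rfl⟩,
    fun hQ => ⟨hQ.nonempty_antipode, fun S => ⟨starRight_isomorphic_diamondRight S hB hC υ,
      ?_, diamondLeft_isomorphic_starLeft S hA hC γ⟩⟩,
    hV, hW, hM, isModuleAlgebra_smashLeft hC γ,
    ⟨AlgebraOn.hom _ (smashRightAssoc_twistedMul υ γ l r), AlgebraOn.hom_bijective _ _,
      fun a b c => rfl⟩,
    ⟨AlgebraOn.hom _ (smashLeftAssoc_twistedMul υ γ l r), AlgebraOn.hom_bijective _ _,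
      fun a b c => rfl⟩⟩
  -- associativity of the two-sided product is that of `(A #_r C) #_l B`
  · obtain ⟨x, rfl⟩ := (smashRightAssoc υ r).surjective x
    obtain ⟨y, rfl⟩ := (smashRightAssoc υ r).surjective y
    obtain ⟨z, rfl⟩ := (smashRightAssoc υ r).surjective z
    simp only [← smashRightAssoc_twistedMul]
    rw [(hM.isTwistingMap hB).twistedMul_assoc hV mul_assoc]
  · exact AlgebraIsomorphic.trans (Y := TwoSidedSmash υ γ l r)
      ⟨AlgebraOn.hom _ (diamondRight_map_mul υ γ l r), AlgebraOn.hom_bijective _ _⟩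
      (AlgebraIsomorphic.symm ⟨AlgebraOn.hom _ (diamondLeft_map_mul υ γ l r),
        AlgebraOn.hom_bijective _ _⟩)
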